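/- Let $\Gamma$ be a finite simplicial graph with vertex set $I$, let $W=W(\Gamma)$ be the right-angled Coxeter group with defining graph $\Gamma$ (generators $s_i$, $i\in I$; relations $s_i^2=1$, and $s_is_j=s_js_i$ if $i,j$ are adjacent), and let $\mathcal B$ be a building of type $W(\Gamma)$, with $W$-valued distance $\delta$. For $J\subset I$ let $W_J$ be the subgroup generated by $\{s_j\}_{j\in J}$; a $J$-residue is a class of the relation $\delta(c,d)\in W_J$ on chambers, and it is spherical if $W_J$ is finite. For a residue $R$ and a chamber $c$, let $\mathrm{proj}_R(c)$ be the unique chamber $d$ of $R$ for which the word length of $\delta(c,d)$ is minimal. Residues $R,R'$ are parallel if $\mathrm{proj}_R(R')=R$ and $\mathrm{proj}_{R'}(R)=R'$; then $\mathrm{proj}_{R'}|_R:R\to R'$ is a bijection, the parallelism map. Blow-up data on $\mathcal B$ consist of a metric space $Z_r$ for every residue $r$ of rank 1, with $Z_r=Z_{r'}$ for parallel $r,r'$, and of maps $f_r:r\to Z_r$ from the set of chambers of $r$, such that $f_{r'}\circ \mathrm{proj}_{r'}|_r=f_r$ whenever $r,r'$ are parallel. Let $M_r$ be the mapping cylinder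 of $f_r$: the space obtained from the disjoint union of $Z_r$ and of one edge $[0,1]$ for each chamber $c$ of $r$ by identifying the endpoint $1$ of the edge of $c$ with $f_r(c)$, with the quotient metric; the endpoint $0$ of the edge of $c$ is the tip of $c$. For parallel $r,r'$ the spaces $M_r,M_{r'}$ are identified by means of the parallelism map. (If $X$ is a disjoint union of metric spaces, different pieces being at distance $\infty$, and $\sim$ is an equivalence relation on $X$, the quotient pseudo-metric on $X/{\sim}$ is the infimum of $\sum_{k=0}^n d(x_k,y_k)$ over all finite chains $x_0,y_0,\dots,x_n,y_n$ from the first class to the second with $y_k\sim x_{k+1}$.) For a spherical $J$-residue $R=\prod_{j\in J}r_j$, where $r_j$ is a $j$-residue in $R$, let $\Phi(R)=\prod_{j\in J}M_{r_j}$ with the $\ell^2$ product metric. If $R'\subset R$ are spherical residues of types $J'\subset J$, then $R'=\prod_{j\in J'}r_j\times\prod_{j\in J\setminus J'}\{u_j\}$ with chambers $u_j\in r_j$; let $\Phi(R')\to\Phi(R)$ be the map that is the identity on the factors $M_{r_j}$ with $j\in J'$ and whose $j$-th coordinate is the tip of $u_j$ for $j\in J\setminus J'$. The blow-up $\Pi$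 is the quotient of the disjoint union $\bigsqcup_R\Phi(R)$ over all spherical residues $R$ by the equivalence relation generated by identifying each point of $\Phi(R')$ with its image in $\Phi(R)$, for all $R'\subset R$, with the quotient pseudo-metric. Theorem. If every $Z_r$ is CAT(0), then the quotient pseudo-metric on $\Pi$ is a (finite) metric, and $\Pi$ with this metric is CAT(0). -/

import Mathlib

open scoped ENNReal

noncomputable section

/-! ### CAT(0) spaces -/

/-- `γ`, restricted to `[0, dist x y]`, is a geodesic from `x` to `y`. -/
structure IsGeodesicFrom {X : Type*} [MetricSpace X] (γ : ℝ → X) (x y : X) : Prop where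
  source : γ 0 = x
  target : γ (dist x y) = y
  isometry : ∀ s ∈ Set.Icc 0 (dist x y), ∀ t ∈ Set.Icc 0 (dist x y), dist (γ s) (γ t) = |s - t|

/-- A metric space is CAT(0) if any two points are joined by a geodesic and, for every geodesic
triangle, the distance of two points of the triangle is at most the distance of their comparison
points in a Euclidean comparison triangle. Two points of one side have the same distance as their
comparison points, and two different sides have a common vertex `x`; so it is enough to speak of
points on two sides `α = [x, y]` and `β = [x, z]`. -/
structure IsCAT0 (X : Type*) [MetricSpace X] : Prop where
  exists_geodesic : ∀ x y : X, ∃ γ : ℝ → X, IsGeodesicFrom γ x y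
  comparison : ∀ (x y z : X) (α β : ℝ → X), IsGeodesicFrom α x y → IsGeodesicFrom β x z →
    ∀ x' y' z' : EuclideanSpace ℝ (Fin 2),
      dist x' y' = dist x y → dist x' z' = dist x z → dist y' z' = dist y z →
    ∀ s ∈ Set.Icc 0 (dist x y), ∀ t ∈ Set.Icc 0 (dist x z),
    ∀ p ∈ segment ℝ x' y', ∀ q ∈ segment ℝ x' z', dist x' p = s → dist x' q = t →
      dist (α s) (β t) ≤ dist p q

/-! ### Quotient metrics -/

/-- The quotient pseudo-metric on `X / s`: the infimum of `∑ d (x_k) (y_k)` over all finite chains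
`x_0, y_0, x_1, y_1, …, x_n, y_n` with `x_0` in the class `a`, `y_n` in the class `b`, and `y_k`
equivalent to `x_{k+1}`. The distance `d` may take the value `∞`, so that `X` may be a disjoint
union of metric spaces. -/
def quotientEDist {X : Type*} (d : X → X → ℝ≥0∞) (s : Setoid X) (a b : Quotient s) : ℝ≥0∞ :=
  ⨅ (n : ℕ) (x : ℕ → X) (y : ℕ → X) (_ : Quotient.mk s (x 0) = a) (_ : Quotient.mk s (y n) = b)
    (_ : ∀ k < n, s (y k) (x (k + 1))), ∑ k ∈ Finset.range (n + 1), d (x k) (y k)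

section quotientEDist

variable {X : Type*} {d : X → X → ℝ≥0∞} {s : Setoid X}

theorem quotientEDist_le {a b : Quotient s} (n : ℕ) (x y : ℕ → X)
    (h0 : Quotient.mk s (x 0) = a) (hn : Quotient.mk s (y n) = b)
    (h : ∀ k < n, s (y k) (x (k + 1))) :
    quotientEDist d s a b ≤ ∑ k ∈ Finset.range (n + 1), d (x k) (y k) :=
  iInf_le_of_le n <| iInf_le_of_le x <| iInf_le_of_le y <| iInf_le_of_le h0 <|
    iInf_le_of_le hn <| iInf_le_of_le h le_rfl

theorem quotientEDist_self (hd : ∀ x, d x x = 0) (a : Quotient s) :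
    quotientEDist d s a a = 0 := by
  induction a using Quotient.inductionOn with
  | _ x =>
    refine le_antisymm ?_ bot_le
    refine (quotientEDist_le 0 (fun _ => x) (fun _ => x) rfl rfl (by simp)).trans ?_
    simp [hd]

theorem quotientEDist_comm_le (hd : ∀ x y, d x y = d y x) (a b : Quotient s) :
    quotientEDist d s a b ≤ quotientEDist d s b a := by
  refine le_iInf fun n => le_iInf fun x => le_iInf fun y => le_iInf fun h0 => le_iInf fun hn =>
    le_iInf fun h => ?_
  refine (quotientEDist_le n (fun k => y (n - k)) (fun k => x (n - k)) (by simpa using hn)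
    (by simpa using h0) fun k hk => ?_).trans_eq ?_
  · have := h (n - (k + 1)) (by omega)
    rw [show n - (k + 1) + 1 = n - k by omega] at this
    exact s.symm this
  · rw [← Finset.sum_range_reflect (fun k => d (x k) (y k)) (n + 1)]
    refine Finset.sum_congr rfl fun k _ => ?_
    rw [hd, show n + 1 - 1 - k = n - k by omega]

theorem quotientEDist_triangle (a b c : Quotient s) :
    quotientEDist d s a c ≤ quotientEDist d s a b + quotientEDist d s b c := by
  refine ENNReal.le_of_forall_pos_le_add fun ε hε hfin => ?_
  have hε2 : (ε : ℝ≥0∞) / 2 ≠ 0 := by simp [hε.ne']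
  obtain ⟨h1, h2⟩ := ENNReal.add_lt_top.1 hfin
  have l1 := ENNReal.lt_add_right h1.ne hε2
  have l2 := ENNReal.lt_add_right h2.ne hε2
  conv_lhs at l1 => unfold quotientEDist
  conv_lhs at l2 => unfold quotientEDist
  simp only [iInf_lt_iff] at l1 l2
  obtain ⟨n, x, y, h0, hn, h, l1⟩ := l1
  obtain ⟨m, x', y', h0', hm, h', l2⟩ := l2
  refine (quotientEDist_le (n + 1 + m) (fun k => if k < n + 1 then x k else x' (k - (n + 1)))
    (fun k => if k < n + 1 then y k else y' (k - (n + 1))) (by simpa using h0)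
    (by simpa [show ¬ n + 1 + m ≤ n by omega] using hm) ?_).trans ?_
  · intro k hk
    rcases lt_trichotomy k n with hkn | hkn | hkn
    · simpa [hkn, show k < n + 1 by omega] using h k hkn
    · subst hkn
      simpa using Quotient.exact (hn.trans h0'.symm)
    · have := h' (k - (n + 1)) (by omega)
      simpa [show ¬ k < n + 1 by omega, show ¬ k < n by omega,
        show k + 1 - (n + 1) = k - (n + 1) + 1 by omega] using this
  · rw [show n + 1 + m + 1 = (n + 1) + (m + 1) by omega, Finset.sum_range_add]
    calc _ = (∑ k ∈ Finset.range (n + 1), d (x k) (y k))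
          + ∑ k ∈ Finset.range (m + 1), d (x' k) (y' k) := by
          congr 1
          · refine Finset.sum_congr rfl fun k hk => ?_
            simp [Finset.mem_range.1 hk]
          · refine Finset.sum_congr rfl fun k hk => ?_
            simp [show ¬ n + 1 + k ≤ n by omega]
      _ ≤ (quotientEDist d s a b + ε / 2) + (quotientEDist d s b c + ε / 2) :=
          add_le_add l1.le l2.le
      _ = _ := by rw [add_add_add_comm, ENNReal.add_halves]

end quotientEDist

/-! ### Mapping cylinders -/

/-- The disjoint union of `Z` and of one unit edge for each `c : R`. -/
inductive PreCylinder (R Z : Type*)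
  | base (z : Z)
  | edge (c : R) (t : unitInterval)

namespace PreCylinder

variable {R Z : Type*}

open Classical in
/-- The metric of the disjoint union: points of different pieces have distance `∞`. -/
def preDist [MetricSpace Z] : PreCylinder R Z → PreCylinder R Z → ℝ≥0∞
  | base z, base z' => edist z z'
  | edge c t, edge c' t' => if c = c' then edist t t' else ⊤
  | _, _ => ⊤

theorem preDist_self [MetricSpace Z] (x : PreCylinder R Z) : preDist x x = 0 := by
  cases x <;> simp [preDist]

theorem preDist_comm [MetricSpace Z] (x y : PreCylinder R Z) : preDist x y = preDist y x := by
  rcases x with z | ⟨c, t⟩ <;> rcases y with z' | ⟨c', t'⟩ <;> simp only [preDist, edist_comm]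
  by_cases h : c = c'
  · simp [h]
  · simp [h, Ne.symm h]

/-- The end `t = 1` of the edge of `c` is attached to `f c`. -/
inductive Attach (f : R → Z) : PreCylinder R Z → PreCylinder R Z → Prop
  | mk (c : R) : Attach f (edge c 1) (base (f c))

end PreCylinder

/-- The mapping cylinder of `f : R → Z`, where `R` is a discrete set. -/
def MappingCylinder {R Z : Type*} (f : R → Z) : Type _ :=
  Quotient (Relation.EqvGen.setoid (PreCylinder.Attach f))

namespace MappingCylinder

variable {R Z : Type*} {f : R → Z}

/-- The tip of the mapping cylinder that corresponds to `c`. -/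
def tip (f : R → Z) (c : R) : MappingCylinder f :=
  Quotient.mk _ (PreCylinder.edge c 0)

/-- The mapping cylinder carries the quotient metric. -/
instance [MetricSpace Z] : PseudoEMetricSpace (MappingCylinder f) where
  edist := quotientEDist PreCylinder.preDist _
  edist_self := quotientEDist_self PreCylinder.preDist_self
  edist_comm a b := le_antisymm (quotientEDist_comm_le PreCylinder.preDist_comm a b)
    (quotientEDist_comm_le PreCylinder.preDist_comm b a)
  edist_triangle := quotientEDist_triangle

end MappingCylinder

/-! ### Buildings -/

open Classical in
/-- The Coxeter matrix of the right-angled Coxeter group `W(Γ)`; the entry `0` stands for `∞`. -/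
def rightAngledMatrix {I : Type*} (Γ : SimpleGraph I) : CoxeterMatrix I where
  M := Matrix.of fun i j => if i = j then 1 else if Γ.Adj i j then 2 else 0
  isSymm := by
    ext i j
    simp [Matrix.transpose_apply, eq_comm, Γ.adj_comm]
  diagonal i := by simp
  off_diagonal i j h := by
    simp only [Matrix.of_apply, h, if_false]
    split_ifs <;> simp

/-- A building of type `M`: a nonempty set `C` of chambers with a distance function `δ` with
values in the Coxeter group of `M`, subject to the usual three axioms. -/
structure Building {I : Type*} (M : CoxeterMatrix I) (C : Type*) where
  δ : C → C → M.Group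
  nonempty : Nonempty C
  δ_eq_one_iff : ∀ c d, δ c d = 1 ↔ c = d
  δ_of_adj : ∀ (i : I) (c' c d : C), δ c' c = M.simple i →
    (δ c' d = M.simple i * δ c d ∨ δ c' d = δ c d) ∧
    (M.toCoxeterSystem.length (M.simple i * δ c d) = M.toCoxeterSystem.length (δ c d) + 1 →
      δ c' d = M.simple i * δ c d)
  exists_adj : ∀ (i : I) (c d : C), ∃ c', δ c' c = M.simple i ∧ δ c' d = M.simple i * δ c d

/-- The standard subgroup `W_J` of the Coxeter group. -/
def CoxeterMatrix.standardSubgroup {I : Type*} (M : CoxeterMatrix I) (J : Set I) :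
    Subgroup M.Group :=
  Subgroup.closure (M.simple '' J)

namespace Building

variable {I C : Type*} {M : CoxeterMatrix I} (B : Building M C)

/-- The set of chambers of the `J`-residue that contains the chamber `c`. -/
def residueSet (J : Finset I) (c : C) : Set C :=
  {d | B.δ c d ∈ M.standardSubgroup J}

theorem mem_residueSet_self (J : Finset I) (c : C) : c ∈ B.residueSet J c := by
  simp [residueSet, (B.δ_eq_one_iff c c).2 rfl, one_mem]

/-- A residue: a finite set `J` of generators and a `J`-residue. -/
structure Residue where
  type : Finset I
  chambers : Set C
  isResidue : ∃ c, chambers = B.residueSet type c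

variable {B}

theorem Residue.nonempty (R : B.Residue) : R.chambers.Nonempty := by
  obtain ⟨c, hc⟩ := R.isResidue
  exact ⟨c, hc ▸ B.mem_residueSet_self _ c⟩

/-- The projection to a residue: the (unique) chamber of `R` at minimal distance from `c`. -/
def Residue.proj (R : B.Residue) (c : C) : C :=
  Function.argminOn (fun d => M.toCoxeterSystem.length (B.δ c d)) R.chambers R.nonempty

theorem Residue.proj_mem (R : B.Residue) (c : C) : R.proj c ∈ R.chambers :=
  Function.argminOn_mem _ _ _

/-- Two residues are parallel if each is the projection of the other. -/
def Residue.Parallel (R R' : B.Residue) : Prop :=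
  R.proj '' R'.chambers = R.chambers ∧ R'.proj '' R.chambers = R'.chambers

/-- The projection of one residue to another; this is the parallelism map if they are parallel. -/
def Residue.parallelismMap (R R' : B.Residue) (c : R.chambers) : R'.chambers :=
  ⟨R'.proj c, R'.proj_mem c⟩

variable (B)

/-- The residues of rank 1. -/
def Panel : Type _ := {R : B.Residue // ∃ i, R.type = {i}}

/-- The `i`-residue that contains the chamber `c`. -/
def panel (i : I) (c : C) : B.Panel :=
  ⟨⟨{i}, B.residueSet {i} c, c, rfl⟩, i, rfl⟩

/-- The parallel classes of residues of rank 1. -/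
def ParallelClass : Type _ := Quot fun r r' : B.Panel => r.1.Parallel r'.1

/-- The spherical residues: those of type `J` with `W_J` finite. -/
def SphericalResidue : Type _ := {R : B.Residue // Finite (M.standardSubgroup (R.type : Set I))}

variable {B}

/-- The parallel class of a residue of rank 1. -/
def Panel.parallelClass (r : B.Panel) : B.ParallelClass := Quot.mk _ r

theorem Panel.parallelClass_eq {r r' : B.Panel} (h : r.1.Parallel r'.1) :
    r.parallelClass = r'.parallelClass := Quot.sound h

/-- A representative of a parallel class. -/
def ParallelClass.rep (l : B.ParallelClass) : B.Panel := Quot.out l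

/-- The parallel class of the factor `r_j` in the product decomposition `∏ r_j` of a spherical
residue: the class of the `j`-residue of any chamber of `R`. -/
def SphericalResidue.factor (R : B.SphericalResidue) (j : R.1.type) : B.ParallelClass :=
  (B.panel j R.1.nonempty.some).parallelClass

end Building

/-! ### Blow-ups -/

/-- Blow-up data on a building: a metric space for each parallel class of residues of rank 1, and
a map from each residue of rank 1 to the space of its class, compatible with parallelism. -/
structure BlowUpData {I : Type*} {C : Type*} {M : CoxeterMatrix I}
    (B : Building M C) where
  Z : B.ParallelClass → Type*
  metric : ∀ l, MetricSpace (Z l)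
  f : ∀ r : B.Panel, r.1.chambers → Z r.parallelClass
  compatible : ∀ (r r' : B.Panel) (h : r.1.Parallel r'.1) (c : r.1.chambers),
    f r' (r.1.parallelismMap r'.1 c) =
      cast (congrArg Z (Building.Panel.parallelClass_eq h)) (f r c)

namespace BlowUpData

variable {I C : Type*} {M : CoxeterMatrix I} {B : Building M C} (D : BlowUpData B)

instance (l : B.ParallelClass) : MetricSpace (D.Z l) := D.metric l

/-- The space `M_r` of a parallel class: the mapping cylinder of `f_r`, where `r` is a fixed
representative of the class. -/
abbrev Cyl (l : B.ParallelClass) : Type _ := MappingCylinder (D.f l.rep)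

/-- The tip of the cylinder of the class `l` that corresponds to the chamber `u`, under the
parallelism to the fixed representative of `l`; here `u` lies in some member of `l`. -/
def tip (l : B.ParallelClass) (u : C) : D.Cyl l :=
  MappingCylinder.tip (D.f l.rep) ⟨l.rep.1.proj u, l.rep.1.proj_mem u⟩

/-- The product `Φ(R) = ∏_{j ∈ J} M_{r_j}` with the `ℓ²` product metric. -/
abbrev Phi (R : B.SphericalResidue) : Type _ :=
  PiLp 2 fun j : R.1.type => D.Cyl (R.factor j)

/-- The disjoint union of the products `Φ(R)`. -/
abbrev PreBlowUp : Type _ := Σ R : B.SphericalResidue, D.Phi R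

open Classical in
/-- The metric of the disjoint union: points of different pieces have distance `∞`. -/
def preDist (x y : D.PreBlowUp) : ℝ≥0∞ :=
  if h : x.1 = y.1 then edist (cast (congrArg D.Phi h) x.2) y.2 else ⊤

/-- For spherical residues `R' ⊆ R` of types `J'` and `J`, the point `x'` of `Φ(R')` is glued to
its image `x` in `Φ(R)`. For `j ∈ J'` the `j`-th coordinates agree; the factors `r_j` of `R'` and
`R` are parallel, so that they are points of the same cylinder, and the equation is written in the
disjoint union of all cylinders. For `j ∉ J'` the coordinate of `x` is the tip given by the
chambers of `R'`. -/
inductive Glue : D.PreBlowUp → D.PreBlowUp → Prop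
  | mk (R' R : B.SphericalResidue) (h : R'.1.chambers ⊆ R.1.chambers) (x' : D.Phi R') (x : D.Phi R)
      (h_mem : ∀ (j : I) (hj' : j ∈ R'.1.type) (hj : j ∈ R.1.type),
        (⟨R.factor ⟨j, hj⟩, x ⟨j, hj⟩⟩ : Σ l, D.Cyl l) = ⟨R'.factor ⟨j, hj'⟩, x' ⟨j, hj'⟩⟩)
      (h_tip : ∀ (j : I) (hj : j ∈ R.1.type), j ∉ R'.1.type → ∀ u ∈ R'.1.chambers,
        x ⟨j, hj⟩ = D.tip (R.factor ⟨j, hj⟩) u) :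
      Glue ⟨R', x'⟩ ⟨R, x⟩

/-- The blow-up `Π` of the building. -/
def BlowUp : Type _ := Quotient (Relation.EqvGen.setoid D.Glue)

/-- The quotient (pseudo-)metric on the blow-up. -/
def blowUpDist (a b : D.BlowUp) : ℝ≥0∞ := quotientEDist D.preDist _ a b

end BlowUpData

end

/-! The blow-up is embedded in the product of all cylinders `M_l`, where `l` runs over the parallel
classes of panels. At a point of `Φ(R)` the coordinates of the factor classes of `R` are the given
ones. Any other class does not separate the chambers of `R`, and its coordinate is the tip of their
common projection. Call two different classes separated unless their types commute and some chamber
lies in panels of both. If `l` and `m` are separated, all chambers at `m` have the same projection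
to `l`; its tip is the gate of `l` towards `m`. Every point of the blow-up then satisfies the clause
that its `l`-coordinate or its `m`-coordinate is the respective gate.

Conversely, each family that satisfies all clauses and differs in finitely many places from the tips
of a chamber comes from the blow-up, and it determines the point up to gluing (`exists_π_eq`,
`exists_residue`, `exists_glue`). Moving coordinates that are pairwise not separated is the same as
moving inside one `Φ(R)` (`exists_phi_of_isStep`). Hence the quotient pseudo-metric is the length
metric in which such a step has its `ℓ²` length (`blowUpDist_eq`), and the theorem becomes a
statement about subspaces of products of CAT(0) spaces that are cut out by clauses
(`ClauseSystem.Point.isCAT0`).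

For such a subspace any four points lie in a slice with finitely many free coordinates, and slices
are treated by induction on the set of these. If no clause links two free coordinates, the slice is
a convex part of a finite `ℓ²` product. Otherwise one clause writes it as a union of two pieces in
which one coordinate is fixed and whose intersection is again of this kind, and Reshetnyak's gluing
theorem applies (`IsGluing.isCNSet_union`). Nothing is assumed complete, so gluing requires that the
distance between points of the two pieces is attained through their intersection. Here that follows
from compactness, after a coordinatewise retraction to geodesic segments (`exists_retraction`,
`exists_dist_add_dist_eq`).

CAT(0) is used in the form of the inequality of Bruhat and Tits, and gluing is proved by adding
angles. The cylinders are CAT(0) because they arise by gluing edges to `Z` at points. The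
combinatorial input is that adjacent chambers have different projections to a panel only if they lie
in a common panel parallel to it (`proj_panel_ne_iff`). It rests on the exchange property and on the
centralizer of a generator in a right-angled Coxeter group. -/

/-! ### The inequality of Bruhat and Tits -/

section CN

variable {X : Type*} [MetricSpace X]

/-- The point `m` divides a geodesic from `x` to `y` in the ratio `t : 1 - t`. -/
def IsBetween (t : ℝ) (x m y : X) : Prop :=
  dist x m = t * dist x y ∧ dist m y = (1 - t) * dist x y

/-- A set in which any two points are joined by a geodesic and which satisfies the inequality of
Bruhat and Tits. -/
structure IsCNSet (S : Set X) : Prop where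
  exists_between : ∀ x ∈ S, ∀ y ∈ S, ∀ t ∈ Set.Icc (0 : ℝ) 1, ∃ m ∈ S, IsBetween t x m y
  cn : ∀ x ∈ S, ∀ y ∈ S, ∀ m ∈ S, ∀ p ∈ S, ∀ t ∈ Set.Icc (0 : ℝ) 1, IsBetween t x m y →
    dist p m ^ 2 ≤ (1 - t) * dist p x ^ 2 + t * dist p y ^ 2 - t * (1 - t) * dist x y ^ 2

theorem IsBetween.symm {t : ℝ} {x m y : X} (h : IsBetween t x m y) : IsBetween (1 - t) y m x := by
  refine ⟨?_, ?_⟩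
  · rw [dist_comm y m, h.2, dist_comm x y]
  · rw [dist_comm m x, h.1, dist_comm x y]; ring

theorem dist_lineMap_sq {E : Type*} [NormedAddCommGroup E] [InnerProductSpace ℝ E] (x y z : E)
    (t : ℝ) : dist z (AffineMap.lineMap x y t) ^ 2 =
      (1 - t) * dist z x ^ 2 + t * dist z y ^ 2 - t * (1 - t) * dist x y ^ 2 := by
  have h1 : z - AffineMap.lineMap x y t = (1 - t) • (z - x) + t • (z - y) := by
    rw [AffineMap.lineMap_apply_module]; module
  have h2 : x - y = (z - y) - (z - x) := by abel
  rw [dist_eq_norm, dist_eq_norm, dist_eq_norm, dist_eq_norm, h1, h2, norm_add_sq_real,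
    norm_sub_sq_real (z - y) (z - x), norm_smul, norm_smul, inner_smul_left, inner_smul_right,
    real_inner_comm (z - x) (z - y)]
  simp only [mul_pow, Real.norm_eq_abs, sq_abs, conj_trivial]
  ring

theorem exists_comparison_triangle {a b c : ℝ} (ha : 0 ≤ a) (hb : 0 ≤ b) (hc : 0 ≤ c)
    (h1 : a ≤ b + c) (h2 : b ≤ a + c) (h3 : c ≤ a + b) :
    ∃ x y z : EuclideanSpace ℝ (Fin 2), dist x y = a ∧ dist x z = b ∧ dist y z = c := by
  rcases ha.eq_or_lt with rfl | ha
  · have : b = c := by linarith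
    subst this
    refine ⟨!₂[0, 0], !₂[0, 0], !₂[b, 0], ?_, ?_, ?_⟩ <;>
      simp [EuclideanSpace.dist_eq, Fin.sum_univ_two, Real.sqrt_sq_eq_abs, abs_of_nonneg hb,
        Real.dist_eq]
  · set u := (a ^ 2 + b ^ 2 - c ^ 2) / (2 * a) with hu
    have hua : 2 * a * u = a ^ 2 + b ^ 2 - c ^ 2 := by rw [hu]; field_simp
    -- Up to the factor `(2 * a) ^ 2` this is Heron's product, which is nonnegative by the triangle
    -- inequalities.
    have hub : 0 ≤ b ^ 2 - u ^ 2 := by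
      have e : (2 * a) ^ 2 * (b ^ 2 - u ^ 2) =
          ((a + b) ^ 2 - c ^ 2) * (c ^ 2 - (a - b) ^ 2) := by
        have : (2 * a) ^ 2 * (b ^ 2 - u ^ 2) = (2 * a * b) ^ 2 - (2 * a * u) ^ 2 := by ring
        rw [this, hua]; ring
      have p1 : 0 ≤ (a + b) ^ 2 - c ^ 2 := by nlinarith
      have p2 : 0 ≤ c ^ 2 - (a - b) ^ 2 := by nlinarith
      have p3 : 0 < (2 * a) ^ 2 := by positivity
      by_contra! h
      nlinarith [mul_nonneg p1 p2, mul_neg_of_pos_of_neg p3 h]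
    have hv := Real.sq_sqrt hub
    set v := √(b ^ 2 - u ^ 2)
    refine ⟨!₂[0, 0], !₂[a, 0], !₂[u, v], ?_, ?_, ?_⟩
    · simp [EuclideanSpace.dist_eq, Fin.sum_univ_two, Real.dist_eq, Real.sqrt_sq_eq_abs,
        abs_of_nonneg ha.le]
    · have : u ^ 2 + v ^ 2 = b ^ 2 := by linarith
      simp [EuclideanSpace.dist_eq, Fin.sum_univ_two, Real.dist_eq, this, Real.sqrt_sq hb]
    · have : (a - u) ^ 2 + v ^ 2 = c ^ 2 := by nlinarith
      simp [EuclideanSpace.dist_eq, Fin.sum_univ_two, Real.dist_eq, this, Real.sqrt_sq hc]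

theorem IsGeodesicFrom.isBetween {γ : ℝ → X} {x y : X} (h : IsGeodesicFrom γ x y) {t : ℝ}
    (ht : t ∈ Set.Icc (0 : ℝ) 1) : IsBetween t x (γ (t * dist x y)) y := by
  have hd := dist_nonneg (x := x) (y := y)
  have h0 : (0 : ℝ) ∈ Set.Icc 0 (dist x y) := ⟨le_rfl, hd⟩
  have h1 : dist x y ∈ Set.Icc 0 (dist x y) := ⟨hd, le_rfl⟩
  have h2 : t * dist x y ∈ Set.Icc 0 (dist x y) :=
    ⟨mul_nonneg ht.1 hd, mul_le_of_le_one_left hd ht.2⟩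
  refine ⟨?_, ?_⟩
  · have := h.isometry _ h0 _ h2
    rwa [h.source, zero_sub, abs_neg, abs_of_nonneg h2.1] at this
  · have := h.isometry _ h2 _ h1
    rw [h.target, abs_sub_comm, abs_of_nonneg (by linarith [h2.2])] at this
    rw [this]; ring

theorem dist_left_lineMap_of_mem {E : Type*} [NormedAddCommGroup E] [NormedSpace ℝ E] (x y : E)
    {t : ℝ} (ht : 0 ≤ t) : dist x (AffineMap.lineMap x y t) = t * dist x y := by
  rw [dist_left_lineMap, Real.norm_of_nonneg ht]

theorem IsCAT0.isCNSet (h : IsCAT0 X) : IsCNSet (Set.univ : Set X) := by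
  have key : ∀ (x y p : X) (γ : ℝ → X), IsGeodesicFrom γ x y → ∀ t ∈ Set.Icc (0 : ℝ) 1,
      dist p (γ (t * dist x y)) ^ 2 ≤
        (1 - t) * dist p x ^ 2 + t * dist p y ^ 2 - t * (1 - t) * dist x y ^ 2 := by
    intro x y p γ hγ t ht
    obtain ⟨β, hβ⟩ := h.exists_geodesic x p
    obtain ⟨x', y', z', e1, e2, e3⟩ := exists_comparison_triangle (dist_nonneg (x := x) (y := y))
      (dist_nonneg (x := x) (y := p)) (dist_nonneg (x := y) (y := p))
      (dist_comm y p ▸ dist_triangle x p y) (dist_triangle x y p)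
      (dist_comm x y ▸ dist_triangle y x p)
    have hd := dist_nonneg (x := x) (y := y)
    have := h.comparison x y p γ β hγ hβ x' y' z' e1 e2 e3 (t * dist x y)
      ⟨mul_nonneg ht.1 hd, mul_le_of_le_one_left hd ht.2⟩ (dist x p) ⟨dist_nonneg, le_rfl⟩
      (AffineMap.lineMap x' y' t) (by
        rw [segment_eq_image_lineMap]; exact ⟨t, ht, rfl⟩) z' (right_mem_segment ℝ x' z')
      (by rw [dist_left_lineMap_of_mem _ _ ht.1, e1]) e2
    rw [hβ.target] at this
    calc dist p (γ (t * dist x y)) ^ 2 ≤ dist z' (AffineMap.lineMap x' y' t) ^ 2 := by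
          rw [dist_comm, dist_comm z']
          exact pow_le_pow_left₀ dist_nonneg this 2
      _ = _ := by
          rw [dist_lineMap_sq, dist_comm z' x', dist_comm z' y', e1, e2, e3, dist_comm p x,
            dist_comm p y]
  refine ⟨fun x _ y _ t ht => ?_, fun x _ y _ m _ p _ t ht hm => ?_⟩
  · obtain ⟨γ, hγ⟩ := h.exists_geodesic x y
    exact ⟨_, trivial, hγ.isBetween ht⟩
  · obtain ⟨γ, hγ⟩ := h.exists_geodesic x y
    have h1 := key x y m γ hγ t ht
    rw [dist_comm m x, hm.1, hm.2] at h1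
    -- For `p = m` the right-hand side vanishes, so any point that divides in the ratio `t` is the
    -- point of the geodesic.
    have h2 : dist m (γ (t * dist x y)) ^ 2 ≤ 0 := by nlinarith
    have h3 : dist m (γ (t * dist x y)) = 0 := by
      nlinarith [dist_nonneg (x := m) (y := γ (t * dist x y))]
    rw [dist_eq_zero.1 h3]
    exact key x y p γ hγ t ht

/-- With `p = m'` the right-hand side of the inequality is exactly `((s - t) * dist x y) ^ 2`; the
opposite bound is the triangle inequality. For `s = t` this is uniqueness of geodesics. -/
theorem IsCNSet.dist_le {S : Set X} (hS : IsCNSet S) {x y m m' : X} (hx : x ∈ S) (hy : y ∈ S)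
    (hm : m ∈ S) (hm' : m' ∈ S) {s t : ℝ} (hs : s ∈ Set.Icc (0 : ℝ) 1)
    (h : IsBetween s x m y) (h' : IsBetween t x m' y) :
    dist m m' = |s - t| * dist x y := by
  refine le_antisymm ?_ ?_
  · have := hS.cn x hx y hy m hm m' hm' s hs h
    rw [dist_comm m' x, h'.1, h'.2] at this
    have h2 : dist m' m ^ 2 ≤ ((s - t) * dist x y) ^ 2 := by nlinarith
    have := sq_le_sq.1 h2
    rwa [abs_of_nonneg dist_nonneg, abs_mul, abs_of_nonneg (dist_nonneg (x := x)), dist_comm]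
      at this
  · have h1 := dist_triangle x m m'
    have h2 := dist_triangle x m' m
    rw [dist_comm m' m] at h2
    rw [h.1, h'.1] at h1 h2
    have h3 := dist_nonneg (x := x) (y := y)
    rcases abs_cases (s - t) with ⟨e, _⟩ | ⟨e, _⟩ <;> rw [e] <;> nlinarith

theorem IsCNSet.isCAT0 (h : IsCNSet (Set.univ : Set X)) : IsCAT0 X := by
  refine ⟨fun x y => ?_, ?_⟩
  · have : Nonempty X := ⟨x⟩
    choose! m hm using fun t => h.exists_between x trivial y trivial t
    have hd := dist_nonneg (x := x) (y := y)
    rcases hd.eq_or_lt with h0 | hd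
    · have := dist_eq_zero.1 h0.symm
      subst this
      refine ⟨fun _ => x, rfl, rfl, ?_⟩
      intro s hs t ht
      simp only [dist_self, Set.Icc_self, Set.mem_singleton_iff] at hs ht ⊢
      simp [hs, ht]
    have mem : ∀ s ∈ Set.Icc 0 (dist x y), s / dist x y ∈ Set.Icc (0 : ℝ) 1 := fun s hs =>
      ⟨div_nonneg hs.1 hd.le, (div_le_one hd).2 hs.2⟩
    refine ⟨fun s => m (s / dist x y), ?_, ?_, ?_⟩
    · have := (hm 0 (by simp)).2.1
      simpa [eq_comm] using this
    · have := (hm 1 (by simp)).2.2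
      simpa [hd.ne'] using this
    · intro s hs t ht
      rw [h.dist_le trivial trivial trivial trivial (mem s hs) (hm _ (mem s hs)).2
        (hm _ (mem t ht)).2, ← sub_div, abs_div, abs_of_pos hd, div_mul_cancel₀ _ hd.ne']
  · intro x y z α β hα hβ x' y' z' e1 e2 e3 s hs t ht p hp q hq hps hqt
    have param : ∀ (y : X) (α : ℝ → X) (y' : EuclideanSpace ℝ (Fin 2)),
        IsGeodesicFrom α x y → dist x' y' = dist x y → ∀ s, ∀ p ∈ segment ℝ x' y',
        dist x' p = s → ∃ u ∈ Set.Icc (0 : ℝ) 1, p = AffineMap.lineMap x' y' u ∧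
          IsBetween u x (α s) y := by
      intro y α y' hα e s p hp hs
      rw [segment_eq_image_lineMap] at hp
      obtain ⟨u, hu, rfl⟩ := hp
      refine ⟨u, hu, rfl, ?_⟩
      rw [dist_left_lineMap_of_mem _ _ hu.1, e] at hs
      rw [← hs]
      exact hα.isBetween hu
    obtain ⟨u, hu, rfl, bu⟩ := param y α y' hα e1 s p hp hps
    obtain ⟨v, hv, rfl, bv⟩ := param z β z' hβ e2 t q hq hqt
    -- The inequality is used twice, for `β t` on `[x, z]` and for `α s` on `[x, y]`. In the
    -- comparison triangle both are equalities (`j1`, `j2`).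
    have i1 := h.cn x trivial z trivial (β t) trivial (α s) trivial v hv bv
    have i2 := h.cn x trivial y trivial (α s) trivial z trivial u hu bu
    have j1 := dist_lineMap_sq x' z' (AffineMap.lineMap x' y' u) v
    have j2 := dist_lineMap_sq x' y' z' u
    rw [dist_comm _ x', dist_left_lineMap_of_mem _ _ hu.1, e1, dist_comm _ z', j2, dist_comm z' x',
      dist_comm z' y', e1, e2, e3] at j1
    rw [dist_comm _ x, bu.1, dist_comm (α s) z] at i1
    rw [dist_comm z x, dist_comm z y] at i2
    refine (sq_le_sq₀ dist_nonneg dist_nonneg).1 ?_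
    rw [j1]
    nlinarith [hv.1, hv.2]

end CN

/-! ### Angles -/

section Angle

variable {X : Type*} [MetricSpace X]

/-- Twice the scalar product of the two sides at `h` of a comparison triangle for `h, u, v`. -/
def comparisonInner (h u v : X) : ℝ := dist h u ^ 2 + dist h v ^ 2 - dist u v ^ 2

theorem comparisonInner_comm (h u v : X) : comparisonInner h u v = comparisonInner h v u := by
  rw [comparisonInner, comparisonInner, dist_comm u v]; ring

theorem comparisonInner_le (h u v : X) : comparisonInner h u v ≤ 2 * (dist h u * dist h v) := by
  have h1 := abs_dist_sub_le h v u
  have h2 := dist_triangle h u v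
  have h3 := dist_triangle h v u
  rw [dist_comm v u] at h3
  have : (dist h u - dist h v) ^ 2 ≤ dist u v ^ 2 := by
    apply sq_le_sq'
    · linarith
    · linarith
  rw [comparisonInner]; nlinarith

theorem neg_le_comparisonInner (h u v : X) :
    -(2 * (dist h u * dist h v)) ≤ comparisonInner h u v := by
  have h2 := dist_triangle u h v
  rw [dist_comm u h] at h2
  have : dist u v ^ 2 ≤ (dist h u + dist h v) ^ 2 := pow_le_pow_left₀ dist_nonneg h2 2
  rw [comparisonInner]; nlinarith

variable {S : Set X}

/-- A form of the inequality of Bruhat and Tits without parameter. -/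
theorem IsCNSet.stewart (hS : IsCNSet S) {x y m p : X} (hx : x ∈ S) (hy : y ∈ S) (hm : m ∈ S)
    (hp : p ∈ S) (h : dist x m + dist m y = dist x y) :
    dist m y * comparisonInner m x p + dist x m * comparisonInner m y p ≤ 0 := by
  have d1 := dist_nonneg (x := x) (y := m)
  have d2 := dist_nonneg (x := m) (y := y)
  rcases (dist_nonneg (x := x) (y := y)).eq_or_lt with h0 | h0
  · have e1 : dist x m = 0 := by linarith
    have e2 : dist m y = 0 := by linarith
    simp [e1, e2]
  · have hb : IsBetween (dist x m / dist x y) x m y := by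
      refine ⟨by field_simp, ?_⟩
      field_simp; linarith
    have := hS.cn x hx y hy m hm p hp _ ⟨by positivity, (div_le_one h0).2 (by linarith)⟩ hb
    have e : 1 - dist x m / dist x y = dist m y / dist x y := by field_simp; linarith
    rw [e] at this
    have h2 := mul_le_mul_of_nonneg_left this h0.le
    have e3 : dist x y * (dist m y / dist x y * dist p x ^ 2 + dist x m / dist x y * dist p y ^ 2 -
        dist x m / dist x y * (dist m y / dist x y) * dist x y ^ 2) =
        dist m y * dist p x ^ 2 + dist x m * dist p y ^ 2 - dist x m * dist m y * dist x y := by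
      field_simp
    rw [e3, ← h] at h2
    simp only [comparisonInner, dist_comm m x, dist_comm x p, dist_comm y p, dist_comm m p]
    nlinarith

/-- The parameter-free inequality implies the usual one. -/
theorem cn_of_stewart {x y m p : X} {t : ℝ} (hb : IsBetween t x m y)
    (h : dist m y * comparisonInner m x p + dist x m * comparisonInner m y p ≤ 0) :
    dist p m ^ 2 ≤ (1 - t) * dist p x ^ 2 + t * dist p y ^ 2 - t * (1 - t) * dist x y ^ 2 := by
  rcases (dist_nonneg (x := x) (y := y)).eq_or_lt with h0 | h0
  · have e1 := hb.1
    rw [← h0, mul_zero] at e1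
    have := dist_eq_zero.1 e1
    subst this
    have := dist_eq_zero.1 h0.symm
    subst this
    simp
    linarith
  · simp only [comparisonInner, dist_comm m x, dist_comm x p, dist_comm y p, dist_comm m p] at h
    rw [hb.1, hb.2] at h
    have e : (1 - t) * dist x y * ((t * dist x y) ^ 2 + dist p m ^ 2 - dist p x ^ 2) +
        t * dist x y * (((1 - t) * dist x y) ^ 2 + dist p m ^ 2 - dist p y ^ 2) =
        dist x y * (dist p m ^ 2 - ((1 - t) * dist p x ^ 2 + t * dist p y ^ 2 -
          t * (1 - t) * dist x y ^ 2)) := by ring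
    rw [e] at h
    have := nonpos_of_mul_nonpos_right h h0
    linarith

/-- Monotonicity of comparison angles: this is Stewart's inequality at `u'`, and it says that
shortening a side of a hinge does not decrease the cosine of its comparison angle. -/
theorem IsCNSet.shrink (hS : IsCNSet S) {h u u' v : X} (hh : h ∈ S) (hu : u ∈ S) (hu' : u' ∈ S)
    (hv : v ∈ S) (hb : dist h u' + dist u' u = dist h u) :
    dist h u' * comparisonInner h u v ≤ dist h u * comparisonInner h u' v := by
  have := hS.stewart hh hu hu' hv hb
  rw [← hb]
  simp only [comparisonInner, dist_comm u' h] at *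
  rw [← hb]
  nlinarith

theorem IsCNSet.exists_dist_eq (hS : IsCNSet S) {h u : X} (hh : h ∈ S) (hu : u ∈ S) {a : ℝ}
    (ha : 0 ≤ a) (ha' : a ≤ dist h u) :
    ∃ u' ∈ S, dist h u' = a ∧ dist h u' + dist u' u = dist h u := by
  rcases (dist_nonneg (x := h) (y := u)).eq_or_lt with h0 | h0
  · exact ⟨h, hh, by rw [dist_self]; linarith, by simp⟩
  · obtain ⟨m, hm, hb⟩ := hS.exists_between h hh u hu (a / dist h u)
      ⟨by positivity, (div_le_one h0).2 ha'⟩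
    refine ⟨m, hm, by rw [hb.1]; field_simp, ?_⟩
    rw [hb.1, hb.2]; ring

theorem IsCNSet.dist_eq_of_between (hS : IsCNSet S) {h u u₁ u₂ : X} (hh : h ∈ S) (hu : u ∈ S)
    (h1 : u₁ ∈ S) (h2 : u₂ ∈ S) (b1 : dist h u₁ + dist u₁ u = dist h u)
    (b2 : dist h u₂ + dist u₂ u = dist h u) (h12 : dist h u₁ ≤ dist h u₂) :
    dist h u₁ + dist u₁ u₂ = dist h u₂ := by
  have d1 := dist_nonneg (x := h) (y := u₁)
  rcases (dist_nonneg (x := h) (y := u)).eq_or_lt with h0 | h0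
  · have := dist_nonneg (x := u₂) (y := u)
    have := dist_nonneg (x := u₁) (y := u)
    have e1 : dist h u₁ = 0 := by linarith
    have e2 : dist h u₂ = 0 := by linarith
    rw [← dist_eq_zero.1 e1, dist_self, e2]; simp
  · have bt : ∀ u', dist h u' + dist u' u = dist h u → IsBetween (dist h u' / dist h u) h u' u := by
      intro u' hu'
      refine ⟨by field_simp, ?_⟩
      field_simp; linarith
    have := hS.dist_le hh hu h1 h2 ⟨by positivity, (div_le_one h0).2 (by
      linarith [dist_nonneg (x := u₁) (y := u)])⟩ (bt u₁ b1) (bt u₂ b2)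
    rw [this, ← sub_div, abs_div, abs_of_pos h0, div_mul_cancel₀ _ h0.ne', abs_of_nonpos (by linarith)]
    ring

/-- The number `c` is the cosine of the angle at `h` between the geodesics to `u` and to `v`. -/
structure IsAngleCos (S : Set X) (h u v : X) (c : ℝ) : Prop where
  le : ∀ u' ∈ S, ∀ v' ∈ S, dist h u' + dist u' u = dist h u → dist h v' + dist v' v = dist h v →
    comparisonInner h u' v' ≤ 2 * c * (dist h u' * dist h v')
  ge : ∀ ε > 0, ∃ ρ > 0, ∀ u' ∈ S, ∀ v' ∈ S, dist h u' + dist u' u = dist h u →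
    dist h v' + dist v' v = dist h v → dist h u' ≤ ρ → dist h v' ≤ ρ →
    2 * (c - ε) * (dist h u' * dist h v') ≤ comparisonInner h u' v'
  mem : c ∈ Set.Icc (-1 : ℝ) 1

/-- By `IsCNSet.shrink` the comparison cosines increase as the two points approach `h`; hence their
supremum is also their limit. -/
theorem IsCNSet.exists_isAngleCos (hS : IsCNSet S) {h u v : X} (hh : h ∈ S) (hu : u ∈ S)
    (hv : v ∈ S) (hu0 : 0 < dist h u) (hv0 : 0 < dist h v) : ∃ c, IsAngleCos S h u v c := by
  let A : Set ℝ := {q | ∃ u' ∈ S, ∃ v' ∈ S, dist h u' + dist u' u = dist h u ∧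
    dist h v' + dist v' v = dist h v ∧ 0 < dist h u' ∧ 0 < dist h v' ∧
    q = comparisonInner h u' v' / (2 * (dist h u' * dist h v'))}
  have hA : ∀ q ∈ A, q ∈ Set.Icc (-1 : ℝ) 1 := by
    rintro q ⟨u', -, v', -, -, -, p1, p2, rfl⟩
    have p3 : 0 < 2 * (dist h u' * dist h v') := by positivity
    exact ⟨by rw [le_div_iff₀ p3]; linarith [neg_le_comparisonInner h u' v'],
      (div_le_one p3).2 (comparisonInner_le h u' v')⟩
  have hbdd : BddAbove A := ⟨1, fun q hq => (hA q hq).2⟩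
  have hne : A.Nonempty := ⟨_, u, hu, v, hv, by simp, by simp, hu0, hv0, rfl⟩
  refine ⟨sSup A, ?_, ?_, ?_⟩
  · intro u' hu' v' hv' b1 b2
    rcases (dist_nonneg (x := h) (y := u')).eq_or_lt with p1 | p1
    · have := comparisonInner_le h u' v'
      rw [← p1] at this ⊢; simpa using this
    rcases (dist_nonneg (x := h) (y := v')).eq_or_lt with p2 | p2
    · have := comparisonInner_le h u' v'
      rw [← p2] at this ⊢; simpa using this
    have := le_csSup hbdd ⟨u', hu', v', hv', b1, b2, p1, p2, rfl⟩
    rw [div_le_iff₀ (by positivity)] at this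
    linarith
  · intro ε hε
    obtain ⟨q, ⟨u₀, hu₀, v₀, hv₀, b1, b2, p1, p2, rfl⟩, hq⟩ :=
      exists_lt_of_lt_csSup hne (sub_lt_self (sSup A) hε)
    refine ⟨min (dist h u₀) (dist h v₀), lt_min p1 p2, ?_⟩
    intro u' hu' v' hv' b1' b2' r1 r2
    have c1 := hS.dist_eq_of_between hh hu hu' hu₀ b1' b1 (r1.trans (min_le_left _ _))
    have c2 := hS.dist_eq_of_between hh hv hv' hv₀ b2' b2 (r2.trans (min_le_right _ _))
    have s1 := hS.shrink hh hu₀ hu' hv' c1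
    have s2 := hS.shrink hh hv₀ hv' hu₀ c2
    rw [comparisonInner_comm h v₀ u₀, comparisonInner_comm h v' u₀] at s2
    rw [lt_div_iff₀ (by positivity)] at hq
    have d1 := dist_nonneg (x := h) (y := u')
    have d2 := dist_nonneg (x := h) (y := v')
    have t1 : dist h u' * dist h v' * comparisonInner h u₀ v₀ ≤
        dist h v₀ * dist h u₀ * comparisonInner h u' v' := by
      nlinarith [mul_le_mul_of_nonneg_left s2 d1, mul_le_mul_of_nonneg_left s1 p2.le]
    have t2 := mul_le_mul_of_nonneg_left hq.le (mul_nonneg d1 d2)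
    have p3 : 0 < dist h v₀ * dist h u₀ := by positivity
    refine le_of_mul_le_mul_left ?_ p3
    nlinarith
  · obtain ⟨q, hq⟩ := hne
    exact ⟨(hA q hq).1.trans (le_csSup hbdd hq), csSup_le ⟨q, hq⟩ fun q hq => (hA q hq).2⟩

/-- Geodesic hinges at `h` look Euclidean at small scales. -/
theorem IsAngleCos.dist_sq_ge {h u v u' v' : X} {c : ℝ} (hc : IsAngleCos S h u v c)
    (hu' : u' ∈ S) (hv' : v' ∈ S) (b1 : dist h u' + dist u' u = dist h u)
    (b2 : dist h v' + dist v' v = dist h v) :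
    dist h u' ^ 2 + dist h v' ^ 2 - 2 * c * (dist h u' * dist h v') ≤ dist u' v' ^ 2 := by
  have := hc.le u' hu' v' hv' b1 b2
  rw [comparisonInner] at this
  linarith

/-- This is the triangle inequality in the tangent cone at `h`. It comes from the points at
distances `τ * A`, `τ * R`, `τ * B` on the three sides after division by `τ`; the error `ε` of the
angles then tends to `0`. -/
theorem IsCNSet.planar_le (hS : IsCNSet S) {h x p g : X} (hh : h ∈ S) (hx : x ∈ S)
    (hp : p ∈ S) (hg : g ∈ S) (hx0 : 0 < dist h x) (hp0 : 0 < dist h p) (hg0 : 0 < dist h g)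
    {c₁ c₂ c₄ : ℝ} (h1 : IsAngleCos S h x p c₁) (h2 : IsAngleCos S h p g c₂)
    (h4 : IsAngleCos S h x g c₄) {A B R : ℝ} (hA : 0 < A) (hB : 0 < B) (hR : 0 < R) :
    √(A ^ 2 + B ^ 2 - 2 * c₄ * (A * B)) ≤
      √(A ^ 2 + R ^ 2 - 2 * c₁ * (A * R)) + √(R ^ 2 + B ^ 2 - 2 * c₂ * (R * B)) := by
  have key : ∀ ε > 0, √(A ^ 2 + B ^ 2 - 2 * c₄ * (A * B)) ≤
      √(A ^ 2 + R ^ 2 - 2 * (c₁ - ε) * (A * R)) + √(R ^ 2 + B ^ 2 - 2 * (c₂ - ε) * (R * B)) := by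
    intro ε hε
    obtain ⟨ρ₁, hρ₁, k1⟩ := h1.ge ε hε
    obtain ⟨ρ₂, hρ₂, k2⟩ := h2.ge ε hε
    set N := A + B + R with hN
    have hN0 : 0 < N := by positivity
    set m := min (min ρ₁ ρ₂) (min (dist h x) (min (dist h p) (dist h g))) with hm
    have hm0 : 0 < m := by simp [*]
    set τ := m / N with hτ
    have hτ0 : 0 < τ := by positivity
    have hτN : τ * N = m := by rw [hτ]; field_simp
    have lA : τ * A ≤ m := by rw [← hτN]; gcongr; linarith
    have lB : τ * B ≤ m := by rw [← hτN]; gcongr; linarith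
    have lR : τ * R ≤ m := by rw [← hτN]; gcongr; linarith
    have m1 : m ≤ ρ₁ := (min_le_left _ _).trans (min_le_left _ _)
    have m2 : m ≤ ρ₂ := (min_le_left _ _).trans (min_le_right _ _)
    have m3 : m ≤ dist h x := (min_le_right _ _).trans (min_le_left _ _)
    have m4 : m ≤ dist h p := (min_le_right _ _).trans ((min_le_right _ _).trans (min_le_left _ _))
    have m5 : m ≤ dist h g := (min_le_right _ _).trans ((min_le_right _ _).trans (min_le_right _ _))
    obtain ⟨x', hx', ex, bx⟩ := hS.exists_dist_eq hh hx (a := τ * A) (by positivity) (lA.trans m3)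
    obtain ⟨p', hp', ep, bp⟩ := hS.exists_dist_eq hh hp (a := τ * R) (by positivity) (lR.trans m4)
    obtain ⟨g', hg', eg, bg⟩ := hS.exists_dist_eq hh hg (a := τ * B) (by positivity) (lB.trans m5)
    have i1 := k1 x' hx' p' hp' bx bp (ex ▸ lA.trans m1) (ep ▸ lR.trans m1)
    have i2 := k2 p' hp' g' hg' bp bg (ep ▸ lR.trans m2) (eg ▸ lB.trans m2)
    have i4 := h4.dist_sq_ge hx' hg' bx bg
    rw [comparisonInner, ex, ep] at i1
    rw [comparisonInner, ep, eg] at i2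
    rw [ex, eg] at i4
    have sq : ∀ q : ℝ, √(τ ^ 2 * q) = τ * √q := fun q => by
      rw [Real.sqrt_mul (by positivity), Real.sqrt_sq hτ0.le]
    have j1 : dist x' p' ≤ τ * √(A ^ 2 + R ^ 2 - 2 * (c₁ - ε) * (A * R)) := by
      rw [← sq]; apply Real.le_sqrt_of_sq_le; nlinarith
    have j2 : dist p' g' ≤ τ * √(R ^ 2 + B ^ 2 - 2 * (c₂ - ε) * (R * B)) := by
      rw [← sq]; apply Real.le_sqrt_of_sq_le; nlinarith
    have j4 : τ * √(A ^ 2 + B ^ 2 - 2 * c₄ * (A * B)) ≤ dist x' g' := by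
      rw [← sq]; apply Real.sqrt_le_iff.2 ⟨dist_nonneg, by nlinarith⟩
    have := dist_triangle x' p' g'
    exact le_of_mul_le_mul_left (by linarith) hτ0
  have hlim : Filter.Tendsto (fun ε : ℝ => √(A ^ 2 + R ^ 2 - 2 * (c₁ - ε) * (A * R)) +
      √(R ^ 2 + B ^ 2 - 2 * (c₂ - ε) * (R * B))) (nhdsWithin 0 (Set.Ioi 0))
      (nhds (√(A ^ 2 + R ^ 2 - 2 * (c₁ - 0) * (A * R)) +
        √(R ^ 2 + B ^ 2 - 2 * (c₂ - 0) * (R * B)))) := by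
    apply Filter.Tendsto.mono_left _ nhdsWithin_le_nhds
    apply Continuous.tendsto
    fun_prop
  simp only [sub_zero] at hlim
  exact ge_of_tendsto hlim (by filter_upwards [self_mem_nhdsWithin] with ε hε using key ε hε)

/-- The triangle inequality for angles. -/
theorem IsCNSet.arccos_le_add (hS : IsCNSet S) {h x p g : X} (hh : h ∈ S) (hx : x ∈ S)
    (hp : p ∈ S) (hg : g ∈ S) (hx0 : 0 < dist h x) (hp0 : 0 < dist h p) (hg0 : 0 < dist h g)
    {c₁ c₂ c₄ : ℝ} (h1 : IsAngleCos S h x p c₁) (h2 : IsAngleCos S h p g c₂)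
    (h4 : IsAngleCos S h x g c₄) : Real.arccos c₄ ≤ Real.arccos c₁ + Real.arccos c₂ := by
  by_contra! hlt
  have key := fun A B R hA hB hR =>
    hS.planar_le hh hx hp hg hx0 hp0 hg0 h1 h2 h4 (A := A) (B := B) (R := R) hA hB hR
  have e1 := Real.cos_arccos h1.mem.1 h1.mem.2
  have e2 := Real.cos_arccos h2.mem.1 h2.mem.2
  have e4 := Real.cos_arccos h4.mem.1 h4.mem.2
  have n1 := Real.arccos_nonneg c₁
  have n2 := Real.arccos_nonneg c₂
  have l4 := Real.arccos_le_pi c₄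
  set θ₁ := Real.arccos c₁
  set θ₂ := Real.arccos c₂
  set θ₄ := Real.arccos c₄
  have hcos : Real.cos θ₄ < Real.cos (θ₁ + θ₂) :=
    Real.cos_lt_cos_of_nonneg_of_le_pi (by positivity) l4 hlt
  have sq0 : ∀ c : ℝ, c ≤ 1 → 0 ≤ 1 ^ 2 + 1 ^ 2 - 2 * c * (1 * 1) := fun c hc => by linarith
  rcases n1.eq_or_lt with z1 | z1
  · rw [← z1, Real.cos_zero] at e1
    have := key 1 1 1 one_pos one_pos one_pos
    rw [← e1] at this
    rw [show (1 : ℝ) ^ 2 + 1 ^ 2 - 2 * 1 * (1 * 1) = 0 by norm_num, Real.sqrt_zero, zero_add,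
      Real.sqrt_le_sqrt_iff (sq0 _ h2.mem.2)] at this
    rw [← z1, zero_add, e2, e4] at hcos
    linarith
  rcases n2.eq_or_lt with z2 | z2
  · rw [← z2, Real.cos_zero] at e2
    have := key 1 1 1 one_pos one_pos one_pos
    rw [← e2] at this
    rw [show (1 : ℝ) ^ 2 + 1 ^ 2 - 2 * 1 * (1 * 1) = 0 by norm_num, Real.sqrt_zero, add_zero,
      Real.sqrt_le_sqrt_iff (sq0 _ h1.mem.2)] at this
    rw [← z2, add_zero, e1, e4] at hcos
    linarith
  have s1 : 0 < Real.sin θ₁ := Real.sin_pos_of_pos_of_lt_pi z1 (by linarith)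
  have s2 : 0 < Real.sin θ₂ := Real.sin_pos_of_pos_of_lt_pi z2 (by linarith)
  have s12 : 0 < Real.sin (θ₁ + θ₂) := Real.sin_pos_of_pos_of_lt_pi (by linarith) (by linarith)
  -- In the plane, place rays at the angles `0`, `θ₁`, `θ₁ + θ₂`. For these lengths the point on the
  -- middle ray is the midpoint of the segment between the other two, so the right-hand side is the
  -- length of that segment. The left-hand side is larger because `θ₄` exceeds `θ₁ + θ₂`.
  have := key (Real.sin θ₂) (Real.sin θ₁) (Real.sin (θ₁ + θ₂) / 2) s2 s1 (by positivity)
  rw [Real.sin_add] at this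
  rw [e4, Real.cos_add] at hcos
  have q1 := Real.sin_sq_add_cos_sq θ₁
  have q2 := Real.sin_sq_add_cos_sq θ₂
  rw [← e1, ← e2] at this
  generalize Real.sin θ₁ = a at *
  generalize Real.sin θ₂ = b at *
  generalize Real.cos θ₁ = k at *
  generalize Real.cos θ₂ = l at *
  set V := ((b * k - a * l) / 2) ^ 2 + (a * b) ^ 2 with hV
  have hV0 : 0 ≤ V := by positivity
  have v1 : b ^ 2 + ((a * l + k * b) / 2) ^ 2 - 2 * k * (b * ((a * l + k * b) / 2)) = V := by
    rw [hV]
    have : b ^ 2 = b ^ 2 * (a ^ 2 + k ^ 2) := by rw [q1, mul_one]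
    rw [this]; ring
  have v2 : ((a * l + k * b) / 2) ^ 2 + a ^ 2 - 2 * l * ((a * l + k * b) / 2 * a) = V := by
    rw [hV]
    have : a ^ 2 = a ^ 2 * (b ^ 2 + l ^ 2) := by rw [q2, mul_one]
    rw [this]; ring
  rw [v1, v2, ← two_mul] at this
  have w := Real.sqrt_le_iff.1 this
  have w2 := w.2
  rw [mul_pow, Real.sq_sqrt hV0] at w2
  have v3 : 2 ^ 2 * V = b ^ 2 + a ^ 2 - 2 * (k * l - a * b) * (b * a) := by
    have r1 : b ^ 2 = b ^ 2 * (a ^ 2 + k ^ 2) := by rw [q1, mul_one]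
    have r2 : a ^ 2 = a ^ 2 * (b ^ 2 + l ^ 2) := by rw [q2, mul_one]
    rw [hV]
    linear_combination (-1 : ℝ) * r1 + (-1 : ℝ) * r2
  rw [v3] at w2
  nlinarith [mul_pos s1 s2]

theorem add_mul_le_of_sq_add_sq_le {a b c d u v : ℝ} (hu : 0 ≤ u) (hv : 0 ≤ v)
    (h1 : a ^ 2 + b ^ 2 ≤ u ^ 2) (h2 : c ^ 2 + d ^ 2 ≤ v ^ 2) : a * c + b * d ≤ u * v := by
  refine abs_le_of_sq_le_sq' ?_ (by positivity) |>.2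
  calc (a * c + b * d) ^ 2 ≤ (a ^ 2 + b ^ 2) * (c ^ 2 + d ^ 2) := by
        nlinarith [sq_nonneg (a * d - b * c)]
    _ ≤ u ^ 2 * v ^ 2 := by gcongr
    _ = (u * v) ^ 2 := by ring

/-- Two Euclidean hinges with a common side. -/
theorem sq_add_ge_of_hinges {P G Y s t θ φ : ℝ} (hs : 0 ≤ s) (ht : 0 ≤ t)
    (h1 : P ^ 2 + G ^ 2 - 2 * Real.cos θ * (P * G) ≤ s ^ 2)
    (h2 : G ^ 2 + Y ^ 2 - 2 * Real.cos φ * (G * Y) ≤ t ^ 2) :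
    P ^ 2 + Y ^ 2 - 2 * Real.cos (θ + φ) * (P * Y) ≤ (s + t) ^ 2 := by
  rw [Real.cos_add]
  have q1 := Real.sin_sq_add_cos_sq θ
  have q2 := Real.sin_sq_add_cos_sq φ
  generalize Real.sin θ = a at *
  generalize Real.sin φ = b at *
  generalize Real.cos θ = k at *
  generalize Real.cos φ = l at *
  have e1 : P ^ 2 = P ^ 2 * (a ^ 2 + k ^ 2) := by rw [q1, mul_one]
  have e2 : Y ^ 2 = Y ^ 2 * (b ^ 2 + l ^ 2) := by rw [q2, mul_one]
  have i1 : (P * k - G) ^ 2 + (P * a) ^ 2 ≤ s ^ 2 := by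
    rw [e1] at h1; nlinarith
  have i2 : (G - Y * l) ^ 2 + (Y * b) ^ 2 ≤ t ^ 2 := by
    rw [e2] at h2; nlinarith
  have := add_mul_le_of_sq_add_sq_le hs ht i1 i2
  rw [e1, e2]
  nlinarith

/-- If two adjacent Euclidean angles sum up to more than `π`, then the broken line has to go
around the vertex. -/
theorem add_le_of_hinges {P G Y s t c d : ℝ} (hG : 0 ≤ G) (hs : 0 ≤ s) (ht : 0 ≤ t)
    (hc : c ∈ Set.Icc (-1 : ℝ) 1) (hd : d ∈ Set.Icc (-1 : ℝ) 1)
    (h1 : P ^ 2 + G ^ 2 - 2 * c * (P * G) ≤ s ^ 2)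
    (h2 : G ^ 2 + Y ^ 2 - 2 * d * (G * Y) ≤ t ^ 2) (hcd : c + d ≤ 0) : P + Y ≤ s + t := by
  -- The side `s` is at least its projection to the direction of `P`.
  have i1 : P - G * c ≤ s := by
    refine (abs_le_of_sq_le_sq' ?_ hs).2
    nlinarith [mul_nonneg (sq_nonneg G) (show 0 ≤ 1 - c ^ 2 by nlinarith [hc.1, hc.2])]
  have i2 : Y - G * d ≤ t := by
    refine (abs_le_of_sq_le_sq' ?_ ht).2
    nlinarith [mul_nonneg (sq_nonneg G) (show 0 ≤ 1 - d ^ 2 by nlinarith [hd.1, hd.2])]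
  nlinarith

end Angle

/-! ### Gluing -/

section Gluing

variable {X : Type*} [MetricSpace X] {S S₁ S₂ : Set X}

theorem IsAngleCos.symm {h u v : X} {c : ℝ} (hc : IsAngleCos S h u v c) :
    IsAngleCos S h v u c := by
  refine ⟨fun u' hu' v' hv' b1 b2 => ?_, fun ε hε => ?_, hc.mem⟩
  · rw [comparisonInner_comm, mul_comm (dist h u')]
    exact hc.le v' hv' u' hu' b2 b1
  · obtain ⟨ρ, hρ, H⟩ := hc.ge ε hε
    refine ⟨ρ, hρ, fun u' hu' v' hv' b1 b2 r1 r2 => ?_⟩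
    rw [comparisonInner_comm, mul_comm (dist h u')]
    exact H v' hv' u' hu' b2 b1 r2 r1

/-- The tangent line bound for the square root; it turns bounds for squared distances into
first-order bounds for distances. -/
theorem le_add_div_of_sq_le {d A w : ℝ} (hA : 0 < A) (h : d ^ 2 ≤ A ^ 2 + w) :
    d ≤ A + w / (2 * A) := by
  have e : w = 2 * A * (w / (2 * A)) := by field_simp
  set q := w / (2 * A)
  rw [e] at h
  have : 0 ≤ A + q := by
    by_contra! hn
    nlinarith [sq_nonneg d]
  refine (abs_le_of_sq_le_sq' ?_ this).2
  nlinarith [sq_nonneg q]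

/-- Adjacent angles at an interior point of a geodesic sum up to at least `π`. -/
theorem IsAngleCos.add_nonpos (h1 : IsCNSet S₁) (h2 : IsCNSet S₂) (hH : IsCNSet (S₁ ∩ S₂))
    {x y h g : X} (hx : x ∈ S₁) (hy : y ∈ S₂) (hh : h ∈ S₁ ∩ S₂) (hg : g ∈ S₁ ∩ S₂)
    (hx0 : 0 < dist h x) (hy0 : 0 < dist h y) (hg0 : 0 < dist h g)
    (hb : dist x h + dist h y = dist x y) {c d : ℝ} (hc : IsAngleCos S₁ h x g c)
    (hd : IsAngleCos S₂ h y g d) : c + d ≤ 0 := by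
  by_contra! he
  obtain ⟨ρ₁, hρ₁, k1⟩ := hc.ge ((c + d) / 8) (by positivity)
  obtain ⟨ρ₂, hρ₂, k2⟩ := hd.ge ((c + d) / 8) (by positivity)
  set m := min (min ρ₁ ρ₂) (min (dist h x) (min (dist h y) (dist h g))) with hm
  have hm0 : 0 < m := by simp [*]
  have m1 : m ≤ ρ₁ := (min_le_left _ _).trans (min_le_left _ _)
  have m2 : m ≤ ρ₂ := (min_le_left _ _).trans (min_le_right _ _)
  have m3 : m ≤ dist h x := (min_le_right _ _).trans (min_le_left _ _)
  have m4 : m ≤ dist h y := (min_le_right _ _).trans ((min_le_right _ _).trans (min_le_left _ _))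
  have m5 : m ≤ dist h g := (min_le_right _ _).trans ((min_le_right _ _).trans (min_le_right _ _))
  -- If `c + d > 0`, a detour along the common ray to `g` is a shortcut. Going from `x'` to `y'` by
  -- way of the point `g'` at distance `m * σ` costs at most `2 * m + m * σ * (σ - 3 / 4 * (c +
  -- d))`, and for this `σ` that is less than `2 * m`.
  set σ := (c + d) / 4 with hσ
  have hσ0 : 0 < σ := by positivity
  have hσ1 : σ ≤ 1 := by linarith [hc.mem.2, hd.mem.2]
  have hmσ : m * σ ≤ m := mul_le_of_le_one_right hm0.le hσ1
  obtain ⟨x', hx', ex, bx⟩ := h1.exists_dist_eq hh.1 hx hm0.le m3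
  obtain ⟨y', hy', ey, by'⟩ := h2.exists_dist_eq hh.2 hy hm0.le m4
  obtain ⟨g', hg', eg, bg⟩ := hH.exists_dist_eq hh hg (a := m * σ) (by positivity) (hmσ.trans m5)
  have i1 := k1 x' hx' g' hg'.1 bx bg (ex ▸ m1) (eg ▸ hmσ.trans m1)
  have i2 := k2 y' hy' g' hg'.2 by' bg (ey ▸ m2) (eg ▸ hmσ.trans m2)
  rw [comparisonInner, ex, eg] at i1
  rw [comparisonInner, ey, eg] at i2
  have j1 := le_add_div_of_sq_le (d := dist x' g') (A := m)
    (w := (m * σ) ^ 2 - 2 * (c - (c + d) / 8) * (m * (m * σ))) hm0 (by linarith)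
  have j2 := le_add_div_of_sq_le (d := dist y' g') (A := m)
    (w := (m * σ) ^ 2 - 2 * (d - (c + d) / 8) * (m * (m * σ))) hm0 (by linarith)
  have e1 : ((m * σ) ^ 2 - 2 * (c - (c + d) / 8) * (m * (m * σ))) / (2 * m) =
    m * σ * (σ / 2 - (c - (c + d) / 8)) := by field_simp
  have e2 : ((m * σ) ^ 2 - 2 * (d - (c + d) / 8) * (m * (m * σ))) / (2 * m) =
    m * σ * (σ / 2 - (d - (c + d) / 8)) := by field_simp
  rw [e1] at j1
  rw [e2] at j2
  have t1 := dist_triangle x x' y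
  have t2 := dist_triangle x' y' y
  have t3 := dist_triangle x' g' y'
  rw [dist_comm g' y'] at t3
  rw [dist_comm x h] at hb
  rw [dist_comm x x'] at t1
  have : 0 ≤ m * σ * (σ - (c + d) + (c + d) / 4) := by nlinarith
  have p : 0 < m * σ := by positivity
  have := nonneg_of_mul_nonneg_right this p
  linarith

/-- The inequality of Bruhat and Tits for the point `m` of a geodesic from `x` to `y`. -/
def StewartLE (p x m y : X) : Prop :=
  dist m y * comparisonInner m x p + dist x m * comparisonInner m y p ≤ 0

theorem StewartLE.symm {p x m y : X} (h : StewartLE p x m y) : StewartLE p y m x := by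
  rw [StewartLE, dist_comm m x, dist_comm y m] at *
  linarith

/-- Eliminating `dist p h` from the two inequalities gives the third. Points of a geodesic that
changes sides are thereby reduced to the crossing point `h`. -/
theorem StewartLE.trans {p x m h y : X} (b1 : dist x m + dist m h = dist x h)
    (b3 : dist m h + dist h y = dist m y)
    (h1 : StewartLE p x m h) (h2 : StewartLE p x h y) : StewartLE p x m y := by
  rcases (dist_nonneg (x := x) (y := h)).eq_or_lt with h0 | h0
  · have d1 := dist_nonneg (x := x) (y := m)
    have d2 := dist_nonneg (x := m) (y := h)
    have e : dist x m = 0 := by linarith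
    have := dist_eq_zero.1 e
    subst this
    simp [StewartLE, comparisonInner]
  · simp only [StewartLE, comparisonInner, dist_comm m x, dist_comm h x] at *
    rw [← b1] at *
    rw [← b3] at *
    refine nonpos_of_mul_nonpos_right ?_ h0
    have d1 := dist_nonneg (x := x) (y := m)
    have d2 := dist_nonneg (x := m) (y := h)
    have d3 := dist_nonneg (x := h) (y := y)
    nlinarith [mul_le_mul_of_nonneg_left h1 (add_nonneg (add_nonneg d1 d2) d3),
      mul_le_mul_of_nonneg_left h2 d1]

theorem StewartLE.shrink {p x m y : X} (b : dist x m + dist m y = dist x y)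
    (h : StewartLE p x m y) :
    dist x m * comparisonInner x y p ≤ dist x y * comparisonInner x m p := by
  simp only [StewartLE, comparisonInner, dist_comm m x] at *
  rw [← b]
  nlinarith

theorem comparisonInner_self_left (h p : X) : comparisonInner h h p = 0 := by
  simp [comparisonInner]

/-- The hypotheses of the gluing theorem. -/
structure IsGluing (S₁ S₂ : Set X) : Prop where
  left : IsCNSet S₁
  right : IsCNSet S₂
  inter : IsCNSet (S₁ ∩ S₂)
  exists_mem : ∀ x ∈ S₁, ∀ y ∈ S₂, ∃ h ∈ S₁ ∩ S₂, dist x h + dist h y = dist x y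

theorem IsGluing.symm (hG : IsGluing S₁ S₂) : IsGluing S₂ S₁ := by
  refine ⟨hG.right, hG.left, Set.inter_comm S₁ S₂ ▸ hG.inter, fun x hx y hy => ?_⟩
  obtain ⟨h, hh, e⟩ := hG.exists_mem y hy x hx
  refine ⟨h, ⟨hh.2, hh.1⟩, ?_⟩
  rw [dist_comm x h, dist_comm h y, dist_comm x y, add_comm, e]

/-- A comparison angle between the two parts is bounded below by a sum of angles. -/
theorem IsGluing.exists_angle (hG : IsGluing S₁ S₂) {h p y : X} (hh : h ∈ S₁ ∩ S₂) (hp : p ∈ S₁)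
    (hy : y ∈ S₂) (hp0 : 0 < dist h p) (hy0 : 0 < dist h y) :
    comparisonInner h y p ≤ -(2 * (dist h p * dist h y)) ∨
    ∃ g ∈ S₁ ∩ S₂, 0 < dist h g ∧ ∃ c d, IsAngleCos S₁ h p g c ∧ IsAngleCos S₂ h g y d ∧
      Real.arccos c + Real.arccos d ≤ Real.pi ∧
      comparisonInner h y p ≤
        2 * Real.cos (Real.arccos c + Real.arccos d) * (dist h p * dist h y) := by
  obtain ⟨g, hg, hb⟩ := hG.exists_mem p hp y hy
  rcases (dist_nonneg (x := h) (y := g)).eq_or_lt with g0 | g0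
  -- The geodesic from `p` to `y` passes through `h`, so the comparison angle at `h` is `π`.
  · left
    have := dist_eq_zero.1 g0.symm
    subst this
    rw [comparisonInner, dist_comm y p, ← hb, dist_comm p h]
    nlinarith
  obtain ⟨c, hc⟩ := hG.left.exists_isAngleCos hh.1 hp hg.1 hp0 g0
  obtain ⟨d, hd⟩ := hG.right.exists_isAngleCos hh.2 hg.2 hy g0 hy0
  have i1 := hc.dist_sq_ge hp hg.1 (by simp) (by simp)
  have i2 := hd.dist_sq_ge hg.2 hy (by simp) (by simp)
  by_cases hcd : Real.arccos c + Real.arccos d ≤ Real.pi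
  · right
    refine ⟨g, hg, g0, c, d, hc, hd, hcd, ?_⟩
    have e1 := Real.cos_arccos hc.mem.1 hc.mem.2
    have e2 := Real.cos_arccos hd.mem.1 hd.mem.2
    have := sq_add_ge_of_hinges (θ := Real.arccos c) (φ := Real.arccos d) (P := dist h p)
      (G := dist h g) (Y := dist h y) (s := dist p g) (t := dist g y) dist_nonneg dist_nonneg
      (by rw [e1]; exact i1) (by rw [e2]; exact i2)
    rw [hb] at this
    rw [comparisonInner, dist_comm y p]
    linarith
  · left
    have hcd' : c + d ≤ 0 := by
      push Not at hcd
      have := Real.cos_le_cos_of_nonneg_of_le_pi (x := Real.pi - Real.arccos d)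
        (y := Real.arccos c) (by linarith [Real.arccos_le_pi d]) (Real.arccos_le_pi c)
        (by linarith)
      rw [Real.cos_pi_sub, Real.cos_arccos hc.mem.1 hc.mem.2,
        Real.cos_arccos hd.mem.1 hd.mem.2] at this
      linarith
    have := add_le_of_hinges (P := dist h p) (G := dist h g) (Y := dist h y) (s := dist p g)
      (t := dist g y) dist_nonneg dist_nonneg dist_nonneg hc.mem hd.mem i1 i2 hcd'
    rw [hb] at this
    have := pow_le_pow_left₀ (by positivity) this 2
    rw [comparisonInner, dist_comm y p]
    linarith

/-- It suffices that the comparison angles at `h` from `p` to `x` and to `y` sum up to at least `π`.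
If `[p, y]` crosses at `g`, the second one is at least `∠(p, g) + ∠(g, y)`. Moreover `∠(x, g) + ∠(g,
y) ≥ π` because `h` lies on the geodesic `[x, y]`, and `∠(x, g) ≤ ∠(x, p) + ∠(p, g)` inside `S₁`. -/
theorem IsGluing.stewartLE_of_mem_left (hG : IsGluing S₁ S₂) {x y h p : X} (hx : x ∈ S₁)
    (hy : y ∈ S₂) (hh : h ∈ S₁ ∩ S₂) (hb : dist x h + dist h y = dist x y) (hp : p ∈ S₁) :
    StewartLE p x h y := by
  rcases (dist_nonneg (x := h) (y := x)).eq_or_lt with x0 | x0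
  · have := dist_eq_zero.1 x0.symm
    subst this
    simp [StewartLE, comparisonInner_self_left]
  rcases (dist_nonneg (x := h) (y := y)).eq_or_lt with y0 | y0
  · have := dist_eq_zero.1 y0.symm
    subst this
    simp [StewartLE, comparisonInner_self_left]
  rcases (dist_nonneg (x := h) (y := p)).eq_or_lt with p0 | p0
  · have := dist_eq_zero.1 p0.symm
    subst this
    simp only [StewartLE]
    rw [comparisonInner_comm h x, comparisonInner_comm h y, comparisonInner_self_left,
      comparisonInner_self_left]
    simp
  rw [StewartLE, dist_comm x h]
  have bx := comparisonInner_le h x p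
  rcases hG.exists_angle hh hp hy p0 y0 with H | ⟨g, hg, g0, c₂, c₃, h2, h3, hle, H⟩
  · nlinarith [mul_le_mul_of_nonneg_left bx y0.le, mul_le_mul_of_nonneg_left H x0.le]
  · obtain ⟨c₁, h1⟩ := hG.left.exists_isAngleCos hh.1 hx hp x0 p0
    obtain ⟨c₄, h4⟩ := hG.left.exists_isAngleCos hh.1 hx hg.1 x0 g0
    have t := hG.left.arccos_le_add hh.1 hx hp hg.1 x0 p0 g0 h1 h2 h4
    have f := h4.add_nonpos hG.left hG.right hG.inter hx hy hh hg x0 y0 g0 hb h3.symm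
    have k1 := h1.le x hx p hp (by simp) (by simp)
    have f' : Real.pi - Real.arccos c₃ ≤ Real.arccos c₄ := by
      rw [← Real.arccos_neg]
      exact Real.arccos_le_arccos (by linarith)
    have key : c₁ ≤ -Real.cos (Real.arccos c₂ + Real.arccos c₃) := by
      have := Real.cos_le_cos_of_nonneg_of_le_pi
        (x := Real.pi - (Real.arccos c₂ + Real.arccos c₃)) (y := Real.arccos c₁) (by linarith)
        (Real.arccos_le_pi c₁) (by linarith)
      rwa [Real.cos_pi_sub, Real.cos_arccos h1.mem.1 h1.mem.2] at this
    have p1 : 0 ≤ dist h x * dist h y * dist h p := by positivity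
    nlinarith [mul_le_mul_of_nonneg_left k1 y0.le, mul_le_mul_of_nonneg_left H x0.le,
      mul_le_mul_of_nonneg_left key p1]

theorem IsGluing.stewartLE (hG : IsGluing S₁ S₂) {x y h p : X} (hx : x ∈ S₁) (hy : y ∈ S₂)
    (hh : h ∈ S₁ ∩ S₂) (hb : dist x h + dist h y = dist x y) (hp : p ∈ S₁ ∪ S₂) :
    StewartLE p x h y := by
  rcases hp with hp | hp
  · exact hG.stewartLE_of_mem_left hx hy hh hb hp
  · refine (hG.symm.stewartLE_of_mem_left hy hx ⟨hh.2, hh.1⟩ ?_ hp).symm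
    rw [dist_comm y h, dist_comm h x, dist_comm y x, ← hb]; ring

/-- Geodesics of the intersection lie in both sets, so both angles are seen on the same points. This
allows angles to be transferred from one side to the other. -/
theorem IsAngleCos.le_of_inter (hH : IsCNSet (S₁ ∩ S₂)) {h u v : X} (hh : h ∈ S₁ ∩ S₂)
    (hu : u ∈ S₁ ∩ S₂) (hv : v ∈ S₁ ∩ S₂) (hu0 : 0 < dist h u) (hv0 : 0 < dist h v) {c d : ℝ}
    (hc : IsAngleCos S₁ h u v c) (hd : IsAngleCos S₂ h u v d) : c ≤ d := by
  refine le_of_forall_pos_sub_le fun ε hε => ?_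
  obtain ⟨ρ, hρ, k⟩ := hc.ge ε hε
  have hm : 0 < min ρ (min (dist h u) (dist h v)) := by simp [*]
  obtain ⟨u', hu', eu, bu⟩ := hH.exists_dist_eq hh hu hm.le
    ((min_le_right _ _).trans (min_le_left _ _))
  obtain ⟨v', hv', ev, bv⟩ := hH.exists_dist_eq hh hv hm.le
    ((min_le_right _ _).trans (min_le_right _ _))
  have i1 := k u' hu'.1 v' hv'.1 bu bv (eu ▸ min_le_left _ _) (ev ▸ min_le_left _ _)
  have i2 := hd.le u' hu'.2 v' hv'.2 bu bv
  rw [eu, ev] at i1 i2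
  have := i1.trans i2
  have := le_of_mul_le_mul_right this (mul_pos hm hm)
  linarith

theorem IsAngleCos.eq_neg_one (hS : IsCNSet S) {h a b : X} (hh : h ∈ S) (ha : a ∈ S) (hb : b ∈ S)
    (ha0 : 0 < dist h a) (hb0 : 0 < dist h b) (hab : dist a h + dist h b = dist a b) {c : ℝ}
    (hc : IsAngleCos S h a b c) : c = -1 := by
  refine le_antisymm ?_ hc.mem.1
  refine le_of_forall_pos_sub_le fun ε hε => ?_
  obtain ⟨ρ, hρ, k⟩ := hc.ge ε hε
  have hm : 0 < min ρ (min (dist h a) (dist h b)) := by simp [*]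
  obtain ⟨u', hu', eu, bu⟩ := hS.exists_dist_eq hh ha hm.le
    ((min_le_right _ _).trans (min_le_left _ _))
  obtain ⟨v', hv', ev, bv⟩ := hS.exists_dist_eq hh hb hm.le
    ((min_le_right _ _).trans (min_le_right _ _))
  have i1 := k u' hu' v' hv' bu bv (eu ▸ min_le_left _ _) (ev ▸ min_le_left _ _)
  have t1 := dist_triangle a u' b
  have t2 := dist_triangle u' v' b
  rw [dist_comm a h] at hab
  rw [dist_comm a u'] at t1
  have t3 : dist h u' + dist h v' ≤ dist u' v' := by linarith
  have t4 := pow_le_pow_left₀ (by positivity) t3 2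
  rw [comparisonInner, eu, ev] at i1
  rw [eu, ev] at t4
  generalize min ρ (min (dist h a) (dist h b)) = m at *
  have : 2 * (c - ε) * (m * m) ≤ 2 * (-1) * (m * m) := by nlinarith
  have := le_of_mul_le_mul_right this (mul_pos hm hm)
  linarith

/-- Let `[p, a]` and `[p, b]` cross at `g` and `g'`. In `S₂` the angles at `m` from `a` to `g`, from
`g` to `g'` and from `g'` to `b` sum up to at least `π`. The middle one is bounded in `S₁` by the
angles from `g` to `p` and from `p` to `g'`. -/
theorem IsGluing.stewartLE_right_of_mem_inter (hG : IsGluing S₁ S₂) {a b m p : X} (ha : a ∈ S₂)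
    (hb : b ∈ S₂) (hm : m ∈ S₁ ∩ S₂) (hab : dist a m + dist m b = dist a b) (hp : p ∈ S₁) :
    StewartLE p a m b := by
  rcases (dist_nonneg (x := m) (y := a)).eq_or_lt with a0 | a0
  · have := dist_eq_zero.1 a0.symm
    subst this
    simp [StewartLE, comparisonInner_self_left]
  rcases (dist_nonneg (x := m) (y := b)).eq_or_lt with b0 | b0
  · have := dist_eq_zero.1 b0.symm
    subst this
    simp [StewartLE, comparisonInner_self_left]
  rcases (dist_nonneg (x := m) (y := p)).eq_or_lt with p0 | p0
  · have := dist_eq_zero.1 p0.symm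
    subst this
    simp only [StewartLE]
    rw [comparisonInner_comm m a, comparisonInner_comm m b, comparisonInner_self_left,
      comparisonInner_self_left]
    simp
  rw [StewartLE, dist_comm a m]
  have ba := comparisonInner_le m a p
  have bb := comparisonInner_le m b p
  rcases hG.exists_angle hm hp ha p0 a0 with H | ⟨g, hg, g0, c, d, hc, hd, hle, H⟩
  · nlinarith [mul_le_mul_of_nonneg_left bb a0.le, mul_le_mul_of_nonneg_left H b0.le]
  rcases hG.exists_angle hm hp hb p0 b0 with H' | ⟨g', hg', g0', c', d', hc', hd', hle', H'⟩
  · nlinarith [mul_le_mul_of_nonneg_left ba b0.le, mul_le_mul_of_nonneg_left H' a0.le]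
  obtain ⟨e, he⟩ := hG.right.exists_isAngleCos hm.2 ha hb a0 b0
  have e1 := he.eq_neg_one hG.right hm.2 ha hb a0 b0 hab
  obtain ⟨e₁, he₁⟩ := hG.right.exists_isAngleCos hm.2 hg.2 hb g0 b0
  obtain ⟨e₂, he₂⟩ := hG.right.exists_isAngleCos hm.2 hg.2 hg'.2 g0 g0'
  obtain ⟨e₃, he₃⟩ := hG.left.exists_isAngleCos hm.1 hg.1 hg'.1 g0 g0'
  have t1 := hG.right.arccos_le_add hm.2 ha hg.2 hb a0 g0 b0 hd.symm he₁ he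
  have t2 := hG.right.arccos_le_add hm.2 hg.2 hg'.2 hb g0 g0' b0 he₂ hd' he₁
  have t3 := hG.left.arccos_le_add hm.1 hg.1 hp hg'.1 g0 p0 g0' hc.symm hc' he₃
  have t4 := Real.arccos_le_arccos (he₃.le_of_inter hG.inter hm hg hg' g0 g0' he₂)
  rw [e1, Real.arccos_neg_one] at t1
  have key := Real.cos_le_cos_of_nonneg_of_le_pi (x := Real.pi - (Real.arccos c + Real.arccos d))
    (y := Real.arccos c' + Real.arccos d') (by linarith) hle' (by linarith)
  rw [Real.cos_pi_sub] at key
  have p1 : 0 ≤ dist m a * dist m b * dist m p := by positivity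
  nlinarith [mul_le_mul_of_nonneg_left H b0.le, mul_le_mul_of_nonneg_left H' a0.le,
    mul_le_mul_of_nonneg_left key p1]

/-- If `m` is not in the intersection, the geodesic from `m` to `p` starts with a segment inside
`S₂`. The broken line from `a` to `b` by way of a point of this segment is not shorter than `[a,
b]`, and the first variation of its length at `m` is the claim. -/
theorem IsGluing.stewartLE_right (hG : IsGluing S₁ S₂) {a b m p : X} (ha : a ∈ S₂)
    (hb : b ∈ S₂) (hm : m ∈ S₂) (hab : dist a m + dist m b = dist a b) (hp : p ∈ S₁) :
    StewartLE p a m b := by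
  rcases (dist_nonneg (x := m) (y := a)).eq_or_lt with a0 | a0
  · have := dist_eq_zero.1 a0.symm
    subst this
    simp [StewartLE, comparisonInner_self_left]
  rcases (dist_nonneg (x := m) (y := b)).eq_or_lt with b0 | b0
  · have := dist_eq_zero.1 b0.symm
    subst this
    simp [StewartLE, comparisonInner_self_left]
  obtain ⟨g, hg, bg⟩ := hG.symm.exists_mem m hm p hp
  rcases (dist_nonneg (x := m) (y := g)).eq_or_lt with g0 | g0
  · have := dist_eq_zero.1 g0.symm
    subst this
    exact hG.stewartLE_right_of_mem_inter ha hb ⟨hg.2, hg.1⟩ hab hp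
  have p0 : 0 < dist m p := by linarith [dist_nonneg (x := g) (y := p)]
  have sa := (hG.symm.stewartLE hm hp hg bg (Or.inl ha)).shrink bg
  have sb := (hG.symm.stewartLE hm hp hg bg (Or.inl hb)).shrink bg
  set A := dist m a with hA
  set B := dist m b with hB
  set P := dist m p with hP
  set qa := comparisonInner m p a with hqa
  set qb := comparisonInner m p b with hqb
  -- Here `g'` is the point at distance `μ` from `m`; the right-hand side is the second-order error,
  -- which disappears for `μ → 0`.
  have key : ∀ μ > 0, μ ≤ dist m g → B * qa + A * qb ≤ μ * (P * (A + B)) := by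
    intro μ hμ hμg
    obtain ⟨g', hg', eg, bg'⟩ := hG.right.exists_dist_eq hm hg.1 hμ.le hμg
    have ta := hG.right.shrink hm hg.1 hg' ha bg'
    have tb := hG.right.shrink hm hg.1 hg' hb bg'
    rw [eg] at ta tb
    have ua : μ * qa ≤ P * comparisonInner m g' a := by
      refine le_of_mul_le_mul_left ?_ g0
      nlinarith
    have ub : μ * qb ≤ P * comparisonInner m g' b := by
      refine le_of_mul_le_mul_left ?_ g0
      nlinarith
    rw [comparisonInner, eg, ← hA] at ua
    rw [comparisonInner, eg, ← hB] at ub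
    have va := le_add_div_of_sq_le (d := dist g' a) (A := A) (w := μ ^ 2 - μ * qa / P)
      a0 (by
        have : μ * qa / P ≤ μ ^ 2 + A ^ 2 - dist g' a ^ 2 := by
          rw [div_le_iff₀ p0]; linarith
        linarith)
    have vb := le_add_div_of_sq_le (d := dist g' b) (A := B) (w := μ ^ 2 - μ * qb / P)
      b0 (by
        have : μ * qb / P ≤ μ ^ 2 + B ^ 2 - dist g' b ^ 2 := by
          rw [div_le_iff₀ p0]; linarith
        linarith)
    have t := dist_triangle a g' b
    rw [dist_comm a g', ← hab, dist_comm a m] at t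
    have : 0 ≤ (μ ^ 2 - μ * qa / P) / (2 * A) + (μ ^ 2 - μ * qb / P) / (2 * B) := by linarith
    have e : (μ ^ 2 - μ * qa / P) / (2 * A) + (μ ^ 2 - μ * qb / P) / (2 * B) =
        μ / (2 * A * B * P) * (μ * (P * (A + B)) - (B * qa + A * qb)) := by
      field_simp; ring
    rw [e] at this
    have := nonneg_of_mul_nonneg_right this (by positivity)
    linarith
  have : B * qa + A * qb ≤ 0 := by
    have hlim : Filter.Tendsto (fun μ : ℝ => μ * (P * (A + B))) (nhdsWithin 0 (Set.Ioi 0))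
        (nhds (0 * (P * (A + B)))) := by
      apply Filter.Tendsto.mono_left _ nhdsWithin_le_nhds
      apply Continuous.tendsto
      fun_prop
    rw [zero_mul] at hlim
    refine ge_of_tendsto hlim ?_
    filter_upwards [Ioc_mem_nhdsGT g0] with μ hμ using key μ hμ.1 hμ.2
  rw [StewartLE, dist_comm a m, comparisonInner_comm m a, comparisonInner_comm m b]
  exact this

/-- If `m` lies in `S₂`, the geodesic enters and leaves at points `h` and `k` of the intersection.
Geodesics of `S₂` are unique and the intersection contains one from `h` to `k`, so it contains `m`.
-/
theorem IsGluing.mem_left_of_between (hG : IsGluing S₁ S₂) {x y m : X} (hx : x ∈ S₁)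
    (hy : y ∈ S₁) (hm : m ∈ S₁ ∪ S₂) (hb : dist x m + dist m y = dist x y) : m ∈ S₁ := by
  rcases hm with hm | hm
  · exact hm
  obtain ⟨h, hh, b1⟩ := hG.exists_mem x hx m hm
  obtain ⟨k, hk, b2⟩ := hG.symm.exists_mem m hm y hy
  have hk' : k ∈ S₁ ∩ S₂ := ⟨hk.2, hk.1⟩
  have t1 := dist_triangle x h y
  have t2 := dist_triangle h k y
  have t3 := dist_triangle h m k
  obtain ⟨m', hm', e, b⟩ := hG.inter.exists_dist_eq hh hk' (a := dist h m) dist_nonneg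
    (by linarith [dist_nonneg (x := m) (y := k)])
  have := hG.right.dist_eq_of_between hh.2 hk.1 hm hm'.2 (by linarith) b e.ge
  have : dist m m' = 0 := by linarith
  rw [dist_eq_zero.1 this]
  exact hm'.1

theorem IsGluing.stewartLE_of_mem_left_left (hG : IsGluing S₁ S₂) {x y m p : X} (hx : x ∈ S₁)
    (hy : y ∈ S₁) (hm : m ∈ S₁) (hp : p ∈ S₁ ∪ S₂) (hb : dist x m + dist m y = dist x y) :
    StewartLE p x m y := by
  rcases hp with hp | hp
  · exact hG.left.stewart hx hy hm hp hb
  · exact hG.symm.stewartLE_right hx hy hm hb hp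

theorem IsGluing.stewartLE_of_mem_left_right (hG : IsGluing S₁ S₂) {x y m p : X} (hx : x ∈ S₁)
    (hy : y ∈ S₂) (hm : m ∈ S₁) (hp : p ∈ S₁ ∪ S₂) (hb : dist x m + dist m y = dist x y) :
    StewartLE p x m y := by
  obtain ⟨h, hh, b⟩ := hG.exists_mem m hm y hy
  have t1 := dist_triangle x m h
  have t2 := dist_triangle x h y
  have b1 : dist x m + dist m h = dist x h := by linarith
  have b2 : dist x h + dist h y = dist x y := by linarith
  exact StewartLE.trans b1 b (hG.stewartLE_of_mem_left_left hx hh.1 hm hp b1)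
    (hG.stewartLE hx hy hh b2 hp)

theorem IsGluing.exists_between_of_le (hG : IsGluing S₁ S₂) {x y h : X} (hx : x ∈ S₁)
    (hh : h ∈ S₁) (hb : dist x h + dist h y = dist x y) {t : ℝ}
    (ht : t ∈ Set.Icc (0 : ℝ) 1) (hle : t * dist x y ≤ dist x h) :
    ∃ m ∈ S₁, IsBetween t x m y := by
  obtain ⟨m, hm, e, b⟩ := hG.left.exists_dist_eq hx hh (mul_nonneg ht.1 dist_nonneg) hle
  refine ⟨m, hm, e, le_antisymm ?_ ?_⟩
  · linarith [dist_triangle m h y]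
  · linarith [dist_triangle x m y]

theorem IsGluing.exists_between_left_right (hG : IsGluing S₁ S₂) {x y : X} (hx : x ∈ S₁)
    (hy : y ∈ S₂) {t : ℝ} (ht : t ∈ Set.Icc (0 : ℝ) 1) : ∃ m ∈ S₁ ∪ S₂, IsBetween t x m y := by
  obtain ⟨h, hh, b⟩ := hG.exists_mem x hx y hy
  by_cases hle : t * dist x y ≤ dist x h
  · obtain ⟨m, hm, e⟩ := hG.exists_between_of_le hx hh.1 b ht hle
    exact ⟨m, Or.inl hm, e⟩
  · obtain ⟨m, hm, e⟩ := hG.symm.exists_between_of_le (y := x) (t := 1 - t) hy hh.2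
      (by rw [dist_comm y h, dist_comm h x, dist_comm y x]; linarith)
      ⟨by linarith [ht.2], by linarith [ht.1]⟩ (by rw [dist_comm y h, dist_comm y x]; nlinarith)
    refine ⟨m, Or.inr hm, ?_⟩
    have := e.symm
    rwa [sub_sub_cancel] at this

/-- Gluing of two spaces along a convex subspace. -/
theorem IsGluing.isCNSet_union (hG : IsGluing S₁ S₂) : IsCNSet (S₁ ∪ S₂) := by
  refine ⟨?_, ?_⟩
  · rintro x (hx | hx) y (hy | hy) t ht
    · obtain ⟨m, hm, e⟩ := hG.left.exists_between x hx y hy t ht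
      exact ⟨m, Or.inl hm, e⟩
    · exact hG.exists_between_left_right hx hy ht
    · obtain ⟨m, hm, e⟩ := hG.symm.exists_between_left_right hx hy ht
      exact ⟨m, hm.symm, e⟩
    · obtain ⟨m, hm, e⟩ := hG.right.exists_between x hx y hy t ht
      exact ⟨m, Or.inr hm, e⟩
  · intro x hx y hy m hm p hp t ht hb
    refine cn_of_stewart hb ?_
    have b : dist x m + dist m y = dist x y := by rw [hb.1, hb.2]; ring
    have b' : dist y m + dist m x = dist y x := by
      rw [dist_comm y m, dist_comm m x, dist_comm y x]; linarith
    change StewartLE p x m y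
    rcases hx with hx | hx <;> rcases hy with hy | hy
    · exact hG.stewartLE_of_mem_left_left hx hy (hG.mem_left_of_between hx hy hm b) hp b
    · rcases hm with hm | hm
      · exact hG.stewartLE_of_mem_left_right hx hy hm hp b
      · exact (hG.symm.stewartLE_of_mem_left_right hy hx hm hp.symm b').symm
    · rcases hm with hm | hm
      · exact (hG.stewartLE_of_mem_left_right hy hx hm hp b').symm
      · exact hG.symm.stewartLE_of_mem_left_right hx hy hm hp.symm b
    · exact hG.symm.stewartLE_of_mem_left_left hx hy
        (hG.symm.mem_left_of_between hx hy hm.symm b) hp.symm b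

end Gluing

/-! ### Subspaces of products defined by clauses -/

/-- It is enough to have the inequality of Bruhat and Tits for one point of each ratio. -/
theorem IsCNSet.of_exists {X : Type*} [MetricSpace X] {S : Set X}
    (h : ∀ x ∈ S, ∀ y ∈ S, ∀ t ∈ Set.Icc (0 : ℝ) 1, ∃ m ∈ S, IsBetween t x m y ∧ ∀ p ∈ S,
      dist p m ^ 2 ≤ (1 - t) * dist p x ^ 2 + t * dist p y ^ 2 - t * (1 - t) * dist x y ^ 2) :
    IsCNSet S := by
  refine ⟨fun x hx y hy t ht => ?_, fun x hx y hy m hm p hp t ht hb => ?_⟩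
  · obtain ⟨m, hm, hb, -⟩ := h x hx y hy t ht
    exact ⟨m, hm, hb⟩
  · obtain ⟨m', hm', hb', H⟩ := h x hx y hy t ht
    have h1 := H m hm
    rw [dist_comm m x, hb.1, hb.2] at h1
    have h2 : dist m m' ^ 2 ≤ 0 := by nlinarith
    have h3 : dist m m' = 0 := by nlinarith [dist_nonneg (x := m) (y := m')]
    rw [dist_eq_zero.1 h3]
    exact H p hp

/-- It is enough to look at four points at a time. -/
theorem isCAT0_of_forall_exists_isCNSet {X : Type*} [MetricSpace X]
    (h : ∀ x y m p : X, ∃ S : Set X, IsCNSet S ∧ x ∈ S ∧ y ∈ S ∧ m ∈ S ∧ p ∈ S) : IsCAT0 X := by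
  refine IsCNSet.isCAT0 ⟨fun x _ y _ t ht => ?_, fun x _ y _ m _ p _ t ht hb => ?_⟩
  · obtain ⟨S, hS, hx, hy, -⟩ := h x y x x
    obtain ⟨m, -, hm⟩ := hS.exists_between x hx y hy t ht
    exact ⟨m, trivial, hm⟩
  · obtain ⟨S, hS, hx, hy, hm, hp⟩ := h x y m p
    exact hS.cn x hx y hy m hm p hp t ht hb

theorem sqrt_sum_sq_le_add {ι : Type*} (s : Finset ι) {f g h : ι → ℝ} (hf : ∀ i ∈ s, 0 ≤ f i)
    (hfg : ∀ i ∈ s, f i ≤ g i + h i) :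
    √(∑ i ∈ s, f i ^ 2) ≤ √(∑ i ∈ s, g i ^ 2) + √(∑ i ∈ s, h i ^ 2) := by
  have e : ∀ k : ι → ℝ, ‖WithLp.toLp 2 (fun i : s => k i)‖ = √(∑ i ∈ s, k i ^ 2) := fun k => by
    rw [EuclideanSpace.norm_eq]
    simp [Finset.sum_attach s fun i => k i ^ 2]
  calc √(∑ i ∈ s, f i ^ 2) ≤ √(∑ i ∈ s, (g i + h i) ^ 2) := by
        gcongr with i hi
        · exact hf i hi
        · exact hfg i hi
    _ = ‖WithLp.toLp 2 (fun i : s => g i) + WithLp.toLp 2 (fun i : s => h i)‖ := by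
        rw [← e fun i => g i + h i]; rfl
    _ ≤ _ := by rw [← e g, ← e h]; exact norm_add_le _ _

/-- A system of clauses `x i = gate i j ∨ x j = gate j i` for points of a product. -/
structure ClauseSystem {ι : Type*} (M : ι → Type*) where
  N : ι → ι → Prop
  symm : ∀ {i j}, N i j → N j i
  irrefl : ∀ i, ¬ N i i
  gate : ∀ i, ι → M i
  -- If the gates of `j` differ, the `j`-th coordinate cannot be at both of them, so the two clauses
  -- imply `x i = gate i j ∨ x k = gate k j`. The system is required to contain this resolvent.
  resolve : ∀ {i j k}, N i j → N j k → gate j i ≠ gate j k →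
    N i k ∧ gate i k = gate i j ∧ gate k i = gate k j

namespace ClauseSystem

variable {ι : Type*} {M : ι → Type*} (P : ClauseSystem M)

/-- The point `x` satisfies all clauses. -/
def Consistent (x : ∀ i, M i) : Prop := ∀ i j, P.N i j → x i = P.gate i j ∨ x j = P.gate j i

/-- The points that satisfy all clauses and have almost all coordinates in common with `o`. -/
def Point (o : ∀ i, M i) : Type _ :=
  {x : ∀ i, M i // P.Consistent x ∧ {i | x i ≠ o i}.Finite}

variable {P} {o : ∀ i, M i}

instance : CoeFun (P.Point o) fun _ => ∀ i, M i := ⟨Subtype.val⟩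

namespace Point

theorem ext {x y : P.Point o} (h : ∀ i, x i = y i) : x = y := Subtype.ext (funext h)

theorem finite_diff (x y : P.Point o) : {i | x i ≠ y i}.Finite := by
  refine (x.2.2.union y.2.2).subset fun i hi => ?_
  by_contra h
  simp only [Set.mem_union, Set.mem_ofPred_eq, not_or, not_not] at h
  exact hi (h.1.trans h.2.symm)

/-- A consistent family that differs from a point in a finite set is a point. -/
def ofDiff (x : P.Point o) (y : ∀ i, M i) (hy : P.Consistent y) (h : {i | x i ≠ y i}.Finite) :
    P.Point o :=
  ⟨y, hy, (h.union x.2.2).subset fun i hi => by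
    by_contra h
    simp only [Set.mem_union, Set.mem_ofPred_eq, not_or, not_not] at h
    exact hi (h.1.symm.trans h.2)⟩

theorem ofDiff_apply (x : P.Point o) (y : ∀ i, M i) (hy : P.Consistent y)
    (h : {i | x i ≠ y i}.Finite) (i : ι) : x.ofDiff y hy h i = y i := rfl

/-- The set of coordinates in which the points differ contains no pair that is subject to a
clause. -/
def IsStep (x y : P.Point o) : Prop := ∀ i j, x i ≠ y i → x j ≠ y j → ¬ P.N i j

theorem IsStep.symm {x y : P.Point o} (h : IsStep x y) : IsStep y x :=
  fun i j hi hj => h i j hi.symm hj.symm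

open Classical in
/-- Two points that differ in the coordinates `i` and `j` of a clause can be joined by way of a
point that satisfies both parts of the clause. -/
theorem exists_crossing {i j : ι} (hij : P.N i j) (x y : P.Point o) (hx : x i = P.gate i j)
    (hy : y j = P.gate j i) : ∃ h : P.Point o, h i = P.gate i j ∧ h j = P.gate j i ∧
      ∀ l, h l = x l ∨ h l = y l := by
  -- The coordinates to be taken from `y` are `j` and those whose value is forced, by a clause with
  -- `j`, once the `j`-th coordinate is `gate j i`.
  let F : ι → Prop := fun l => l = j ∨ (P.N j l ∧ P.gate j l ≠ P.gate j i)
  let h : ∀ l, M l := fun l => if F l then y l else x l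
  have hF : ∀ l, P.N j l → P.gate j l ≠ P.gate j i → y l = P.gate l j := by
    intro l hl hne
    rcases y.2.1 j l hl with h1 | h1
    · exact absurd (h1.symm.trans hy) hne
    · exact h1
  have key : ∀ k l, F l → ¬ F k → P.N k l → h k = P.gate k l ∨ h l = P.gate l k := by
    intro k l hl hk hkl
    have ek : h k = x k := if_neg hk
    have el : h l = y l := if_pos hl
    rw [el]
    right
    rcases hl with rfl | ⟨h1, h2⟩
    · by_contra hne
      exact hk (Or.inr ⟨P.symm hkl, fun e => hne (hy.trans e.symm)⟩)
    · rw [hF l h1 h2]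
      by_contra hne
      -- If the gates of `l` towards `j` and `k` differ, resolution yields a clause between `j` and
      -- `k` that forces `k` as well.
      obtain ⟨r1, r2, -⟩ := P.resolve h1 (P.symm hkl) hne
      exact hk (Or.inr ⟨r1, r2 ▸ h2⟩)
  have hcons : P.Consistent h := by
    intro k l hkl
    by_cases hk : F k <;> by_cases hl : F l
    · have e1 : h k = y k := if_pos hk
      have e2 : h l = y l := if_pos hl
      rw [e1, e2]; exact y.2.1 k l hkl
    · exact (key l k hk hl (P.symm hkl)).symm
    · exact key k l hl hk hkl
    · have e1 : h k = x k := if_neg hk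
      have e2 : h l = x l := if_neg hl
      rw [e1, e2]; exact x.2.1 k l hkl
  have hor : ∀ l, h l = x l ∨ h l = y l := fun l => by
    by_cases hl : F l
    · exact Or.inr (if_pos hl)
    · exact Or.inl (if_neg hl)
  refine ⟨x.ofDiff h hcons ((x.finite_diff y).subset fun l hl => ?_), ?_, ?_, hor⟩
  · rcases hor l with e | e
    · exact absurd e.symm hl
    · simpa [e] using hl
  · have : ¬ F i := by
      rintro (rfl | ⟨-, h2⟩)
      · exact P.irrefl _ hij
      · exact h2 rfl
    rw [ofDiff_apply, ← hx]; exact if_neg this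
  · rw [ofDiff_apply, ← hy]; exact if_pos (Or.inl rfl)

/-- The points with prescribed coordinates outside of a finite set. -/
def slice (s : Finset ι) (z : P.Point o) : Set (P.Point o) := {x | ∀ i ∉ s, x i = z i}

theorem setOf_slice_eq [DecidableEq ι] (s : Finset ι) (z z' : P.Point o) (i : ι) (hi : i ∈ s)
    (hz' : z' ∈ slice s z) : {x ∈ slice s z | x i = z' i} = slice (s.erase i) z' := by
  ext x
  constructor
  · rintro ⟨h1, h2⟩ l hl
    by_cases e : l = i
    · subst e; exact h2
    · have : l ∉ s := fun h => hl (Finset.mem_erase.2 ⟨e, h⟩)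
      rw [h1 l this, hz' l this]
  · intro h
    refine ⟨fun l hl => ?_, h i (by simp)⟩
    rw [h l fun h' => hl (Finset.mem_of_mem_erase h'), hz' l hl]

/-! ### The length metric on the space of consistent points -/

variable [∀ i, MetricSpace (M i)]

/-- The `ℓ²` distance. -/
noncomputable def l2 (x y : P.Point o) : ℝ := √(∑ᶠ i, dist (x i) (y i) ^ 2)

theorem l2_eq {x y : P.Point o} (s : Finset ι) (h : ∀ i ∉ s, x i = y i) :
    l2 x y = √(∑ i ∈ s, dist (x i) (y i) ^ 2) := by
  rw [l2, finsum_eq_sum_of_support_subset]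
  intro i hi
  by_contra h'
  simp [h i h'] at hi

theorem le_l2 (x y : P.Point o) (s : Finset ι) :
    √(∑ i ∈ s, dist (x i) (y i) ^ 2) ≤ l2 x y := by
  classical
  rw [l2_eq (s ∪ (x.finite_diff y).toFinset) fun i hi => by
    by_contra h; exact hi (by simp [h])]
  gcongr
  exact Finset.subset_union_left

theorem l2_comm (x y : P.Point o) : l2 x y = l2 y x := by simp only [l2, dist_comm]

theorem l2_nonneg (x y : P.Point o) : 0 ≤ l2 x y := Real.sqrt_nonneg _

/-- A chain of steps of total length `c`. -/
inductive Chain : P.Point o → P.Point o → ℝ → Prop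
  | refl (x) : Chain x x 0
  | step {x y z c} (h : IsStep x y) (hc : Chain y z c) : Chain x z (l2 x y + c)

theorem Chain.nonneg {x y : P.Point o} {c : ℝ} (h : Chain x y c) : 0 ≤ c := by
  induction h with
  | refl => exact le_rfl
  | step _ _ ih => exact add_nonneg (l2_nonneg _ _) ih

theorem Chain.single {x y : P.Point o} (h : IsStep x y) : Chain x y (l2 x y) := by
  have := Chain.step h (Chain.refl y)
  rwa [add_zero] at this

theorem Chain.trans {x y z : P.Point o} {c d : ℝ} (h : Chain x y c) (h' : Chain y z d) :
    Chain x z (c + d) := by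
  induction h with
  | refl => rwa [zero_add]
  | step s _ ih => rw [add_assoc]; exact .step s (ih h')

theorem Chain.symm {x y : P.Point o} {c : ℝ} (h : Chain x y c) : Chain y x c := by
  induction h with
  | refl => exact .refl _
  | step s _ ih =>
    rw [add_comm, l2_comm]
    exact ih.trans (.single s.symm)

theorem Chain.le {x y : P.Point o} {c : ℝ} (h : Chain x y c) (s : Finset ι) :
    √(∑ i ∈ s, dist (x i) (y i) ^ 2) ≤ c := by
  induction h with
  | refl => simp
  | @step _ y _ _ _ _ ih =>
    refine (sqrt_sum_sq_le_add s (fun _ _ => dist_nonneg)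
      fun i _ => dist_triangle _ (y i) _).trans ?_
    exact add_le_add (le_l2 _ _ s) ih

/-- If `x` and `y` do not form a step, some clause is satisfied by them in different ways. Then
`exists_crossing` gives a point that differs from each of them in fewer coordinates, and induction
applies. -/
theorem exists_chain (x y : P.Point o) : ∃ c, Chain x y c := by
  induction hn : (x.finite_diff y).toFinset.card using Nat.strong_induction_on generalizing x y with
  | _ n ih =>
  by_cases hs : IsStep x y
  · exact ⟨_, .single hs⟩
  have key : ∀ x' y' : P.Point o, (x'.finite_diff y').toFinset ⊂ (x.finite_diff y).toFinset →
      ∃ c, Chain x' y' c := fun x' y' h => ih _ (hn ▸ Finset.card_lt_card h) x' y' rfl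
  have main : ∀ i j, P.N i j → x i ≠ y i → x j ≠ y j → x i = P.gate i j → y j = P.gate j i →
      ∃ c, Chain x y c := by
    intro i j hij hi hj ei ej
    obtain ⟨h, h1, h2, h3⟩ := exists_crossing hij x y ei ej
    obtain ⟨c, hc⟩ := key x h (by
      rw [Finset.ssubset_iff_of_subset]
      · refine ⟨i, by simpa using hi, by simp [h1, ei]⟩
      · intro l
        rcases h3 l with e | e <;> simp [e])
    obtain ⟨d, hd⟩ := key h y (by
      rw [Finset.ssubset_iff_of_subset]
      · refine ⟨j, by simpa using hj, by simp [h2, ej]⟩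
      · intro l
        rcases h3 l with e | e <;> simp [e])
    exact ⟨_, hc.trans hd⟩
  simp only [IsStep, not_forall, not_not] at hs
  obtain ⟨i, j, hi, hj, hij⟩ := hs
  rcases x.2.1 i j hij with ei | ej
  · rcases y.2.1 i j hij with ei' | ej'
    · exact absurd (ei.trans ei'.symm) hi
    · exact main i j hij hi hj ei ej'
  · rcases y.2.1 i j hij with ei' | ej'
    · exact main j i (P.symm hij) hj hi ej ei'
    · exact absurd (ej.trans ej'.symm) hj

/-- The length metric. -/
noncomputable def chainDist (x y : P.Point o) : ℝ := sInf {c | Chain x y c}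

theorem chainDist_le {x y : P.Point o} {c : ℝ} (h : Chain x y c) : chainDist x y ≤ c :=
  csInf_le ⟨0, fun _ h => h.nonneg⟩ h

/-- Existence of a chain rules out the default value of `sInf` on the empty set. -/
theorem le_chainDist {x y : P.Point o} {b : ℝ} (h : ∀ c, Chain x y c → b ≤ c) :
    b ≤ chainDist x y := le_csInf (exists_chain x y) h

theorem chainDist_comm_le (x y : P.Point o) : chainDist x y ≤ chainDist y x :=
  le_chainDist fun _ h => chainDist_le h.symm

noncomputable instance : MetricSpace (P.Point o) where
  dist := chainDist
  dist_self x := le_antisymm (chainDist_le (.refl x)) (le_chainDist fun _ h => h.nonneg)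
  dist_comm x y := le_antisymm (chainDist_comm_le x y) (chainDist_comm_le y x)
  dist_triangle x y z := by
    have : chainDist x z - chainDist x y ≤ chainDist y z := le_chainDist fun d hd => by
      have : chainDist x z - d ≤ chainDist x y := le_chainDist fun c hc => by
        linarith [chainDist_le (hc.trans hd)]
      linarith
    linarith
  eq_of_dist_eq_zero {x y} h := by
    refine ext fun i => ?_
    have : √(∑ k ∈ {i}, dist (x k) (y k) ^ 2) ≤ 0 := (le_chainDist fun c hc => hc.le {i}).trans h.le
    rw [Finset.sum_singleton, Real.sqrt_sq dist_nonneg] at this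
    exact dist_le_zero.1 this

theorem dist_le_of_chain {x y : P.Point o} {c : ℝ} (h : Chain x y c) : dist x y ≤ c :=
  chainDist_le h

theorem le_dist {x y : P.Point o} {b : ℝ} (h : ∀ c, Chain x y c → b ≤ c) : b ≤ dist x y :=
  le_chainDist h

theorem exists_chain_lt {x y : P.Point o} {b : ℝ} (h : dist x y < b) : ∃ c < b, Chain x y c := by
  obtain ⟨c, hc, hlt⟩ := exists_lt_of_csInf_lt (exists_chain x y) h
  exact ⟨c, hlt, hc⟩

theorem IsStep.dist_eq {x y : P.Point o} (h : IsStep x y) : dist x y = l2 x y := by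
  refine le_antisymm (dist_le_of_chain (.single h)) (le_dist fun c hc => ?_)
  rw [l2_eq (x.finite_diff y).toFinset fun i hi => by
    by_contra h; exact hi (by simp [h])]
  exact hc.le _

/-- Any two points of the slice form a step, so the metric is that of a finite `ℓ²` product, where
geodesics and the inequality are obtained coordinatewise. A clause between a free and a fixed
coordinate survives on geodesics: either the fixed coordinate is at its gate, or the free one is at
its gate at both ends. -/
theorem isCNSet_slice_of_forall_not (hM : ∀ i, IsCAT0 (M i)) (s : Finset ι) (z : P.Point o)
    (hs : ∀ i ∈ s, ∀ j ∈ s, ¬ P.N i j) : IsCNSet (slice s z) := by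
  classical
  have hstep : ∀ x ∈ slice s z, ∀ y ∈ slice s z, dist x y ^ 2 =
      ∑ i ∈ s, dist (x i) (y i) ^ 2 := by
    intro x hx y hy
    have e : ∀ i ∉ s, x i = y i := fun i hi => (hx i hi).trans (hy i hi).symm
    rw [IsStep.dist_eq, l2_eq s e, Real.sq_sqrt (Finset.sum_nonneg fun _ _ => sq_nonneg _)]
    intro i j hi hj
    refine hs i ?_ j ?_ <;> by_contra h
    · exact hi (e i h)
    · exact hj (e j h)
  refine IsCNSet.of_exists fun x hx y hy t ht => ?_
  choose m _ hm using fun i => (hM i).isCNSet.exists_between (x i) trivial (y i) trivial t ht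
  have me : ∀ i, x i = y i → m i = x i := by
    intro i h
    have := (hm i).1
    rw [h, dist_self, mul_zero] at this
    rw [← dist_eq_zero.1 this, h]
  have mz : ∀ i ∉ s, m i = z i := fun i hi => by
    rw [me i ((hx i hi).trans (hy i hi).symm), hx i hi]
  have key : ∀ i ∈ s, ∀ j, P.N i j → m i = P.gate i j ∨ m j = P.gate j i := by
    intro i hi j hij
    have hj : j ∉ s := fun hj => hs i hi j hj hij
    rw [mz j hj]
    rcases x.2.1 i j hij with e | e
    · rcases y.2.1 i j hij with e' | e'
      · left; rw [me i (e.trans e'.symm), e]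
      · right; rw [← hy j hj, e']
    · right; rw [← hx j hj, e]
  have hcons : P.Consistent m := by
    intro i j hij
    by_cases hi : i ∈ s
    · exact key i hi j hij
    by_cases hj : j ∈ s
    · exact (key j hj i (P.symm hij)).symm
    rw [mz i hi, mz j hj]
    exact z.2.1 i j hij
  let m' : P.Point o := z.ofDiff m hcons (s.finite_toSet.subset fun i hi => by
    by_contra h; exact hi (mz i h).symm)
  have hm' : m' ∈ slice s z := mz
  have sq_eq : ∀ {a b c : ℝ}, 0 ≤ a → 0 ≤ b → 0 ≤ c → a ^ 2 = b ^ 2 * c ^ 2 → a = b * c := by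
    intro a b c ha hb hc h
    rw [← mul_pow] at h
    exact (pow_left_inj₀ ha (mul_nonneg hb hc) two_ne_zero).1 h
  refine ⟨m', hm', ⟨?_, ?_⟩, fun p hp => ?_⟩
  · apply sq_eq dist_nonneg ht.1 dist_nonneg
    rw [hstep x hx m' hm', hstep x hx y hy, Finset.mul_sum]
    refine Finset.sum_congr rfl fun i _ => ?_
    rw [← mul_pow, ← (hm i).1]; rfl
  · apply sq_eq dist_nonneg (by linarith [ht.2]) dist_nonneg
    rw [hstep m' hm' y hy, hstep x hx y hy, Finset.mul_sum]
    refine Finset.sum_congr rfl fun i _ => ?_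
    rw [← mul_pow, ← (hm i).2]; rfl
  · rw [hstep p hp m' hm', hstep p hp x hx, hstep p hp y hy, hstep x hx y hy, Finset.mul_sum,
      Finset.mul_sum, Finset.mul_sum, ← Finset.sum_add_distrib, ← Finset.sum_sub_distrib]
    exact Finset.sum_le_sum fun i _ => (hM i).isCNSet.cn (x i) trivial (y i) trivial (m i) trivial
      (p i) trivial t ht (hm i)

/-! ### Chains that cross a clause, and coordinatewise contractions -/

theorem Chain.exists_crossing {i j : ι} (hij : P.N i j) {x y : P.Point o} {c : ℝ}
    (h : Chain x y c) (hx : x i = P.gate i j) (hy : y j = P.gate j i) :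
    ∃ (m : P.Point o) (c₁ c₂ : ℝ), Chain x m c₁ ∧ Chain m y c₂ ∧ c₁ + c₂ = c ∧
      m i = P.gate i j ∧ m j = P.gate j i := by
  induction h with
  | refl x => exact ⟨x, 0, 0, .refl x, .refl x, by simp, hx, hy⟩
  | @step x y z c s hc ih =>
    by_cases e : y i = P.gate i j
    · obtain ⟨m, c₁, c₂, h1, h2, rfl, h4, h5⟩ := ih e hy
      exact ⟨m, _, c₂, .step s h1, h2, by ring, h4, h5⟩
    · have e' := (y.2.1 i j hij).resolve_left e
      -- A step changes at most one of the two coordinates of a clause. When the `i`-th coordinate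
      -- leaves its gate, the `j`-th one is therefore already at its own.
      refine ⟨x, 0, _, .refl x, .step s hc, by simp, hx, ?_⟩
      rw [← e']
      by_contra hne
      exact s i j (fun h => e (h.symm.trans hx)) hne hij

theorem Chain.map (φ : P.Point o → P.Point o)
    (hφ : ∀ x y i, dist (φ x i) (φ y i) ≤ dist (x i) (y i)) {x y : P.Point o} {c : ℝ} (h : Chain x y c) : ∃ d ≤ c, Chain (φ x) (φ y) d := by
  induction h with
  | refl x => exact ⟨0, le_rfl, .refl _⟩
  | @step x y z c s hc ih =>
    obtain ⟨d, hd, h⟩ := ih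
    have hne : ∀ i, φ x i ≠ φ y i → x i ≠ y i := fun i hi e => hi (by
      have := hφ x y i
      rw [e, dist_self] at this
      exact dist_le_zero.1 this)
    refine ⟨_, ?_, .step (fun i j hi hj => s i j (hne i hi) (hne j hj)) h⟩
    refine add_le_add ?_ hd
    have hs : ∀ i ∉ (x.finite_diff y).toFinset, x i = y i := fun i hi => by
      by_contra h; exact hi (by simp [h])
    have hs' : ∀ i ∉ (x.finite_diff y).toFinset, φ x i = φ y i := fun i hi => by
      by_contra h; exact hne i h (hs i hi)
    rw [l2_eq _ hs, l2_eq _ hs']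
    gcongr
    exact hφ x y _

theorem dist_map_le (φ : P.Point o → P.Point o)
    (hφ : ∀ x y i, dist (φ x i) (φ y i) ≤ dist (x i) (y i)) (x y : P.Point o) :
    dist (φ x) (φ y) ≤ dist x y := le_dist fun _ h => by
  obtain ⟨d, hd, h'⟩ := h.map φ hφ
  exact (dist_le_of_chain h').trans hd

end Point

end ClauseSystem

/-! ### Subspaces defined by clauses are CAT(0) -/

namespace ClauseSystem.Point

variable {ι : Type*} {M : ι → Type*} {P : ClauseSystem M} {o : ∀ i, M i}
  [∀ i, MetricSpace (M i)]

/-- Each coordinate `z` is sent to the point of the geodesic from `x i` to `y i` at distance `min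
(dist (x i) z) (dist (x i) (y i))` from `x i`; this does not increase distances. Clauses survive: if
the gate of `i` is neither `x i` nor `y i`, then `x j` and `y j` are both at the gate of `j`, and
the `j`-th segment is a point. -/
theorem exists_retraction (hM : ∀ i, IsCAT0 (M i)) (x y : P.Point o) :
    ∃ (C : ∀ i, Set (M i)) (φ : P.Point o → P.Point o), (∀ i, IsCompact (C i)) ∧
      (∀ i, x i = y i → C i = {x i}) ∧ (∀ h i, φ h i ∈ C i) ∧
      (∀ h h', dist (φ h) (φ h') ≤ dist h h') ∧ (∀ h i, h i = x i → φ h i = x i) ∧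
      (∀ h i, h i = y i → φ h i = y i) := by
  choose γ hγ using fun i => (hM i).exists_geodesic (x i) (y i)
  have hd : ∀ i (z : M i), min (dist (x i) z) (dist (x i) (y i)) ∈ Set.Icc 0 (dist (x i) (y i)) :=
    fun i z => ⟨le_min dist_nonneg dist_nonneg, min_le_right _ _⟩
  let p : ∀ i, M i → M i := fun i z => γ i (min (dist (x i) z) (dist (x i) (y i)))
  have px : ∀ i, p i (x i) = x i := fun i => by simp [p, (hγ i).source]
  have py : ∀ i, p i (y i) = y i := fun i => by simp [p, (hγ i).target]
  have plip : ∀ i (z w : M i), dist (p i z) (p i w) ≤ dist z w := fun i z w => by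
    rw [(hγ i).isometry _ (hd i z) _ (hd i w)]
    refine (abs_min_sub_min_le_max _ _ _ _).trans ?_
    simp only [sub_self, abs_zero]
    refine max_le ?_ dist_nonneg
    rw [dist_comm (x i) z, dist_comm (x i) w]
    exact abs_dist_sub_le z w (x i)
  have pconst : ∀ i, x i = y i → ∀ z, p i z = x i := fun i h z => by
    have : min (dist (x i) z) (dist (x i) (y i)) = 0 := by
      rw [h, dist_self]; exact min_eq_right dist_nonneg
    simp only [p, this, (hγ i).source]
  have key : ∀ (h : P.Point o) i j, P.N i j → h i = P.gate i j →
      p i (h i) = P.gate i j ∨ p j (h j) = P.gate j i := by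
    intro h i j hij hi
    by_cases e : x i = P.gate i j
    · left; rw [hi, ← e, px]
    by_cases e' : y i = P.gate i j
    · left; rw [hi, ← e', py]
    right
    have ej := (x.2.1 i j hij).resolve_left e
    have ej' := (y.2.1 i j hij).resolve_left e'
    rw [pconst j (ej.trans ej'.symm), ej]
  have hcons : ∀ h : P.Point o, P.Consistent fun i => p i (h i) := by
    intro h i j hij
    rcases h.2.1 i j hij with e | e
    · exact key h i j hij e
    · exact (key h j i (P.symm hij) e).symm
  let φ : P.Point o → P.Point o := fun h => x.ofDiff _ (hcons h)
    ((x.finite_diff y).subset fun i hi e => hi (pconst i e _).symm)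
  refine ⟨fun i => γ i '' Set.Icc 0 (dist (x i) (y i)), φ, fun i => ?_, fun i h => ?_,
    fun h i => ⟨_, hd i (h i), rfl⟩, fun h h' => ?_, fun h i e => ?_, fun h i e => ?_⟩
  · refine isCompact_Icc.image_of_continuousOn ?_
    have : LipschitzOnWith 1 (γ i) (Set.Icc 0 (dist (x i) (y i))) :=
      LipschitzOnWith.of_dist_le_mul fun s hs t ht => by
        rw [(hγ i).isometry s hs t ht]; simp [Real.dist_eq]
    exact this.continuousOn
  · have := (hγ i).source
    simp_all
  · exact dist_map_le φ (fun a b i => plip i _ _) h h'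
  · exact (congrArg (p i) e).trans (px i)
  · exact (congrArg (p i) e).trans (py i)

/-- The infimum of the lengths of paths that cross the set of a clause is attained. -/
theorem exists_dist_add_dist_eq (hM : ∀ i, IsCAT0 (M i)) {i j : ι} (hij : P.N i j)
    (x y : P.Point o) (hx : x i = P.gate i j) (hy : y j = P.gate j i) :
    ∃ h : P.Point o, h i = P.gate i j ∧ h j = P.gate j i ∧ (∀ l, x l = y l → h l = x l) ∧
      dist x h + dist h y = dist x y := by
  obtain ⟨C, φ, hC, hC', hφ, hlip, hφx, hφy⟩ := exists_retraction hM x y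
  -- Candidates for the crossing point inside the product of segments; this set is compact in the
  -- product topology.
  let T : Set (∀ l, M l) := {u | (∀ l, u l ∈ C l) ∧ P.Consistent u ∧ u i = P.gate i j ∧
    u j = P.gate j i}
  have hTc : IsCompact T := by
    have h1 : IsCompact {u : ∀ l, M l | ∀ l, u l ∈ C l} := by
      have := isCompact_univ_pi hC
      simpa [Set.pi] using this
    have h2 : IsClosed {u : ∀ l, M l | P.Consistent u ∧ u i = P.gate i j ∧ u j = P.gate j i} := by
      have e : ∀ k l : ι, IsClosed {u : ∀ l, M l | u k = P.gate k l} := fun k l =>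
        isClosed_eq (continuous_apply k) continuous_const
      have hcl : {u : ∀ l, M l | P.Consistent u} = ⋂ k, ⋂ l, ⋂ (_ : P.N k l),
          ({u | u k = P.gate k l} ∪ {u | u l = P.gate l k}) := by
        ext u; simp [Consistent]
      have hcl' : IsClosed {u : ∀ l, M l | P.Consistent u} := by
        rw [hcl]
        exact isClosed_iInter fun k => isClosed_iInter fun l => isClosed_iInter fun _ =>
          (e k l).union (e l k)
      exact hcl'.inter ((e i j).inter (e j i))
    exact h1.inter_right h2
  have hTd : ∀ u ∈ T, ∀ l, x l = y l → u l = x l := fun u hu l e => by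
    have := hu.1 l
    rwa [hC' l e] at this
  let Φ : T → P.Point o := fun u => x.ofDiff u.1 u.2.2.1
    ((x.finite_diff y).subset fun l hl e => hl (hTd u.1 u.2 l e).symm)
  -- The product topology must be compared with the length metric. Only finitely many coordinates
  -- vary, and those off a gate stay off it nearby; so a nearby point is reached from `u` by a
  -- single step, whose length is the `ℓ²` distance.
  have hΦ : Continuous Φ := by
    rw [continuous_iff_continuousAt]
    intro u
    rw [ContinuousAt, tendsto_iff_dist_tendsto_zero]
    set s := (x.finite_diff y).toFinset with hs
    have hsd : ∀ v w : T, ∀ l ∉ s, Φ v l = Φ w l := fun v w l hl => by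
      have e : x l = y l := by by_contra h; exact hl (by simpa [hs] using h)
      exact (hTd v.1 v.2 l e).trans (hTd w.1 w.2 l e).symm
    have hlim : Filter.Tendsto (fun v : T => √(∑ l ∈ s, dist (v.1 l) (u.1 l) ^ 2)) (nhds u)
        (nhds 0) := by
      have hc : Continuous fun v : T => √(∑ l ∈ s, dist (v.1 l) (u.1 l) ^ 2) := by
        refine Real.continuous_sqrt.comp (continuous_finsetSum _ fun l _ => ?_)
        exact (((continuous_apply l).comp continuous_subtype_val).dist continuous_const).pow 2
      have := hc.tendsto u
      simpa using this
    refine squeeze_zero' (Filter.Eventually.of_forall fun _ => dist_nonneg) ?_ hlim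
    have hnear : ∀ᶠ v : T in nhds u, ∀ k ∈ s, ∀ l ∈ s, u.1 k ≠ P.gate k l →
        v.1 k ≠ P.gate k l := by
      rw [Filter.eventually_all_finset]
      intro k _
      rw [Filter.eventually_all_finset]
      intro l _
      by_cases e : u.1 k = P.gate k l
      · exact Filter.Eventually.of_forall fun _ h => absurd e h
      · have hc : ContinuousAt (fun v : T => v.1 k) u :=
          ((continuous_apply k).comp continuous_subtype_val).continuousAt
        filter_upwards [hc.eventually_ne e] with v hv _ using hv
    filter_upwards [hnear] with v hv
    have hst : IsStep (Φ u) (Φ v) := by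
      have mem : ∀ l, Φ u l ≠ Φ v l → l ∈ s := fun l hl => by
        by_contra h; exact hl (hsd u v l h)
      intro k l hk hl hkl
      have ks := mem k hk
      have ls := mem l hl
      have key : ∀ k ∈ s, ∀ l ∈ s, P.N k l → Φ u k ≠ Φ v k → Φ u l ≠ Φ v l →
          Φ u k = P.gate k l → False := by
        intro k ks l ls hkl hk hl e
        have e' := ((Φ v).2.1 k l hkl).resolve_left fun e' => hk (e.trans e'.symm)
        exact hv l ls k ks (fun e'' => hl (e''.trans e'.symm)) e'
      rcases (Φ u).2.1 k l hkl with e | e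
      · exact key k ks l ls hkl hk hl e
      · exact key l ls k ks (P.symm hkl) hl hk e
    rw [hst.symm.dist_eq, l2_eq s (hsd v u)]
    exact le_rfl
  have : CompactSpace T := isCompact_iff_compactSpace.1 hTc
  obtain ⟨h₀, h₁, h₂, h₃⟩ := exists_crossing hij x y hx hy
  have hφT : ∀ h : P.Point o, h i = P.gate i j → h j = P.gate j i → (φ h).1 ∈ T := by
    intro h e1 e2
    refine ⟨hφ h, (φ h).2.1, ?_, ?_⟩
    · rw [hφx h i (e1.trans hx.symm), hx]
    · rw [hφy h j (e2.trans hy.symm), hy]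
  have hne : (Set.univ : Set T).Nonempty := ⟨⟨_, hφT h₀ h₁ h₂⟩, trivial⟩
  obtain ⟨u, -, hu⟩ := isCompact_univ.exists_isMinOn hne
    ((continuous_const.dist hΦ).add (hΦ.dist continuous_const)).continuousOn
    (f := fun u => dist x (Φ u) + dist (Φ u) y)
  refine ⟨Φ u, u.2.2.2.1, u.2.2.2.2, hTd u.1 u.2, le_antisymm ?_ (dist_triangle _ _ _)⟩
  refine le_of_forall_gt fun b hb => ?_
  obtain ⟨c, hcb, hc⟩ := exists_chain_lt hb
  -- Any almost shortest chain passes through a crossing point `m`. The retraction fixes `x` and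
  -- `y`, moves `m` into the compact set and does not increase distances, so the minimizer is at
  -- least as good.
  obtain ⟨m, c₁, c₂, k1, k2, rfl, k4, k5⟩ := hc.exists_crossing hij hx hy
  have hmin := hu (Set.mem_univ ⟨_, hφT m k4 k5⟩)
  have hΦφ : Φ ⟨_, hφT m k4 k5⟩ = φ m := rfl
  simp only [Set.mem_ofPred_eq, hΦφ] at hmin
  have ex : φ x = x := ext fun l => hφx x l rfl
  have ey : φ y = y := ext fun l => hφy y l rfl
  have l1 := hlip x m
  have l2 := hlip m y
  rw [ex] at l1
  rw [ey] at l2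
  have := dist_le_of_chain k1
  have := dist_le_of_chain k2
  linarith

/-- A clause between two free coordinates covers the slice by the two sets in which one of them is
at its gate. These and their intersection are empty or smaller slices, and `exists_dist_add_dist_eq`
provides the crossing points for gluing. -/
theorem isCNSet_slice (hM : ∀ i, IsCAT0 (M i)) (s : Finset ι) (z : P.Point o) :
    IsCNSet (slice s z) := by
  classical
  induction s using Finset.strongInduction generalizing z with
  | _ s ih =>
  by_cases hs : ∀ i ∈ s, ∀ j ∈ s, ¬ P.N i j
  · exact isCNSet_slice_of_forall_not hM s z hs
  push Not at hs
  obtain ⟨i, hi, j, hj, hij⟩ := hs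
  have hempty : IsCNSet (∅ : Set (P.Point o)) := ⟨by simp, by simp⟩
  have hslice : ∀ s' ⊆ s, ∀ z : P.Point o, ∀ k ∈ s',
      ∀ a : M k, IsCNSet {x ∈ slice s' z | x k = a} := by
    intro s' hs' z k hk a
    rcases Set.eq_empty_or_nonempty {x ∈ slice s' z | x k = a} with e | ⟨z', h1, h2⟩
    · rw [e]; exact hempty
    · subst h2
      rw [setOf_slice_eq s' z z' k hk h1]
      exact ih _ ((Finset.erase_ssubset hk).trans_subset hs') z'
  have hji : j ≠ i := fun e => P.irrefl i (by rwa [e] at hij)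
  have e : slice s z = {x ∈ slice s z | x i = P.gate i j} ∪ {x ∈ slice s z | x j = P.gate j i} := by
    ext x
    refine ⟨fun hx => ?_, ?_⟩
    · exact (x.2.1 i j hij).imp (fun h => ⟨hx, h⟩) fun h => ⟨hx, h⟩
    · rintro (h | h) <;> exact h.1
  rw [e]
  refine IsGluing.isCNSet_union ⟨?_, ?_, ?_, ?_⟩
  · exact hslice s le_rfl z i hi _
  · exact hslice s le_rfl z j hj _
  · rcases Set.eq_empty_or_nonempty {x ∈ slice s z | x i = P.gate i j} with e | ⟨z', h1, h2⟩
    · rw [e, Set.empty_inter]; exact hempty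
    · have : {x ∈ slice s z | x i = P.gate i j} ∩ {x ∈ slice s z | x j = P.gate j i} =
          {x ∈ slice (s.erase i) z' | x j = P.gate j i} := by
        rw [← setOf_slice_eq s z z' i hi h1, h2]
        ext x
        constructor
        · rintro ⟨h1, h2⟩; exact ⟨h1, h2.2⟩
        · rintro ⟨h1, h2⟩; exact ⟨h1, h1.1, h2⟩
      rw [this]
      exact hslice _ (Finset.erase_subset i s) z' j
        (Finset.mem_erase.2 ⟨hji, hj⟩) _
  · rintro x ⟨hx, hx'⟩ y ⟨hy, hy'⟩
    obtain ⟨h, h1, h2, h3, h4⟩ := exists_dist_add_dist_eq hM hij x y hx' hy'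
    have : h ∈ slice s z := fun l hl => by
      rw [h3 l ((hx l hl).trans (hy l hl).symm), hx l hl]
    exact ⟨h, ⟨⟨this, h1⟩, this, h2⟩, h4⟩

theorem isCAT0 (hM : ∀ i, IsCAT0 (M i)) : IsCAT0 (P.Point o) := by
  classical
  have mem : ∀ (x y : P.Point o) (s : Finset ι), (x.finite_diff y).toFinset ⊆ s →
      y ∈ slice s x := fun x y s h i hi => by
    by_contra hne
    exact hi (h (by simpa [eq_comm] using hne))
  refine isCAT0_of_forall_exists_isCNSet fun x y m p => ?_
  exact ⟨_, isCNSet_slice hM ((x.finite_diff y).toFinset ∪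
    ((x.finite_diff m).toFinset ∪ (x.finite_diff p).toFinset)) x, fun _ _ => rfl,
    mem x y _ Finset.subset_union_left,
    mem x m _ (Finset.subset_union_left.trans Finset.subset_union_right),
    mem x p _ (Finset.subset_union_right.trans Finset.subset_union_right)⟩

end ClauseSystem.Point

/-! ### Mapping cylinders are CAT(0) -/

theorem quotientEDist_le_dist {X : Type*} {d : X → X → ℝ≥0∞} {s : Setoid X} (x y : X) :
    quotientEDist d s (Quotient.mk s x) (Quotient.mk s y) ≤ d x y := by
  refine (quotientEDist_le 0 (fun _ => x) (fun _ => y) rfl rfl (by simp)).trans ?_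
  simp

/-- A map to a metric space that respects the equivalence relation and does not increase distances
does not increase the quotient distance. -/
theorem edist_le_quotientEDist {X Y : Type*} [PseudoEMetricSpace Y] {d : X → X → ℝ≥0∞}
    {s : Setoid X} (e : X → Y) (h1 : ∀ x y, edist (e x) (e y) ≤ d x y)
    (h2 : ∀ x y, s x y → edist (e x) (e y) = 0) (x y : X) :
    edist (e x) (e y) ≤ quotientEDist d s (Quotient.mk s x) (Quotient.mk s y) := by
  refine le_iInf fun n => le_iInf fun u => le_iInf fun v => le_iInf fun h0 => le_iInf fun hn =>
    le_iInf fun h => ?_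
  have key : ∀ m ≤ n, edist (e (u 0)) (e (v m)) ≤
      ∑ k ∈ Finset.range (m + 1), d (u k) (v k) := by
    intro m hm
    induction m with
    | zero => simpa using h1 _ _
    | succ m ih =>
      rw [Finset.sum_range_succ]
      calc edist (e (u 0)) (e (v (m + 1)))
          ≤ edist (e (u 0)) (e (v m)) + edist (e (v m)) (e (u (m + 1))) +
            edist (e (u (m + 1))) (e (v (m + 1))) := edist_triangle4 _ _ _ _
        _ ≤ _ := by
          rw [h2 _ _ (h m (by omega)), add_zero]
          exact add_le_add (ih (by omega)) (h1 _ _)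
  refine le_trans ?_ (key n le_rfl)
  calc edist (e x) (e y)
      ≤ edist (e x) (e (u 0)) + edist (e (u 0)) (e (v n)) + edist (e (v n)) (e y) :=
        edist_triangle4 _ _ _ _
    _ = _ := by
      rw [h2 _ _ (s.symm (Quotient.exact h0)), h2 _ _ (Quotient.exact hn), zero_add, add_zero]

namespace PreCylinder

variable {R Z : Type*} [MetricSpace Z] (f : R → Z)

open Classical in
/-- The distance of points of the mapping cylinder. -/
noncomputable def cylDist : PreCylinder R Z → PreCylinder R Z → ℝ
  | base z, base z' => dist z z'
  | base z, edge c t => dist z (f c) + (1 - t)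
  | edge c t, base z => dist (f c) z + (1 - t)
  | edge c t, edge c' t' =>
    if c = c' then |(t : ℝ) - t'| else dist (f c) (f c') + (1 - t) + (1 - t')

theorem cylDist_self (x : PreCylinder R Z) : cylDist f x x = 0 := by
  cases x <;> simp [cylDist]

theorem cylDist_comm (x y : PreCylinder R Z) : cylDist f x y = cylDist f y x := by
  rcases x with z | ⟨c, t⟩ <;> rcases y with z' | ⟨c', t'⟩ <;> simp only [cylDist, dist_comm]
  by_cases h : c = c'
  · simp [h, abs_sub_comm]
  · simp [h, Ne.symm h]; ring

theorem cylDist_triangle (x y z : PreCylinder R Z) :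
    cylDist f x z ≤ cylDist f x y + cylDist f y z := by
  rcases x with x | ⟨c, t⟩ <;> rcases y with y | ⟨c', t'⟩ <;> rcases z with z | ⟨c'', t''⟩ <;>
    simp only [cylDist]
  · exact dist_triangle _ _ _
  · linarith [dist_triangle x y (f c'')]
  · linarith [dist_triangle x (f c') z, t'.2.2]
  · split_ifs with h
    · subst h
      linarith [le_abs_self ((t' : ℝ) - t'')]
    · linarith [dist_triangle x (f c') (f c''), t'.2.2]
  · linarith [dist_triangle (f c) y z]
  · split_ifs with h
    · subst h
      rcases abs_cases ((t : ℝ) - t'') with ⟨e, _⟩ | ⟨e, _⟩ <;> rw [e] <;>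
        linarith [t.2.2, t''.2.2, dist_nonneg (x := f c) (y := y), dist_nonneg (x := y) (y := f c)]
    · linarith [dist_triangle (f c) y (f c'')]
  · split_ifs with h
    · subst h
      linarith [neg_abs_le ((t : ℝ) - t')]
    · linarith [dist_triangle (f c) (f c') z, t'.2.2]
  · by_cases h : c = c'
    · subst h
      by_cases h' : c = c''
      · subst h'
        simp only [if_true]
        exact abs_sub_le _ _ _
      · simp only [h', if_false, if_true]
        linarith [neg_abs_le ((t : ℝ) - t')]
    · by_cases h' : c' = c''
      · subst h'
        simp only [h, if_false, if_true]
        linarith [le_abs_self ((t' : ℝ) - t'')]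
      · simp only [h, h', if_false]
        split_ifs with h''
        · subst h''
          rcases abs_cases ((t : ℝ) - t'') with ⟨e, _⟩ | ⟨e, _⟩ <;> rw [e] <;>
            linarith [t.2.2, t'.2.2, t''.2.2, dist_nonneg (x := f c) (y := f c'),
              dist_nonneg (x := f c') (y := f c)]
        · linarith [dist_triangle (f c) (f c') (f c''), t'.2.2]

/-- The pseudo-metric of the mapping cylinder on the disjoint union of its pieces. -/
noncomputable abbrev cylPseudoMetricSpace : PseudoMetricSpace (PreCylinder R Z) where
  dist := cylDist f
  dist_self := cylDist_self f
  dist_comm := cylDist_comm f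
  dist_triangle := cylDist_triangle f

theorem ofReal_cylDist_le_preDist (x y : PreCylinder R Z) :
    ENNReal.ofReal (cylDist f x y) ≤ preDist x y := by
  rcases x with z | ⟨c, t⟩ <;> rcases y with z' | ⟨c', t'⟩ <;> simp only [cylDist, preDist]
  · rw [edist_dist]
  · exact le_top
  · exact le_top
  · split_ifs with h
    · rw [edist_dist, Subtype.dist_eq, Real.dist_eq]
    · exact le_top

end PreCylinder

namespace MappingCylinder

open PreCylinder

variable {R Z : Type*} {f : R → Z}

/-- The class of a point in the mapping cylinder. -/
def mk (f : R → Z) (x : PreCylinder R Z) : MappingCylinder f := Quotient.mk _ x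

theorem mk_edge_one (c : R) : mk f (edge c 1) = mk f (base (f c)) :=
  Quotient.sound (Relation.EqvGen.rel _ _ (.mk c))

variable [MetricSpace Z]

theorem edist_mk_le (x y : PreCylinder R Z) : edist (mk f x) (mk f y) ≤ preDist x y :=
  quotientEDist_le_dist x y

/-- The upper bound follows a path through the attaching points. For the lower bound, `cylDist` is a
pseudo-metric on the disjoint union that is at most `preDist` and vanishes on identified points. -/
theorem edist_mk (x y : PreCylinder R Z) :
    edist (mk f x) (mk f y) = ENNReal.ofReal (cylDist f x y) := by
  refine le_antisymm ?_ ?_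
  · have edge_le : ∀ (c : R) (t : unitInterval),
        edist (mk f (base (f c))) (mk f (edge c t)) ≤ ENNReal.ofReal (1 - t) := by
      intro c t
      rw [← mk_edge_one]
      refine (edist_mk_le _ _).trans ?_
      simp only [preDist, if_true]
      rw [edist_dist, Subtype.dist_eq, Real.dist_eq, abs_of_nonneg (by simp [t.2.2])]
      simp
    have base_le : ∀ z z' : Z,
        edist (mk f (base z)) (mk f (base z')) ≤ ENNReal.ofReal (dist z z') := by
      intro z z'
      refine (edist_mk_le _ _).trans ?_
      simp [preDist, edist_dist]
    have t0 : ∀ t : unitInterval, 0 ≤ 1 - (t : ℝ) := fun t => by linarith [t.2.2]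
    rcases x with z | ⟨c, t⟩ <;> rcases y with z' | ⟨c', t'⟩ <;> simp only [cylDist]
    · exact base_le z z'
    · rw [ENNReal.ofReal_add dist_nonneg (t0 _)]
      exact (edist_triangle _ (mk f (base (f c'))) _).trans
        (add_le_add (base_le _ _) (edge_le _ _))
    · rw [ENNReal.ofReal_add dist_nonneg (t0 _), edist_comm, dist_comm]
      exact (edist_triangle _ (mk f (base (f c))) _).trans
        (add_le_add (base_le _ _) (edge_le _ _))
    · split_ifs with h
      · subst h
        refine (edist_mk_le _ _).trans ?_
        simp only [preDist, if_true]
        rw [edist_dist, Subtype.dist_eq, Real.dist_eq]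
      · rw [ENNReal.ofReal_add (add_nonneg dist_nonneg (t0 _)) (t0 _),
          ENNReal.ofReal_add dist_nonneg (t0 _),
          add_comm (ENNReal.ofReal (dist (f c) (f c')))]
        refine (edist_triangle4 _ (mk f (base (f c))) (mk f (base (f c'))) _).trans ?_
        refine add_le_add (add_le_add ?_ (base_le _ _)) (edge_le _ _)
        rw [edist_comm]; exact edge_le _ _
  · let _ := cylPseudoMetricSpace f
    have e : ∀ x y : PreCylinder R Z, edist x y = ENNReal.ofReal (cylDist f x y) := fun x y => by
      rw [edist_dist]; rfl
    rw [← e]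
    refine edist_le_quotientEDist (fun x : PreCylinder R Z => x) (fun x y => ?_) ?_ x y
    · rw [e]; exact ofReal_cylDist_le_preDist f x y
    · intro x y h
      induction h with
      | rel x y h =>
        rcases h with ⟨c⟩
        rw [e]; simp [cylDist]
      | refl x => exact edist_self x
      | symm x y _ ih => rw [edist_comm]; exact ih
      | trans x y z _ _ ih1 ih2 =>
        refine le_antisymm ((edist_triangle x y z).trans ?_) bot_le
        rw [ih1, ih2]; simp

theorem mk_eq_mk_of_cylDist_eq_zero {x y : PreCylinder R Z} (h : cylDist f x y ≤ 0) :
    mk f x = mk f y := by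
  have edge : ∀ (z : Z) (c : R) (t : unitInterval), dist z (f c) + (1 - t) ≤ 0 →
      mk f (base z) = mk f (edge c t) := by
    intro z c t h
    have h1 := t.2.2
    have h2 := dist_nonneg (x := z) (y := f c)
    have e1 : z = f c := dist_le_zero.1 (by linarith)
    have e2 : t = 1 := Subtype.ext (show (t : ℝ) = 1 by linarith)
    rw [e1, e2, mk_edge_one]
  rcases x with z | ⟨c, t⟩ <;> rcases y with z' | ⟨c', t'⟩ <;> simp only [cylDist] at h
  · rw [dist_le_zero.1 h]
  · exact edge _ _ _ h
  · rw [dist_comm] at h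
    exact (edge _ _ _ h).symm
  · split_ifs at h with h'
    · subst h'
      have : t = t' := Subtype.ext (by
        have := abs_nonpos_iff.1 h
        linarith)
      rw [this]
    · have h1 := t'.2.2
      have h2 := t.2.2
      have h3 := dist_nonneg (x := f c) (y := f c')
      rw [← edge (f c) c t (by rw [dist_self]; linarith), edge (f c) c' t' (by linarith)]

/-- Built on the quotient distance, so that `edist` remains the one used for `Φ(R)`. -/
noncomputable instance : MetricSpace (MappingCylinder f) :=
  letI : EMetricSpace (MappingCylinder f) :=
    { (inferInstance : PseudoEMetricSpace (MappingCylinder f)) with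
      eq_of_edist_eq_zero := fun {a b} h => by
        induction a using Quotient.inductionOn with
        | _ x =>
        induction b using Quotient.inductionOn with
        | _ y =>
        have := (edist_mk (f := f) x y).symm.trans h
        exact mk_eq_mk_of_cylDist_eq_zero (ENNReal.ofReal_eq_zero.1 this) }
  EMetricSpace.toMetricSpace fun a b => by
    induction a using Quotient.inductionOn with
    | _ x =>
    induction b using Quotient.inductionOn with
    | _ y =>
    exact (edist_mk (f := f) x y).trans_ne ENNReal.ofReal_ne_top

theorem dist_mk (x y : PreCylinder R Z) : dist (mk f x) (mk f y) = cylDist f x y := by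
  rw [← ENNReal.ofReal_eq_ofReal_iff dist_nonneg (by
    let _ := cylPseudoMetricSpace f
    exact dist_nonneg (x := x) (y := y)), ← edist_dist]
  exact edist_mk x y

end MappingCylinder

/-! ### Isometric images, intervals and points -/

section

variable {X : Type*} [MetricSpace X]

theorem IsCNSet.image {A : Type*} [MetricSpace A] {S : Set A} (hS : IsCNSet S) (φ : A → X)
    (hφ : ∀ x ∈ S, ∀ y ∈ S, dist (φ x) (φ y) = dist x y) : IsCNSet (φ '' S) := by
  refine ⟨?_, ?_⟩
  · rintro _ ⟨x, hx, rfl⟩ _ ⟨y, hy, rfl⟩ t ht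
    obtain ⟨m, hm, h⟩ := hS.exists_between x hx y hy t ht
    refine ⟨_, ⟨m, hm, rfl⟩, ?_⟩
    rwa [IsBetween, hφ x hx m hm, hφ m hm y hy, hφ x hx y hy]
  · rintro _ ⟨x, hx, rfl⟩ _ ⟨y, hy, rfl⟩ _ ⟨m, hm, rfl⟩ _ ⟨p, hp, rfl⟩ t ht h
    rw [IsBetween, hφ x hx m hm, hφ m hm y hy, hφ x hx y hy] at h
    rw [hφ p hp m hm, hφ p hp x hx, hφ p hp y hy, hφ x hx y hy]
    exact hS.cn x hx y hy m hm p hp t ht h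

theorem isCNSet_Icc (a b : ℝ) : IsCNSet (Set.Icc a b) := by
  refine IsCNSet.of_exists fun x hx y hy t ht => ⟨(1 - t) * x + t * y, ?_, ⟨?_, ?_⟩, fun p _ => ?_⟩
  · exact (convex_Icc a b) hx hy (by linarith [ht.2]) ht.1 (by ring)
  · rw [Real.dist_eq, Real.dist_eq, show x - ((1 - t) * x + t * y) = t * (x - y) by ring, abs_mul,
      abs_of_nonneg ht.1]
  · rw [Real.dist_eq, Real.dist_eq, show (1 - t) * x + t * y - y = (1 - t) * (x - y) by ring,
      abs_mul, abs_of_nonneg (by linarith [ht.2])]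
  · simp only [Real.dist_eq, sq_abs]
    apply le_of_eq
    ring

theorem isCNSet_singleton (x : X) : IsCNSet ({x} : Set X) := by
  refine ⟨?_, ?_⟩
  · rintro _ rfl _ rfl t _
    exact ⟨_, rfl, by simp [IsBetween]⟩
  · rintro _ rfl _ rfl _ rfl _ rfl t _ _
    simp

end

namespace MappingCylinder

open PreCylinder

variable {R Z : Type*} [MetricSpace Z] {f : R → Z}

/-- The union of the base and of finitely many edges. -/
def finitePart (f : R → Z) (F : Finset R) : Set (MappingCylinder f) :=
  {q | (∃ z, q = mk f (base z)) ∨ ∃ c ∈ F, ∃ t, q = mk f (edge c t)}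

/-- Edges are attached one at a time; a new edge meets the previous part in the single point `f c`.
-/
theorem isCNSet_finitePart (hZ : IsCAT0 Z) (F : Finset R) : IsCNSet (finitePart f F) := by
  classical
  induction F using Finset.induction_on with
  | empty =>
    have e : finitePart f ∅ = (fun z => mk f (base z)) '' Set.univ := by
      ext q; simp [finitePart, eq_comm]
    rw [e]
    exact hZ.isCNSet.image _ fun x _ y _ => by rw [dist_mk]; rfl
  | insert c F hc ih =>
    have hedge : IsCNSet {q : MappingCylinder f | ∃ t, q = mk f (edge c t)} := by
      have e : {q : MappingCylinder f | ∃ t, q = mk f (edge c t)} =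
          (fun t : ℝ => mk f (edge c (Set.projIcc 0 1 zero_le_one t))) '' Set.Icc 0 1 := by
        ext q
        constructor
        · rintro ⟨t, rfl⟩
          exact ⟨t, t.2, by simp⟩
        · rintro ⟨t, ht, rfl⟩
          exact ⟨_, rfl⟩
      rw [e]
      refine (isCNSet_Icc 0 1).image _ fun x hx y hy => ?_
      rw [dist_mk, Set.projIcc_of_mem _ hx, Set.projIcc_of_mem _ hy]
      simp [cylDist, Real.dist_eq]
    have e : finitePart f (insert c F) = finitePart f F ∪ {q | ∃ t, q = mk f (edge c t)} := by
      ext q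
      simp only [finitePart, Set.mem_union, Set.mem_ofPred_eq, Finset.mem_insert, or_and_right,
        exists_or, exists_eq_left, or_assoc]
      rw [or_comm (a := ∃ t, q = mk f (edge c t))]
    have hdist : ∀ x ∈ finitePart f F, ∀ t, dist x (mk f (edge c t)) =
        dist x (mk f (base (f c))) + (1 - t) := by
      rintro x (⟨z, rfl⟩ | ⟨c', hc', t', rfl⟩) t
      · simp only [dist_mk, cylDist]
      · have : c' ≠ c := fun h => hc (h ▸ hc')
        simp only [dist_mk, cylDist, this, if_false]
    have hbase : mk f (base (f c)) ∈ finitePart f F ∩ {q | ∃ t, q = mk f (edge c t)} :=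
      ⟨Or.inl ⟨_, rfl⟩, 1, (mk_edge_one c).symm⟩
    rw [e]
    refine IsGluing.isCNSet_union ⟨ih, hedge, ?_, ?_⟩
    · have : finitePart f F ∩ {q | ∃ t, q = mk f (edge c t)} = {mk f (base (f c))} := by
        refine Set.eq_singleton_iff_unique_mem.2 ⟨hbase, ?_⟩
        rintro _ ⟨h1, t, rfl⟩
        have := hdist _ h1 t
        rw [dist_self] at this
        exact dist_le_zero.1 (by linarith [t.2.2])
      rw [this]
      exact isCNSet_singleton _
    · rintro x hx _ ⟨t, rfl⟩
      refine ⟨_, hbase, ?_⟩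
      rw [hdist x hx t, dist_mk (f := f) (base (f c))]
      simp [cylDist]

theorem isCAT0 (hZ : IsCAT0 Z) : IsCAT0 (MappingCylinder f) := by
  classical
  have key : ∀ q : MappingCylinder f, ∃ F, ∀ F', F ⊆ F' → q ∈ finitePart f F' := by
    intro q
    induction q using Quotient.inductionOn with
    | _ x =>
    rcases x with z | ⟨c, t⟩
    · exact ⟨∅, fun _ _ => Or.inl ⟨z, rfl⟩⟩
    · exact ⟨{c}, fun F' h => Or.inr ⟨c, h (by simp), t, rfl⟩⟩
  refine isCAT0_of_forall_exists_isCNSet fun x y m p => ?_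
  obtain ⟨F₁, h1⟩ := key x
  obtain ⟨F₂, h2⟩ := key y
  obtain ⟨F₃, h3⟩ := key m
  obtain ⟨F₄, h4⟩ := key p
  exact ⟨finitePart f (F₁ ∪ F₂ ∪ (F₃ ∪ F₄)), isCNSet_finitePart hZ _,
    h1 _ (Finset.subset_union_left.trans Finset.subset_union_left),
    h2 _ (Finset.subset_union_right.trans Finset.subset_union_left),
    h3 _ (Finset.subset_union_left.trans Finset.subset_union_right),
    h4 _ (Finset.subset_union_right.trans Finset.subset_union_right)⟩

theorem tip_injective (f : R → Z) : Function.Injective (tip f) := by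
  intro c c' h
  have : dist (mk f (edge c 0)) (mk f (edge c' 0)) = 0 := by
    rw [dist_eq_zero]; exact h
  rw [dist_mk] at this
  simp only [cylDist] at this
  by_contra hne
  simp only [hne, if_false, Set.Icc.coe_zero, sub_zero] at this
  linarith [dist_nonneg (x := f c) (y := f c')]

end MappingCylinder

/-! ### Right-angled Coxeter groups -/

section RightAngled

variable {I : Type*} (Γ : SimpleGraph I)

/-- The Coxeter system of the right-angled Coxeter group. -/
noncomputable def racs : CoxeterSystem (rightAngledMatrix Γ) (rightAngledMatrix Γ).Group :=
  (rightAngledMatrix Γ).toCoxeterSystem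

open Classical in
theorem rightAngledMatrix_of_adj {i j : I} (h : Γ.Adj i j) : rightAngledMatrix Γ i j = 2 := by
  change (if i = j then 1 else if Γ.Adj i j then 2 else 0) = 2
  rw [if_neg h.ne, if_pos h]

open Classical in
theorem rightAngledMatrix_of_not_adj {i j : I} (hij : i ≠ j) (h : ¬ Γ.Adj i j) :
    rightAngledMatrix Γ i j = 0 := by
  change (if i = j then 1 else if Γ.Adj i j then 2 else 0) = 0
  rw [if_neg hij, if_neg h]

/-- To define a homomorphism on the group, one needs involutions that commute for adjacent
vertices. -/
theorem isLiftable_rightAngledMatrix {G : Type*} [Monoid G] {f : I → G} (h1 : ∀ i, f i * f i = 1)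
    (h2 : ∀ i j, Γ.Adj i j → f i * f j = f j * f i) : (rightAngledMatrix Γ).IsLiftable f := by
  intro i j
  by_cases hij : i = j
  · subst hij
    rw [CoxeterMatrix.diagonal, pow_one, h1]
  by_cases h : Γ.Adj i j
  · rw [rightAngledMatrix_of_adj Γ h, pow_two]
    nth_rw 2 [h2 i j h]
    rw [mul_assoc, ← mul_assoc (f j), h1, one_mul, h1]
  · rw [rightAngledMatrix_of_not_adj Γ hij h, pow_zero]

variable {Γ}

theorem simple_commute {i j : I} (h : Γ.Adj i j) :
    (racs Γ).simple i * (racs Γ).simple j = (racs Γ).simple j * (racs Γ).simple i := by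
  have := (racs Γ).simple_mul_simple_pow i j
  rw [rightAngledMatrix_of_adj Γ h, pow_two] at this
  have h2 := eq_inv_of_mul_eq_one_left this
  rwa [mul_inv_rev, (racs Γ).inv_simple, (racs Γ).inv_simple] at h2

/-! #### The exchange property -/

open Classical in
/-- The action of a generator on `W × ℤ/2` that underlies the exchange property. -/
noncomputable def signedConj (Γ : SimpleGraph I) (i : I)
    (p : (rightAngledMatrix Γ).Group × ZMod 2) : (rightAngledMatrix Γ).Group × ZMod 2 :=
  ((racs Γ).simple i * p.1 * (racs Γ).simple i, p.2 + if p.1 = (racs Γ).simple i then 1 else 0)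

theorem conj_simple_eq_iff {i j : I}
    (h : (racs Γ).simple i * (racs Γ).simple j = (racs Γ).simple j * (racs Γ).simple i)
    (t : (rightAngledMatrix Γ).Group) :
    (racs Γ).simple i * t * (racs Γ).simple i = (racs Γ).simple j ↔ t = (racs Γ).simple j := by
  constructor
  · intro e
    have : t = (racs Γ).simple i * ((racs Γ).simple i * t * (racs Γ).simple i) *
        (racs Γ).simple i := by simp [mul_assoc]
    rw [this, e, h]; simp [mul_assoc]
  · rintro rfl
    rw [h]; simp [mul_assoc]

open Classical in
theorem isLiftable_signedConj :
    (rightAngledMatrix Γ).IsLiftable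
      (G := Function.End ((rightAngledMatrix Γ).Group × ZMod 2)) (signedConj Γ) := by
  refine isLiftable_rightAngledMatrix Γ (fun i => ?_) fun i j h => ?_
  · funext p
    refine Prod.ext ?_ ?_
    · change (racs Γ).simple i * ((racs Γ).simple i * p.1 * (racs Γ).simple i) *
        (racs Γ).simple i = p.1
      simp [mul_assoc]
    · change p.2 + (if p.1 = (racs Γ).simple i then 1 else 0) +
        (if (racs Γ).simple i * p.1 * (racs Γ).simple i = (racs Γ).simple i then 1 else 0) = p.2
      rw [add_assoc]
      simp only [conj_simple_eq_iff rfl]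
      split_ifs
      · rw [show (1 : ZMod 2) + 1 = 0 from rfl, add_zero]
      · simp
  · funext p
    refine Prod.ext ?_ ?_
    · change (racs Γ).simple i * ((racs Γ).simple j * p.1 * (racs Γ).simple j) *
        (racs Γ).simple i = (racs Γ).simple j * ((racs Γ).simple i * p.1 * (racs Γ).simple i) *
        (racs Γ).simple j
      have h1 := simple_commute h
      rw [← mul_assoc, ← mul_assoc, ← mul_assoc, ← mul_assoc, h1, mul_assoc _ ((racs Γ).simple j),
        ← h1, ← mul_assoc]
    · change p.2 + (if p.1 = (racs Γ).simple j then 1 else 0) +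
        (if (racs Γ).simple j * p.1 * (racs Γ).simple j = (racs Γ).simple i then 1 else 0) =
        p.2 + (if p.1 = (racs Γ).simple i then 1 else 0) +
        (if (racs Γ).simple i * p.1 * (racs Γ).simple i = (racs Γ).simple j then 1 else 0)
      simp only [conj_simple_eq_iff (simple_commute h), conj_simple_eq_iff (simple_commute h).symm]
      ring

/-- The action of the group on `W × ℤ/2` that underlies the exchange property. -/
noncomputable def signedConjHom (Γ : SimpleGraph I) :
    (rightAngledMatrix Γ).Group →* Function.End ((rightAngledMatrix Γ).Group × ZMod 2) :=
  (racs Γ).lift ⟨signedConj Γ, isLiftable_signedConj⟩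

theorem signedConjHom_simple (i : I) : signedConjHom Γ ((racs Γ).simple i) = signedConj Γ i :=
  (racs Γ).lift_apply_simple isLiftable_signedConj i

/-- Each letter flips the sign exactly when the current conjugate of `t` is that letter, which means
that `t` occurs in the right inversion sequence at this place. -/
theorem signedConjHom_wordProd (ω : List I) (t : (rightAngledMatrix Γ).Group) (ε : ZMod 2) :
    ∃ ε', signedConjHom Γ ((racs Γ).wordProd ω) (t, ε) =
        ((racs Γ).wordProd ω * t * ((racs Γ).wordProd ω)⁻¹, ε') ∧
      (ε' ≠ ε → t ∈ (racs Γ).rightInvSeq ω) := by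
  induction ω with
  | nil => exact ⟨ε, by simp; rfl, fun h => absurd rfl h⟩
  | cons i ω ih =>
    obtain ⟨ε', h1, h2⟩ := ih
    rw [CoxeterSystem.wordProd_cons, map_mul]
    change ∃ ε'', signedConjHom Γ ((racs Γ).simple i)
      (signedConjHom Γ ((racs Γ).wordProd ω) (t, ε)) = _ ∧ _
    rw [h1, signedConjHom_simple, signedConj]
    refine ⟨_, Prod.ext ?_ rfl, fun h => ?_⟩
    · simp [mul_assoc]
    · rw [CoxeterSystem.rightInvSeq, List.mem_cons]
      by_cases e : (racs Γ).wordProd ω * t * ((racs Γ).wordProd ω)⁻¹ = (racs Γ).simple i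
      · left
        rw [← e]; group
      · right
        refine h2 ?_
        simpa [e] using h

/-- The sign that `w` gives to `s_i` depends only on `w`, not on a word. If `ω` does not flip it, a
reduced word of `w * s_i` does, since `s_i` flips itself; then `s_i` is a right inversion of `w *
s_i`, contrary to the hypothesis on lengths. So `s_i` occurs in the inversion sequence of `ω`, and
the corresponding letter can be deleted. -/
theorem exchange {ω : List I} {i : I}
    (h : (racs Γ).length ((racs Γ).wordProd ω * (racs Γ).simple i) <
      (racs Γ).length ((racs Γ).wordProd ω)) :
    ∃ k < ω.length, (racs Γ).wordProd ω * (racs Γ).simple i =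
      (racs Γ).wordProd (ω.eraseIdx k) := by
  have main : (racs Γ).simple i ∈ (racs Γ).rightInvSeq ω := by
    obtain ⟨ε', h1, h2⟩ := signedConjHom_wordProd ω ((racs Γ).simple i) 0
    refine h2 fun e => ?_
    obtain ⟨ω', hω', e'⟩ := (racs Γ).exists_isReduced ((racs Γ).wordProd ω * (racs Γ).simple i)
    obtain ⟨ε'', h1', h2'⟩ := signedConjHom_wordProd ω' ((racs Γ).simple i) 0
    have : ε'' ≠ 0 := by
      rw [← e', map_mul] at h1'
      change signedConjHom Γ ((racs Γ).wordProd ω) (signedConjHom Γ ((racs Γ).simple i) _) = _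
        at h1'
      rw [signedConjHom_simple, signedConj] at h1'
      simp only [if_true, zero_add, CoxeterSystem.simple_mul_simple_cancel_right] at h1'
      obtain ⟨ε₃, h3, h4⟩ := signedConjHom_wordProd ω ((racs Γ).simple i) 1
      have h5 := congrArg Prod.snd (h3.symm.trans h1')
      simp only at h5
      rw [← h5]
      rintro rfl
      -- The action commutes with the change of sign.
      have add_one : ∀ (ω : List I) (t : (rightAngledMatrix Γ).Group) (ε : ZMod 2),
          (signedConjHom Γ ((racs Γ).wordProd ω) (t, ε + 1)) =
          ((signedConjHom Γ ((racs Γ).wordProd ω) (t, ε)).1,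
            (signedConjHom Γ ((racs Γ).wordProd ω) (t, ε)).2 + 1) := by
        intro ω t ε
        induction ω with
        | nil => rw [CoxeterSystem.wordProd_nil, map_one]; rfl
        | cons i ω ih =>
          rw [CoxeterSystem.wordProd_cons, map_mul]
          change signedConjHom Γ ((racs Γ).simple i)
            (signedConjHom Γ ((racs Γ).wordProd ω) (t, ε + 1)) =
            ((signedConjHom Γ ((racs Γ).simple i) (signedConjHom Γ ((racs Γ).wordProd ω) (t, ε))).1,
              (signedConjHom Γ ((racs Γ).simple i)
                (signedConjHom Γ ((racs Γ).wordProd ω) (t, ε))).2 + 1)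
          rw [ih, signedConjHom_simple, signedConj, signedConj]
          refine Prod.ext rfl ?_
          simp only; ring
      have h7 := add_one ω ((racs Γ).simple i) 0
      rw [h1, e, zero_add, h3] at h7
      have := congrArg Prod.snd h7
      simp at this
    have mem := h2' this
    have := (racs Γ).isRightInversion_of_mem_rightInvSeq hω' mem
    have h3 := this.2
    rw [← e', CoxeterSystem.simple_mul_simple_cancel_right] at h3
    exact absurd h (not_lt.2 h3.le)
  obtain ⟨k, hk, e⟩ := List.getElem_of_mem main
  rw [CoxeterSystem.length_rightInvSeq] at hk
  refine ⟨k, hk, ?_⟩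
  rw [← (racs Γ).wordProd_mul_getD_rightInvSeq ω k, List.getD_eq_getElem _ _ (by simpa using hk), e]

/-- The exchange property for the word `j :: ω` deletes the letter `j`; deleting a letter of `ω`
would make `w * s_i` shorter than `w`. -/
theorem simple_mul_eq_mul_simple {w : (rightAngledMatrix Γ).Group} {i j : I}
    (h1 : (racs Γ).length w < (racs Γ).length (w * (racs Γ).simple i))
    (h2 : (racs Γ).length ((racs Γ).simple j * w * (racs Γ).simple i) <
      (racs Γ).length ((racs Γ).simple j * w)) :
    (racs Γ).simple j * w = w * (racs Γ).simple i := by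
  obtain ⟨ω, hω, rfl⟩ := (racs Γ).exists_isReduced w
  rw [← CoxeterSystem.wordProd_cons] at h2
  obtain ⟨k, hk, e⟩ := exchange h2
  rw [CoxeterSystem.wordProd_cons] at e
  rcases k with _ | k
  · simp only [List.eraseIdx_zero, List.tail_cons] at e
    simpa using congrArg (· * (racs Γ).simple i) e
  · rw [List.eraseIdx_cons_succ, CoxeterSystem.wordProd_cons, mul_assoc] at e
    have e' := mul_left_cancel e
    have := (racs Γ).length_wordProd_le (ω.eraseIdx k)
    rw [← e', List.length_eraseIdx_of_lt (by simpa using hk)] at this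
    rw [hω.eq] at h1
    omega

/-! #### Infinite dihedral quotients -/

open Classical in
/-- The generators `i` and `k` act on `ℤ` by the reflections in `-1/2` and `1/2`. -/
noncomputable def dihedralGen (i k l : I) : Equiv.Perm ℤ :=
  if l = i then Equiv.subLeft (-1) else if l = k then Equiv.subLeft 1 else 1

theorem isLiftable_dihedralGen {i k : I} (h : ¬ Γ.Adj i k) :
    (rightAngledMatrix Γ).IsLiftable (dihedralGen i k) := by
  refine isLiftable_rightAngledMatrix Γ (fun l => ?_) fun l l' hl => ?_
  · ext x
    simp only [dihedralGen]
    split_ifs <;> simp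
  · have h' : ¬ Γ.Adj k i := fun e => h e.symm
    simp only [dihedralGen]
    split_ifs <;> subst_vars <;> simp_all

/-- In the action on `ℤ` generators are isometries that move `0` by at most `1`, so an element moves
`0` by at most its length. The alternating word moves `0` by exactly `m`. -/
theorem length_alternatingWord_le {i k : I} (hik : i ≠ k) (h : ¬ Γ.Adj i k) (m : ℕ) :
    m ≤ (racs Γ).length ((racs Γ).wordProd (CoxeterSystem.alternatingWord i k m)) := by
  set φ : (rightAngledMatrix Γ).Group →* Equiv.Perm ℤ :=
    (racs Γ).lift ⟨dihedralGen i k, isLiftable_dihedralGen h⟩ with hφ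
  have hs : ∀ l, φ ((racs Γ).simple l) = dihedralGen i k l := fun l =>
    (racs Γ).lift_apply_simple (isLiftable_dihedralGen h) l
  have hiso : ∀ l (x y : ℤ), |dihedralGen i k l x - dihedralGen i k l y| = |x - y| := by
    intro l x y
    simp only [dihedralGen]
    split_ifs
    · simp only [Equiv.subLeft_apply]
      rw [show -1 - x - (-1 - y) = y - x by ring, abs_sub_comm]
    · simp only [Equiv.subLeft_apply]
      rw [show 1 - x - (1 - y) = y - x by ring, abs_sub_comm]
    · simp
  have hgen : ∀ l, |dihedralGen i k l 0| ≤ 1 := by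
    intro l
    simp only [dihedralGen]
    split_ifs <;> simp
  have bound : ∀ ω : List I, |φ ((racs Γ).wordProd ω) 0| ≤ ω.length := by
    intro ω
    induction ω with
    | nil => simp
    | cons l ω ih =>
      rw [CoxeterSystem.wordProd_cons, map_mul, hs, Equiv.Perm.mul_apply]
      have h1 := hiso l (φ ((racs Γ).wordProd ω) 0) 0
      have h2 := hgen l
      rw [sub_zero] at h1
      have h3 := abs_sub_abs_le_abs_sub (dihedralGen i k l (φ ((racs Γ).wordProd ω) 0))
        (dihedralGen i k l 0)
      rw [List.length_cons]
      push_cast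
      linarith
  have bound' : ∀ w, |φ w 0| ≤ (racs Γ).length w := by
    intro w
    obtain ⟨ω, hω, rfl⟩ := (racs Γ).exists_isReduced w
    rw [hω.eq]; exact bound ω
  have hpow : ∀ n : ℕ, φ (((racs Γ).simple i * (racs Γ).simple k) ^ n) 0 = -2 * n := by
    intro n
    induction n with
    | zero => simp
    | succ n ih =>
      rw [pow_succ', map_mul, map_mul, hs, hs, Equiv.Perm.mul_apply, ih, Equiv.Perm.mul_apply]
      simp only [dihedralGen, if_true, hik.symm, if_false, Equiv.subLeft_apply]
      push_cast; ring
  have hval : |φ ((racs Γ).wordProd (CoxeterSystem.alternatingWord i k m)) 0| = m := by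
    rw [CoxeterSystem.prod_alternatingWord_eq_mul_pow, map_mul, Equiv.Perm.mul_apply, hpow]
    rcases Nat.even_or_odd' m with ⟨n, rfl | rfl⟩
    · rw [if_pos (by simp), map_one, Equiv.Perm.one_apply]
      rw [show 2 * n / 2 = n by omega, abs_of_nonpos (by omega)]
      push_cast; ring
    · rw [if_neg (by simp), hs]
      simp only [dihedralGen, if_true, hik.symm, if_false, Equiv.subLeft_apply]
      rw [show (2 * n + 1) / 2 = n by omega, abs_of_nonneg (by omega)]
      push_cast; ring
  have := bound' ((racs Γ).wordProd (CoxeterSystem.alternatingWord i k m))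
  rw [hval] at this
  exact_mod_cast this

theorem simple_mul_simple_pow_ne_one {i k : I} (hik : i ≠ k) (h : ¬ Γ.Adj i k) {n : ℕ}
    (hn : 0 < n) : ((racs Γ).simple i * (racs Γ).simple k) ^ n ≠ 1 := by
  intro e
  have h1 := length_alternatingWord_le hik h (2 * n)
  rw [CoxeterSystem.prod_alternatingWord_eq_mul_pow, if_pos (by simp),
    show 2 * n / 2 = n by omega, e, one_mul, CoxeterSystem.length_one] at h1
  omega

/-- Two different descents of an element commute. -/
theorem adj_of_isRightDescent {w : (rightAngledMatrix Γ).Group} {i k : I} (hik : i ≠ k)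
    (hi : (racs Γ).IsRightDescent w i) (hk : (racs Γ).IsRightDescent w k) : Γ.Adj i k := by
  by_contra h
  -- If `i` and `k` are not adjacent, the exchange property splits off alternating suffixes of every
  -- length, in particular longer than `w`.
  have key : ∀ n : ℕ, ∀ i k, i ≠ k → ¬ Γ.Adj i k → (racs Γ).IsRightDescent w i →
      (racs Γ).IsRightDescent w k → ∃ ω : List I,
        w = (racs Γ).wordProd ω * (racs Γ).wordProd (CoxeterSystem.alternatingWord i k n) ∧
        ω.length + n = (racs Γ).length w := by
    intro n
    induction n with
    | zero =>
      intro i k _ _ _ _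
      obtain ⟨ω, hω, e⟩ := (racs Γ).exists_isReduced w
      refine ⟨ω, by simp [e, CoxeterSystem.alternatingWord], ?_⟩
      rw [e, hω.eq, add_zero]
    | succ n ih =>
      intro i k hik h hi hk
      obtain ⟨ω, e, hl⟩ := ih k i hik.symm (fun e => h e.symm) hk hi
      rw [← CoxeterSystem.wordProd_append] at e
      have hk' := hk
      rw [CoxeterSystem.IsRightDescent, e] at hk'
      obtain ⟨r, hr, er⟩ := exchange hk'
      rw [← e] at er
      by_cases hrω : r < ω.length
      · rw [List.eraseIdx_append_of_lt_length hrω, CoxeterSystem.wordProd_append] at er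
        refine ⟨ω.eraseIdx r, ?_, ?_⟩
        · rw [CoxeterSystem.alternatingWord_succ, CoxeterSystem.wordProd_concat, ← mul_assoc, ← er]
          simp
        · rw [List.length_eraseIdx_of_lt hrω]; omega
      -- The deleted letter is not in the alternating suffix: otherwise the alternating word with `n
      -- + 1` letters would have length at most `n`.
      · exfalso
        rw [List.eraseIdx_append_of_length_le (not_lt.1 hrω), CoxeterSystem.wordProd_append, e,
          CoxeterSystem.wordProd_append, mul_assoc] at er
        have er' := mul_left_cancel er
        rw [← CoxeterSystem.wordProd_concat, ← CoxeterSystem.alternatingWord_succ] at er'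
        have l1 := length_alternatingWord_le hik h (n + 1)
        rw [er'] at l1
        have l2 := (racs Γ).length_wordProd_le
          ((CoxeterSystem.alternatingWord k i n).eraseIdx (r - ω.length))
        have l3 := List.length_eraseIdx_le (CoxeterSystem.alternatingWord k i n) (r - ω.length)
        rw [CoxeterSystem.length_alternatingWord] at l3
        omega
  obtain ⟨ω, -, hl⟩ := key ((racs Γ).length w + 1) i k hik h hi hk
  omega

/-! #### Standard subgroups -/

theorem simple_mem_standardSubgroup {J : Set I} {j : I} (hj : j ∈ J) :
    (racs Γ).simple j ∈ (rightAngledMatrix Γ).standardSubgroup J :=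
  Subgroup.subset_closure ⟨j, hj, rfl⟩

theorem standardSubgroup_mono {J K : Set I} (h : J ⊆ K) :
    (rightAngledMatrix Γ).standardSubgroup J ≤ (rightAngledMatrix Γ).standardSubgroup K :=
  Subgroup.closure_mono (Set.image_mono h)

open Classical in
-- Killing the generators outside `J` defines a retraction to `W_J` that does not increase length.
-- If `k ∉ J`, it maps `s_k * w` to `w`, so `k` is not a descent of `w`.
theorem mem_of_isLeftDescent {J : Set I} {w : (rightAngledMatrix Γ).Group}
    (hw : w ∈ (rightAngledMatrix Γ).standardSubgroup J) {k : I}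
    (hk : (racs Γ).IsLeftDescent w k) : k ∈ J := by
  let f : I → (rightAngledMatrix Γ).Group := fun l => if l ∈ J then (racs Γ).simple l else 1
  have hf : (rightAngledMatrix Γ).IsLiftable f := by
    refine isLiftable_rightAngledMatrix Γ (fun l => ?_) fun l l' hl => ?_
    · simp only [f]; split_ifs <;> simp
    · simp only [f]; split_ifs <;> simp [simple_commute hl]
  set ρ := (racs Γ).lift ⟨f, hf⟩
  have hs : ∀ l, ρ ((racs Γ).simple l) = f l := fun l => (racs Γ).lift_apply_simple hf l
  have hfix : ρ w = w := by
    clear hk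
    induction hw using Subgroup.closure_induction with
    | mem x hx =>
      obtain ⟨l, hl, rfl⟩ := hx
      exact (hs l).trans (if_pos hl)
    | one => exact map_one ρ
    | mul x y _ _ hx hy => rw [map_mul, hx, hy]
    | inv x _ hx => rw [map_inv, hx]
  have hle : ∀ u, (racs Γ).length (ρ u) ≤ (racs Γ).length u := by
    intro u
    obtain ⟨ω, hω, rfl⟩ := (racs Γ).exists_isReduced u
    rw [hω.eq]
    clear hω
    induction ω with
    | nil => simp
    | cons l ω ih =>
      rw [CoxeterSystem.wordProd_cons, map_mul, hs, List.length_cons]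
      refine ((racs Γ).length_mul_le _ _).trans ?_
      have : (racs Γ).length (f l) ≤ 1 := by simp only [f]; split_ifs <;> simp
      omega
  by_contra hkJ
  have e : ρ ((racs Γ).simple k * w) = w := by rw [map_mul, hs, hfix]; simp [f, hkJ]
  have := hle ((racs Γ).simple k * w)
  rw [e] at this
  exact absurd hk (not_lt.2 this)

theorem commute_of_mem_standardSubgroup {i : I} {J : Set I} (hJ : ∀ j ∈ J, j = i ∨ Γ.Adj i j)
    {w : (rightAngledMatrix Γ).Group} (hw : w ∈ (rightAngledMatrix Γ).standardSubgroup J) :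
    (racs Γ).simple i * w = w * (racs Γ).simple i := by
  induction hw using Subgroup.closure_induction with
  | mem x hx =>
    obtain ⟨l, hl, rfl⟩ := hx
    rcases hJ l hl with rfl | h
    · rfl
    · exact simple_commute h
  | one => simp
  | mul x y _ _ hx hy => rw [← mul_assoc, hx, mul_assoc, hy, mul_assoc]
  | inv x _ hx =>
    rw [← mul_right_inj x, ← mul_left_inj x]
    simp [mul_assoc, hx.symm]

/-- The centralizer of a generator. -/
theorem mem_standardSubgroup_of_commute {i : I} {w : (rightAngledMatrix Γ).Group}
    (h : (racs Γ).simple i * w = w * (racs Γ).simple i)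
    (hl : (racs Γ).length w < (racs Γ).length (w * (racs Γ).simple i)) :
    w ∈ (rightAngledMatrix Γ).standardSubgroup {j | Γ.Adj i j} := by
  induction hn : (racs Γ).length w using Nat.strong_induction_on generalizing w with
  | _ n ih =>
  by_cases hw : w = 1
  · rw [hw]; exact one_mem _
  obtain ⟨k, hk⟩ := (racs Γ).exists_rightDescent_of_ne_one hw
  have hk' := (racs Γ).isRightDescent_iff.1 hk
  have hki : i ≠ k := by
    rintro rfl
    exact absurd hk (not_lt.2 hl.le)
  have hl' := (racs Γ).length_mul_simple w i
  -- Both `i` and `k` are descents of `w * s_i = s_i * w`, so they commute, and `s_k` can be removed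
  -- from `w`.
  have hadj : Γ.Adj i k := by
    refine adj_of_isRightDescent (w := w * (racs Γ).simple i) hki ?_ ?_
    · rw [CoxeterSystem.IsRightDescent, CoxeterSystem.simple_mul_simple_cancel_right]; exact hl
    · rw [CoxeterSystem.IsRightDescent, ← h, mul_assoc]
      have := (racs Γ).length_mul_le ((racs Γ).simple i) (w * (racs Γ).simple k)
      rw [CoxeterSystem.length_simple] at this
      rw [h]; omega
  have hc := simple_commute hadj
  have : w * (racs Γ).simple k ∈ (rightAngledMatrix Γ).standardSubgroup {j | Γ.Adj i j} := by
    refine ih _ (by omega) ?_ ?_ rfl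
    · rw [← mul_assoc, h, mul_assoc, hc, mul_assoc]
    · rw [mul_assoc, ← hc, ← mul_assoc]
      have := (racs Γ).length_mul_simple (w * (racs Γ).simple i) k
      omega
  have h2 := mul_mem this (simple_mem_standardSubgroup (Γ := Γ) (show k ∈ {j | Γ.Adj i j} from hadj))
  rwa [CoxeterSystem.simple_mul_simple_cancel_right] at h2

-- The number of letters `i` modulo 2 is a homomorphism to a commutative group.
open Classical in
theorem eq_of_simple_mul_eq {i j : I} {w : (rightAngledMatrix Γ).Group}
    (h : (racs Γ).simple j * w = w * (racs Γ).simple i) : j = i := by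
  let f : I → Multiplicative (ZMod 2) := fun l => if l = i then Multiplicative.ofAdd 1 else 1
  have hf : (rightAngledMatrix Γ).IsLiftable f := by
    refine isLiftable_rightAngledMatrix Γ (fun l => ?_) fun l l' _ => mul_comm _ _
    simp only [f]; split_ifs
    · rfl
    · rfl
  have hs : ∀ l, (racs Γ).lift ⟨f, hf⟩ ((racs Γ).simple l) = f l := fun l =>
    (racs Γ).lift_apply_simple hf l
  have := congrArg ((racs Γ).lift ⟨f, hf⟩) h
  rw [map_mul, map_mul, mul_comm, hs, hs] at this
  have := mul_left_cancel this
  by_contra hne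
  simp only [f, hne, if_false, if_true] at this
  exact absurd this (by decide)

theorem adj_of_finite_standardSubgroup {J : Set I}
    (hJ : Finite ((rightAngledMatrix Γ).standardSubgroup J)) {i j : I} (hi : i ∈ J) (hj : j ∈ J)
    (hij : i ≠ j) : Γ.Adj i j := by
  by_contra h
  let x : (rightAngledMatrix Γ).standardSubgroup J :=
    ⟨(racs Γ).simple i * (racs Γ).simple j,
      mul_mem (simple_mem_standardSubgroup hi) (simple_mem_standardSubgroup hj)⟩
  refine simple_mul_simple_pow_ne_one hij h (orderOf_pos x) ?_
  have := congrArg Subtype.val (pow_orderOf_eq_one x)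
  rwa [Subgroup.coe_pow] at this

/-- If `s_k` commutes with `W_J`, adding `k` to `J` gives the union of `W_J` and `s_k * W_J`. -/
theorem finite_standardSubgroup [Finite I] {J : Set I}
    (hJ : ∀ i ∈ J, ∀ j ∈ J, i ≠ j → Γ.Adj i j) :
    Finite ((rightAngledMatrix Γ).standardSubgroup J) := by
  have key : ∀ J : Set I, J.Finite → (∀ i ∈ J, ∀ j ∈ J, i ≠ j → Γ.Adj i j) →
      ((rightAngledMatrix Γ).standardSubgroup J : Set (rightAngledMatrix Γ).Group).Finite := by
    intro J hJf
    induction J, hJf using Set.Finite.induction_on with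
    | empty => intro _; simp [CoxeterMatrix.standardSubgroup]
    | @insert k J hk hJf ih =>
      intro hJ
      have hfin := ih fun i hi j hj => hJ i (Or.inr hi) j (Or.inr hj)
      refine (hfin.union (hfin.image fun w => (racs Γ).simple k * w)).subset ?_
      intro w hw
      have hcl : ∀ l ∈ insert k J, ∀ u, (u ∈ (rightAngledMatrix Γ).standardSubgroup J ∨
          (racs Γ).simple k * u ∈ (rightAngledMatrix Γ).standardSubgroup J) →
          ((racs Γ).simple l * u ∈ (rightAngledMatrix Γ).standardSubgroup J ∨
          (racs Γ).simple k * ((racs Γ).simple l * u) ∈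
            (rightAngledMatrix Γ).standardSubgroup J) := by
        rintro l (rfl | hl) u hu
        · rw [CoxeterSystem.simple_mul_simple_cancel_left]; exact hu.symm
        · have hc := simple_commute (hJ l (Or.inr hl) k (Or.inl rfl) (fun e => hk (e ▸ hl)))
          have hm := simple_mem_standardSubgroup (Γ := Γ) hl
          refine hu.imp (fun h => mul_mem hm h) fun h => ?_
          rw [← mul_assoc, ← hc, mul_assoc]
          exact mul_mem hm h
      have : w ∈ (rightAngledMatrix Γ).standardSubgroup J ∨
          (racs Γ).simple k * w ∈ (rightAngledMatrix Γ).standardSubgroup J := by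
        change w ∈ Subgroup.closure _ at hw
        induction hw using Subgroup.closure_induction_left with
        | one => exact Or.inl (one_mem _)
        | mul_left x hx y _ ih =>
          obtain ⟨l, hl, rfl⟩ := hx
          exact hcl l hl y ih
        | inv_mul_cancel x hx y _ ih =>
          obtain ⟨l, hl, rfl⟩ := hx
          have : ((rightAngledMatrix Γ).simple l)⁻¹ = (racs Γ).simple l :=
            (racs Γ).inv_simple l
          rw [this]
          exact hcl l hl y ih
      rcases this with h | h
      · exact Or.inl h
      · exact Or.inr ⟨_, h, by simp⟩
  exact (key J (Set.toFinite J) hJ).to_subtype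

end RightAngled

/-! ### Right-angled buildings -/

section RightAngledBuilding

variable {I C : Type*} {Γ : SimpleGraph I}

local notation "σ" => CoxeterSystem.simple (racs Γ)
local notation "ℓ" => CoxeterSystem.length (racs Γ)
local notation "W_" => CoxeterMatrix.standardSubgroup (rightAngledMatrix Γ)

/-- If `i` were a descent of `v * s_j`, the exchange property would delete a letter of `v`, and then
`i` would be a descent of `v` by commutation, or it would delete `j`, and then `s_j = s_i`. -/
theorem length_mul_simple_lt_of_adj {v : (rightAngledMatrix Γ).Group} {i j : I} (h : Γ.Adj i j)
    (hv : ℓ v < ℓ (v * σ i)) : ℓ (v * σ j) < ℓ (v * σ j * σ i) := by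
  by_contra hlt
  have hc := simple_commute h
  have h1 := (racs Γ).length_mul_simple (v * σ j) i
  have h2 := (racs Γ).length_mul_simple v j
  have h3 : ℓ (v * σ i) ≤ ℓ (v * σ j * σ i) + 1 := by
    have := (racs Γ).length_mul_simple (v * σ j * σ i) j
    rw [mul_assoc (v * σ j), hc, ← mul_assoc, CoxeterSystem.simple_mul_simple_cancel_right] at this
    omega
  obtain ⟨ω, hω, rfl⟩ := (racs Γ).exists_isReduced v
  have hd : ℓ ((racs Γ).wordProd (ω ++ [j]) * σ i) < ℓ ((racs Γ).wordProd (ω ++ [j])) := by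
    rw [CoxeterSystem.wordProd_append, CoxeterSystem.wordProd_singleton]
    omega
  obtain ⟨k, hk, e⟩ := exchange hd
  rw [CoxeterSystem.wordProd_append, CoxeterSystem.wordProd_singleton] at e
  by_cases hkω : k < ω.length
  · rw [List.eraseIdx_append_of_lt_length hkω, CoxeterSystem.wordProd_append,
      CoxeterSystem.wordProd_singleton, mul_assoc, ← hc, ← mul_assoc] at e
    have e' := mul_right_cancel e
    rw [e'] at hv
    have l1 := (racs Γ).length_wordProd_le (ω.eraseIdx k)
    rw [List.length_eraseIdx_of_lt hkω] at l1
    rw [hω.eq] at hv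
    omega
  · have hk' : k = ω.length := by simp at hk; omega
    rw [List.eraseIdx_append_of_length_le (not_lt.1 hkω), hk'] at e
    simp only [Nat.sub_self, List.eraseIdx_zero, List.tail_cons, List.append_nil] at e
    rw [mul_assoc] at e
    have e' : σ j * σ i = 1 := by simpa using e
    have e2 : σ j * 1 = 1 * σ i := by
      rw [one_mul, mul_one]
      have := eq_inv_of_mul_eq_one_left e'
      rwa [CoxeterSystem.inv_simple] at this
    exact h.ne (eq_of_simple_mul_eq e2).symm

/-! ### The distance function of a building -/

namespace Building

variable (B : Building (rightAngledMatrix Γ) C)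

theorem δ_self (c : C) : B.δ c c = 1 := (B.δ_eq_one_iff c c).2 rfl

theorem simple_ne_one (i : I) : σ i ≠ 1 := by
  intro h
  have := (racs Γ).length_simple i
  rw [h, CoxeterSystem.length_one] at this
  exact absurd this (by norm_num)

variable {B}

theorem ne_of_δ_eq_simple {i : I} {c d : C} (h : B.δ c d = σ i) : c ≠ d := by
  rintro rfl
  rw [δ_self] at h
  exact simple_ne_one i h.symm

theorem δ_left_cases {i : I} {c' c : C} (h : B.δ c' c = σ i) (d : C) :
    B.δ c' d = σ i * B.δ c d ∨ B.δ c' d = B.δ c d := (B.δ_of_adj i c' c d h).1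

theorem δ_left_of_lt {i : I} {c' c d : C} (h : B.δ c' c = σ i)
    (hl : ℓ (B.δ c d) < ℓ (σ i * B.δ c d)) : B.δ c' d = σ i * B.δ c d := by
  refine (B.δ_of_adj i c' c d h).2 ?_
  have := (racs Γ).length_simple_mul (B.δ c d) i
  change ℓ (σ i * B.δ c d) = ℓ (B.δ c d) + 1
  omega

theorem δ_simple_symm {i : I} {c d : C} (h : B.δ c d = σ i) : B.δ d c = σ i := by
  rcases δ_left_cases h c with h1 | h1 <;> rw [δ_self] at h1
  · have := eq_inv_of_mul_eq_one_right h1.symm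
    rwa [CoxeterSystem.inv_simple] at this
  · exact absurd ((B.δ_eq_one_iff d c).1 h1.symm).symm (ne_of_δ_eq_simple h)

/-- The axioms describe changes of the first chamber only. Here the second one changes, by induction
along a minimal gallery from `d` to `c'`; symmetry of `δ` follows from this. -/
theorem δ_right_of_lt {i : I} {d c' c : C} (h : B.δ c' c = σ i)
    (hl : ℓ (B.δ d c') < ℓ (B.δ d c' * σ i)) : B.δ d c = B.δ d c' * σ i := by
  induction hn : ℓ (B.δ d c') using Nat.strong_induction_on generalizing d with
  | _ n ih =>
  by_cases h1 : B.δ d c' = 1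
  · rw [h1, one_mul, (B.δ_eq_one_iff d c').1 h1, h]
  obtain ⟨j, hj⟩ := (racs Γ).exists_leftDescent_of_ne_one h1
  rw [CoxeterSystem.isLeftDescent_iff] at hj
  obtain ⟨d', hd, hd'⟩ := B.exists_adj j d c'
  change B.δ d' d = σ j at hd
  change B.δ d' c' = σ j * B.δ d c' at hd'
  have l1 := (racs Γ).length_simple_mul (B.δ d c' * σ i) j
  have l2 := (racs Γ).length_mul_simple (B.δ d c') i
  have := ih (ℓ (B.δ d' c')) (by rw [hd']; omega) (d := d')
    (by rw [hd', mul_assoc]; omega) rfl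
  rw [hd', mul_assoc] at this
  rw [δ_left_of_lt (δ_simple_symm hd) (by
    rw [this, CoxeterSystem.simple_mul_simple_cancel_left]
    have := (racs Γ).length_mul_simple (σ j * B.δ d c') i
    rw [mul_assoc] at this
    omega), this, CoxeterSystem.simple_mul_simple_cancel_left]

theorem δ_symm (c d : C) : B.δ d c = (B.δ c d)⁻¹ := by
  induction hn : ℓ (B.δ c d) using Nat.strong_induction_on generalizing c with
  | _ n ih =>
  by_cases h1 : B.δ c d = 1
  · rw [h1, inv_one, (B.δ_eq_one_iff c d).1 h1, δ_self]
  obtain ⟨j, hj⟩ := (racs Γ).exists_leftDescent_of_ne_one h1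
  rw [CoxeterSystem.isLeftDescent_iff] at hj
  obtain ⟨c', hc, hc'⟩ := B.exists_adj j c d
  change B.δ c' c = σ j at hc
  change B.δ c' d = σ j * B.δ c d at hc'
  have := ih (ℓ (B.δ c' d)) (by rw [hc']; omega) c' rfl
  rw [hc', mul_inv_rev, CoxeterSystem.inv_simple] at this
  rw [δ_right_of_lt hc, this, CoxeterSystem.simple_mul_simple_cancel_right]
  rw [this, CoxeterSystem.simple_mul_simple_cancel_right, ← (racs Γ).inv_simple j, ← mul_inv_rev,
    CoxeterSystem.length_inv, CoxeterSystem.length_inv]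
  omega

theorem δ_right_cases {i : I} {c' c : C} (h : B.δ c' c = σ i) (d : C) :
    B.δ d c = B.δ d c' * σ i ∨ B.δ d c = B.δ d c' := by
  rw [δ_symm c d, δ_symm c' d]
  refine (δ_left_cases (δ_simple_symm h) d).imp (fun e => ?_) fun e => ?_
  · rw [e, mul_inv_rev, CoxeterSystem.inv_simple]
  · rw [e]

variable (B)

theorem exists_adj_right (i : I) (d c : C) :
    ∃ c', B.δ c c' = σ i ∧ B.δ d c' = B.δ d c * σ i := by
  obtain ⟨c', h1, h2⟩ := B.exists_adj i c d
  refine ⟨c', δ_simple_symm h1, ?_⟩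
  rw [δ_symm c' d, h2, mul_inv_rev, ← δ_symm]
  congr 1
  exact (racs Γ).inv_simple i

variable {B}

/-! #### Residues -/

/-- A property that is invariant under `j`-adjacency for all `j ∈ J` is constant on `J`-residues. -/
theorem residue_induction {J : Set I} {p : C → Prop} {d : C}
    (step : ∀ x y : C, ∀ j ∈ J, B.δ x d ∈ W_ J → B.δ x y = σ j → p y → p x)
    (hd : p d) {c : C} (h : B.δ c d ∈ W_ J) : p c := by
  induction hn : ℓ (B.δ c d) using Nat.strong_induction_on generalizing c with
  | _ n ih =>
  by_cases h1 : B.δ c d = 1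
  · rwa [(B.δ_eq_one_iff c d).1 h1]
  obtain ⟨j, hj⟩ := (racs Γ).exists_leftDescent_of_ne_one h1
  have hjJ := mem_of_isLeftDescent h hj
  rw [CoxeterSystem.isLeftDescent_iff] at hj
  obtain ⟨c', hc, hc'⟩ := B.exists_adj j c d
  change B.δ c' c = σ j at hc
  change B.δ c' d = σ j * B.δ c d at hc'
  refine step c c' j hjJ h (δ_simple_symm hc) (ih (ℓ (B.δ c' d)) (by rw [hc']; omega) ?_ rfl)
  rw [hc']
  exact mul_mem (simple_mem_standardSubgroup hjJ) h

theorem δ_mem_symm {J : Set I} {c d : C} (h : B.δ c d ∈ W_ J) : B.δ d c ∈ W_ J := by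
  rw [δ_symm]; exact inv_mem h

theorem δ_mem_trans {J : Set I} {c d e : C} (h : B.δ c d ∈ W_ J) (h' : B.δ d e ∈ W_ J) :
    B.δ c e ∈ W_ J := by
  refine residue_induction (p := fun x => B.δ x e ∈ W_ J) (fun x y j hj _ hxy hy => ?_) h' h
  rcases δ_left_cases hxy e with h1 | h1 <;> rw [h1]
  · exact mul_mem (simple_mem_standardSubgroup hj) hy
  · exact hy

theorem mem_standardSubgroup_singleton {i : I} {w : (rightAngledMatrix Γ).Group} :
    w ∈ W_ {i} ↔ w = 1 ∨ w = σ i := by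
  constructor
  · intro h
    by_cases h1 : w = 1
    · exact Or.inl h1
    right
    obtain ⟨j, hj⟩ := (racs Γ).exists_leftDescent_of_ne_one h1
    obtain rfl : j = i := mem_of_isLeftDescent h hj
    by_cases h2 : σ j * w = 1
    · have := eq_inv_of_mul_eq_one_right h2
      rwa [CoxeterSystem.inv_simple] at this
    obtain ⟨k, hk⟩ := (racs Γ).exists_leftDescent_of_ne_one h2
    obtain rfl : k = j :=
      mem_of_isLeftDescent (mul_mem (simple_mem_standardSubgroup (Set.mem_singleton j)) h) hk
    rw [CoxeterSystem.IsLeftDescent, CoxeterSystem.simple_mul_simple_cancel_left] at hk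
    exact absurd hj (not_lt.2 hk.le)
  · rintro (rfl | rfl)
    · exact one_mem _
    · exact simple_mem_standardSubgroup (Set.mem_singleton i)

theorem mem_panel {i : I} {c d : C} :
    d ∈ (B.panel i c).1.chambers ↔ d = c ∨ B.δ c d = σ i := by
  change B.δ c d ∈ W_ (({i} : Finset I) : Set I) ↔ _
  rw [Finset.coe_singleton, mem_standardSubgroup_singleton, B.δ_eq_one_iff, eq_comm]

theorem self_mem_panel (i : I) (c : C) : c ∈ (B.panel i c).1.chambers := B.mem_residueSet_self _ c

theorem residueSet_eq {J : Finset I} {c d : C} (h : B.δ c d ∈ W_ (J : Set I)) :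
    B.residueSet J d = B.residueSet J c := by
  ext e
  exact ⟨fun h' => δ_mem_trans h h', fun h' => δ_mem_trans (δ_mem_symm h) h'⟩

theorem panel_eq_of_mem {i : I} {c d : C} (h : d ∈ (B.panel i c).1.chambers) :
    B.panel i d = B.panel i c := by
  refine Subtype.ext ?_
  change (⟨{i}, B.residueSet {i} d, _⟩ : B.Residue) = ⟨{i}, B.residueSet {i} c, _⟩
  congr 1
  exact residueSet_eq h

theorem Panel.exists_eq (r : B.Panel) : ∃ i c, r = B.panel i c := by
  obtain ⟨⟨J, S, c, rfl⟩, i, hi⟩ := r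
  change J = {i} at hi
  subst hi
  exact ⟨i, c, rfl⟩

/-! #### Projections to panels -/

theorem length_δ_proj_lt (i : I) (c x : C) :
    ℓ (B.δ x ((B.panel i c).1.proj x)) < ℓ (B.δ x ((B.panel i c).1.proj x) * σ i) := by
  set p := (B.panel i c).1.proj x with hp
  have hpm : p ∈ (B.panel i c).1.chambers := (B.panel i c).1.proj_mem x
  obtain ⟨e, h1, h2⟩ := B.exists_adj_right i x p
  have he : e ∈ (B.panel i c).1.chambers := by
    rw [← panel_eq_of_mem hpm, mem_panel]; exact Or.inr h1
  have : ℓ (B.δ x p) ≤ ℓ (B.δ x e) :=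
    Function.argminOn_le (fun d => (rightAngledMatrix Γ).toCoxeterSystem.length (B.δ x d)) _ he
  rw [h2] at this
  have := (racs Γ).length_mul_simple (B.δ x p) i
  omega

theorem proj_panel_eq {i : I} {c x d : C} (hd : d ∈ (B.panel i c).1.chambers)
    (h : ℓ (B.δ x d) < ℓ (B.δ x d * σ i)) : (B.panel i c).1.proj x = d := by
  set p := (B.panel i c).1.proj x with hp
  have hpm : p ∈ (B.panel i c).1.chambers := (B.panel i c).1.proj_mem x
  have hlt := length_δ_proj_lt (B := B) i c x
  rw [← hp] at hlt
  rw [← panel_eq_of_mem hd, mem_panel] at hpm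
  rcases hpm with h1 | h1
  · exact h1
  · rw [δ_right_of_lt h1 h, CoxeterSystem.simple_mul_simple_cancel_right] at hlt
    omega

theorem proj_panel_self {i : I} {c x : C} (h : x ∈ (B.panel i c).1.chambers) :
    (B.panel i c).1.proj x = x := by
  refine proj_panel_eq h ?_
  rw [δ_self, one_mul, CoxeterSystem.length_one, CoxeterSystem.length_simple]
  exact one_pos

/-- The generator `i` together with the generators that commute with it. -/
abbrev star (Γ : SimpleGraph I) (i : I) : Set I := insert i {j | Γ.Adj i j}

theorem commute_of_mem_star {i : I} {w : (rightAngledMatrix Γ).Group} (h : w ∈ W_ (star Γ i)) :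
    σ i * w = w * σ i :=
  commute_of_mem_standardSubgroup (fun _ hj => hj) h

/-- In a residue whose type is the star of `i`, distances are products of a power of `s_i` and an
element of the link subgroup; projecting removes the first factor. -/
theorem δ_proj_mem {i : I} {c x : C} (h : B.δ x c ∈ W_ (star Γ i)) :
    B.δ x ((B.panel i c).1.proj x) ∈ W_ {j | Γ.Adj i j} := by
  refine mem_standardSubgroup_of_commute ?_ (length_δ_proj_lt i c x)
  refine commute_of_mem_star (δ_mem_trans h ?_)
  exact standardSubgroup_mono (by simp)
    ((B.panel i c).1.proj_mem x : B.δ c _ ∈ W_ (({i} : Finset I) : Set I))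

theorem δ_mem_star_of_mem_panel {i : I} {c x : C} (h : x ∈ (B.panel i c).1.chambers) :
    B.δ c x ∈ W_ (star Γ i) :=
  standardSubgroup_mono (by simp) (h : B.δ c x ∈ W_ (({i} : Finset I) : Set I))

/-- Adjacent chambers have different projections to a panel only if they cross a parallel panel. -/
theorem proj_panel_ne_iff {i k : I} {c x x' : C} (h : B.δ x x' = σ k) :
    (B.panel i c).1.proj x ≠ (B.panel i c).1.proj x' ↔ k = i ∧ B.δ x c ∈ W_ (star Γ i) := by
  have hpm := (B.panel i c).1.proj_mem x
  have hlt := length_δ_proj_lt (B := B) i c x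
  constructor
  · intro hne
    set p := (B.panel i c).1.proj x with hp
    have hv : ¬ ℓ (B.δ x' p) < ℓ (B.δ x' p * σ i) := fun hv =>
      hne (proj_panel_eq hpm hv).symm
    rcases δ_left_cases (δ_simple_symm h) p with h1 | h1
    · rw [h1] at hv
      have h2 := (racs Γ).length_mul_simple (σ k * B.δ x p) i
      -- The projection changes only if `s_k * v = v * s_i` for `v = δ(x, p)`. Then `k = i`, and `v`
      -- lies in the centralizer of `s_i`.
      have h3 := simple_mul_eq_mul_simple hlt (j := k) (by omega)
      obtain rfl := eq_of_simple_mul_eq h3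
      refine ⟨rfl, ?_⟩
      have h4 := mem_standardSubgroup_of_commute h3 hlt
      exact δ_mem_trans (standardSubgroup_mono (Set.subset_insert _ _) h4)
        (δ_mem_symm (δ_mem_star_of_mem_panel hpm))
    · rw [h1] at hv
      exact absurd hlt hv
  · rintro ⟨rfl, hm⟩ heq
    have hc := commute_of_mem_star (standardSubgroup_mono (Set.subset_insert _ _) (δ_proj_mem hm))
    have hlt' := length_δ_proj_lt (B := B) k c x'
    rw [← heq] at hlt'
    rw [δ_left_of_lt (δ_simple_symm h) (by rw [hc]; exact hlt), hc,
      CoxeterSystem.simple_mul_simple_cancel_right] at hlt'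
    omega

/-- Passing to a `j`-adjacent chamber, with `j` adjacent to `i`, does not make `i` a right descent
of the distance from `x`. -/
theorem proj_panel_of_δ_mem {i : I} {p q x : C} (h : B.δ q p ∈ W_ {j | Γ.Adj i j})
    (hp : (B.panel i p).1.proj x = p) : (B.panel i q).1.proj x = q := by
  refine residue_induction (p := fun q => (B.panel i q).1.proj x = q)
    (fun q' q j hj _ hq hq' => ?_) hp h
  refine proj_panel_eq (self_mem_panel i q') ?_
  have hlt := length_δ_proj_lt (B := B) i q x
  rw [hq'] at hlt
  rcases δ_right_cases (δ_simple_symm hq) x with e | e <;> rw [e]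
  · exact length_mul_simple_lt_of_adj hj hlt
  · exact hlt

theorem proj_panel_proj_panel {i : I} {c d : C} (h : B.δ c d ∈ W_ (star Γ i)) (x : C) :
    (B.panel i c).1.proj ((B.panel i d).1.proj x) = (B.panel i c).1.proj x := by
  set p := (B.panel i d).1.proj x with hp
  have hpm : p ∈ (B.panel i d).1.chambers := (B.panel i d).1.proj_mem x
  set q := (B.panel i c).1.proj p with hq
  have hqm : q ∈ (B.panel i c).1.chambers := (B.panel i c).1.proj_mem p
  have h1 : B.δ p c ∈ W_ (star Γ i) :=
    δ_mem_symm (δ_mem_trans h (δ_mem_star_of_mem_panel hpm))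
  have h2 := δ_mem_symm (δ_proj_mem h1)
  rw [← hq] at h2
  have := proj_panel_of_δ_mem h2 (x := x) (by rw [panel_eq_of_mem hpm])
  rw [panel_eq_of_mem hqm] at this
  exact this.symm

variable (B) in
theorem exists_ne_mem_panel (i : I) (c : C) : ∃ d ∈ (B.panel i c).1.chambers, d ≠ c := by
  obtain ⟨d, h, -⟩ := B.exists_adj_right i c c
  exact ⟨d, mem_panel.2 (Or.inr h), (ne_of_δ_eq_simple h).symm⟩

/-- Panels have at least two chambers, so some two chambers of the first panel have different
projections to the second, and `proj_panel_ne_iff` applies. Conversely, the projections are inverse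
to each other by `proj_panel_proj_panel`. -/
theorem parallel_panel_iff {i k : I} {c d : C} :
    (B.panel i c).1.Parallel (B.panel k d).1 ↔ i = k ∧ B.δ c d ∈ W_ (star Γ i) := by
  constructor
  · rintro ⟨-, h⟩
    obtain ⟨d', hd', hne⟩ := B.exists_ne_mem_panel k d
    have hd := self_mem_panel (B := B) k d
    rw [← h] at hd hd'
    obtain ⟨x, hx, rfl⟩ := hd'
    obtain ⟨y, hy, e⟩ := hd
    have hxy : x ≠ y := by rintro rfl; exact hne e
    rw [← panel_eq_of_mem hx, mem_panel] at hy
    have := (proj_panel_ne_iff (hy.resolve_left hxy.symm)).1 (by rw [e]; exact hne)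
    obtain ⟨rfl, hm⟩ := this
    exact ⟨rfl, δ_mem_trans (δ_mem_star_of_mem_panel hx) hm⟩
  · rintro ⟨rfl, h⟩
    have key : ∀ c d : C, B.δ c d ∈ W_ (star Γ i) →
        (B.panel i c).1.proj '' (B.panel i d).1.chambers = (B.panel i c).1.chambers := by
      intro c d h
      refine subset_antisymm ?_ fun y hy => ⟨(B.panel i d).1.proj y, Residue.proj_mem _ _, ?_⟩
      · rintro _ ⟨x, -, rfl⟩
        exact Residue.proj_mem _ _
      · rw [proj_panel_proj_panel h, proj_panel_self hy]
    exact ⟨key c d h, key d c (δ_mem_symm h)⟩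

end Building

end RightAngledBuilding

/-! ### Parallel classes of panels -/

section RightAngledBuilding

variable {I C : Type*} {Γ : SimpleGraph I}

local notation "σ" => CoxeterSystem.simple (racs Γ)
local notation "ℓ" => CoxeterSystem.length (racs Γ)
local notation "W_" => CoxeterMatrix.standardSubgroup (rightAngledMatrix Γ)

namespace Building

variable (B : Building (rightAngledMatrix Γ) C)

/-- The parallel class of the `i`-panel of `c`. -/
noncomputable def cls (i : I) (c : C) : B.ParallelClass := (B.panel i c).parallelClass

variable {B}

theorem cls_eq_iff {i k : I} {c d : C} :
    B.cls i c = B.cls k d ↔ i = k ∧ B.δ c d ∈ W_ (star Γ i) := by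
  rw [← parallel_panel_iff]
  have heq : Equivalence fun r r' : B.Panel => r.1.Parallel r'.1 := by
    refine ⟨fun r => ?_, fun h => ⟨h.2, h.1⟩, fun {r r' r''} h h' => ?_⟩
    · obtain ⟨i, c, rfl⟩ := r.exists_eq
      exact parallel_panel_iff.2 ⟨rfl, by rw [δ_self]; exact one_mem _⟩
    · obtain ⟨i, c, rfl⟩ := r.exists_eq
      obtain ⟨j, d, rfl⟩ := r'.exists_eq
      obtain ⟨k, e, rfl⟩ := r''.exists_eq
      rw [parallel_panel_iff] at h h' ⊢
      obtain ⟨rfl, h⟩ := h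
      obtain ⟨rfl, h'⟩ := h'
      exact ⟨rfl, δ_mem_trans h h'⟩
  exact ⟨fun h => heq.eqvGen_iff.1 (Quot.eqvGen_exact h), fun h => Quot.sound h⟩

namespace ParallelClass

theorem exists_rep_eq (l : B.ParallelClass) : ∃ i c, l.rep = B.panel i c ∧ l = B.cls i c := by
  obtain ⟨i, c, h⟩ := l.rep.exists_eq
  refine ⟨i, c, h, ?_⟩
  rw [cls, ← h]
  exact (Quot.out_eq l).symm

/-- The type of the panels of a parallel class. -/
noncomputable def type (l : B.ParallelClass) : I := l.exists_rep_eq.choose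

/-- A chamber of the chosen panel of a parallel class. -/
noncomputable def base (l : B.ParallelClass) : C := l.exists_rep_eq.choose_spec.choose

theorem rep_eq (l : B.ParallelClass) : l.rep = B.panel l.type l.base :=
  l.exists_rep_eq.choose_spec.choose_spec.1

theorem cls_base (l : B.ParallelClass) : B.cls l.type l.base = l :=
  l.exists_rep_eq.choose_spec.choose_spec.2.symm

/-- The projection to the chosen panel of a parallel class. -/
noncomputable def π (l : B.ParallelClass) (c : C) : C := l.rep.1.proj c

/-- The chambers that lie in a panel of the class. -/
def wall (l : B.ParallelClass) : Set C := {c | B.cls l.type c = l}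

theorem base_mem (l : B.ParallelClass) : l.base ∈ l.wall := l.cls_base

end ParallelClass

open ParallelClass

theorem type_cls (i : I) (c : C) : (B.cls i c).type = i :=
  (cls_eq_iff.1 (cls_base (B.cls i c))).1

theorem mem_wall_cls (i : I) (c : C) : c ∈ (B.cls i c).wall := by
  rw [wall, Set.mem_ofPred_eq, type_cls]

theorem mem_wall_iff {l : B.ParallelClass} {c : C} :
    c ∈ l.wall ↔ B.δ c l.base ∈ W_ (star Γ l.type) := by
  rw [wall, Set.mem_ofPred_eq]
  conv_lhs => rhs; rw [← l.cls_base]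
  rw [cls_eq_iff]
  simp

theorem mem_wall_of_δ_mem {l : B.ParallelClass} {c d : C} (hc : c ∈ l.wall)
    (h : B.δ c d ∈ W_ (star Γ l.type)) : d ∈ l.wall := by
  rw [mem_wall_iff] at hc ⊢
  exact δ_mem_trans (δ_mem_symm h) hc

theorem mem_wall_of_adj {l : B.ParallelClass} {k : I} {c d : C} (hc : c ∈ l.wall)
    (h : B.δ c d = σ k) (hk : k ∈ star Γ l.type) : d ∈ l.wall :=
  mem_wall_of_δ_mem hc (h ▸ simple_mem_standardSubgroup hk)

theorem cls_eq_of_mem_wall {l : B.ParallelClass} {c : C} (hc : c ∈ l.wall) {k : I}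
    (hk : k = l.type) : B.cls k c = l := hk ▸ hc

theorem mem_wall_of_cls_eq {l : B.ParallelClass} {c : C} {k : I} (h : B.cls k c = l) :
    c ∈ l.wall := h ▸ mem_wall_cls k c

theorem type_of_cls_eq {l : B.ParallelClass} {c : C} {k : I} (h : B.cls k c = l) :
    l.type = k := h ▸ type_cls k c

theorem π_ne_iff {l : B.ParallelClass} {k : I} {x x' : C} (h : B.δ x x' = σ k) :
    l.π x ≠ l.π x' ↔ B.cls k x = l := by
  rw [π, π, rep_eq, proj_panel_ne_iff h]
  conv_rhs => rhs; rw [← l.cls_base]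
  rw [cls_eq_iff]
  constructor
  · rintro ⟨rfl, hm⟩; exact ⟨rfl, hm⟩
  · rintro ⟨rfl, hm⟩; exact ⟨rfl, hm⟩

theorem π_eq_of_cls_ne {l : B.ParallelClass} {k : I} {x x' : C} (h : B.δ x x' = σ k)
    (hl : B.cls k x ≠ l) : l.π x = l.π x' := by
  by_contra hne
  exact hl ((π_ne_iff h).1 hne)

theorem π_mem (l : B.ParallelClass) (c : C) : l.π c ∈ l.rep.1.chambers := Residue.proj_mem _ _

theorem π_proj_panel {l : B.ParallelClass} {c : C} (hc : c ∈ l.wall) (x : C) :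
    l.π ((B.panel l.type c).1.proj x) = l.π x := by
  rw [π, π, rep_eq]
  exact proj_panel_proj_panel (δ_mem_symm (mem_wall_iff.1 hc)) x

theorem π_of_mem_rep {l : B.ParallelClass} {c : C} (hc : c ∈ l.rep.1.chambers) : l.π c = c := by
  rw [π, rep_eq]
  rw [rep_eq] at hc
  exact proj_panel_self hc

theorem mem_wall_of_mem_rep {l : B.ParallelClass} {c : C} (hc : c ∈ l.rep.1.chambers) :
    c ∈ l.wall := by
  rw [rep_eq] at hc
  exact mem_wall_of_δ_mem l.base_mem (δ_mem_star_of_mem_panel hc)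

/-- In a panel of the class there is a chamber with any prescribed projection. -/
theorem exists_mem_panel_π_eq {l : B.ParallelClass} {c d : C} (hc : c ∈ l.wall)
    (hd : d ∈ l.rep.1.chambers) : ∃ c' ∈ (B.panel l.type c).1.chambers, l.π c' = d :=
  ⟨(B.panel l.type c).1.proj d, Residue.proj_mem _ _, by rw [π_proj_panel hc, π_of_mem_rep hd]⟩

/-- The first step of a minimal gallery. -/
theorem exists_step {x y : C} (h : x ≠ y) : ∃ (k : I) (x' : C), B.δ x x' = σ k ∧
    ℓ (B.δ x' y) + 1 = ℓ (B.δ x y) ∧ (B.cls k x).π x ≠ (B.cls k x).π y ∧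
    (B.cls k x).π x' = (B.cls k x).π y := by
  have h1 : B.δ x y ≠ 1 := fun e => h ((B.δ_eq_one_iff x y).1 e)
  obtain ⟨k, hk⟩ := (racs Γ).exists_leftDescent_of_ne_one h1
  rw [CoxeterSystem.isLeftDescent_iff] at hk
  obtain ⟨x', hx, hx'⟩ := B.exists_adj k x y
  change B.δ x' x = σ k at hx
  change B.δ x' y = σ k * B.δ x y at hx'
  have hs := δ_simple_symm hx
  have hp : (B.panel k x).1.proj y = x' := by
    refine proj_panel_eq (mem_panel.2 (Or.inr hs)) ?_
    rw [δ_symm x' y, hx', mul_inv_rev, CoxeterSystem.inv_simple,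
      CoxeterSystem.simple_mul_simple_cancel_right, ← (racs Γ).inv_simple k, ← mul_inv_rev,
      CoxeterSystem.length_inv, CoxeterSystem.length_inv]
    omega
  have h2 := π_proj_panel (mem_wall_cls (B := B) k x) y
  rw [type_cls, hp] at h2
  refine ⟨k, x', hs, by rw [hx', hk], ?_, h2⟩
  rw [← h2]
  exact (π_ne_iff hs).2 rfl

/-- Between two chambers that a class separates, there is a chamber at the wall of this class. -/
theorem exists_mem_wall {l : B.ParallelClass} {x y : C} (h : l.π x ≠ l.π y) :
    ∃ z ∈ l.wall, ∀ m : B.ParallelClass, m.π x = m.π y → m.π z = m.π x := by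
  induction hn : ℓ (B.δ x y) using Nat.strong_induction_on generalizing x with
  | _ n ih =>
  obtain ⟨k, x', hs, hlt, h1, h2⟩ := exists_step (B := B) (x := x) (y := y)
    (fun e => h (by rw [e]))
  by_cases hl : B.cls k x = l
  · exact ⟨x, mem_wall_of_cls_eq hl, fun m _ => rfl⟩
  · have e := π_eq_of_cls_ne hs hl
    obtain ⟨z, hz, hm⟩ := ih _ (by omega) (x := x') (by rw [← e]; exact h) rfl
    refine ⟨z, hz, fun m hxy => ?_⟩
    have hmk : B.cls k x ≠ m := by rintro rfl; exact h1 hxy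
    have e' := π_eq_of_cls_ne hs hmk
    rw [hm m (by rw [← e', hxy]), e']

/-- A step of a gallery changes the projection to one class only. -/
theorem finite_π_ne (x y : C) : {l : B.ParallelClass | l.π x ≠ l.π y}.Finite := by
  induction hn : ℓ (B.δ x y) using Nat.strong_induction_on generalizing x with
  | _ n ih =>
  by_cases hxy : x = y
  · simp [hxy]
  obtain ⟨k, x', hs, hlt, h1, h2⟩ := exists_step (B := B) hxy
  refine ((ih _ (by omega) x' rfl).insert (B.cls k x)).subset fun l hl => ?_
  by_cases hlk : B.cls k x = l
  · exact Or.inl hlk.symm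
  · right
    rw [Set.mem_ofPred_eq, ← π_eq_of_cls_ne hs hlk]
    exact hl

/-- Chambers that are separated only by classes with types in `J` lie in the same `J`-residue. -/
theorem δ_mem_of_forall_type_mem {J : Set I} {x y : C}
    (h : ∀ l : B.ParallelClass, l.π x ≠ l.π y → l.type ∈ J) : B.δ x y ∈ W_ J := by
  induction hn : ℓ (B.δ x y) using Nat.strong_induction_on generalizing x with
  | _ n ih =>
  by_cases hxy : x = y
  · rw [hxy, δ_self]; exact one_mem _
  obtain ⟨k, x', hs, hlt, h1, h2⟩ := exists_step (B := B) hxy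
  have hk : k ∈ J := by
    have := h _ h1
    rwa [type_cls] at this
  refine δ_mem_trans (hs ▸ simple_mem_standardSubgroup hk) (ih _ (by omega) (fun l hl => ?_) rfl)
  refine h l fun e => ?_
  by_cases hlk : B.cls k x = l
  · subst hlk
    exact hl h2
  · exact hl (by rw [← π_eq_of_cls_ne hs hlk, e])

/-- A class that separates two chambers of a `J`-residue meets this residue. -/
theorem exists_cls_eq_of_π_ne {J : Set I} {x y : C} (h : B.δ x y ∈ W_ J) {l : B.ParallelClass}
    (hl : l.π x ≠ l.π y) : l.type ∈ J ∧ ∃ z ∈ l.wall, B.δ z y ∈ W_ J := by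
  by_contra hcon
  refine hl (residue_induction (p := fun x => l.π x = l.π y) (fun u v j hj hu huv hv => ?_) rfl h)
  rw [← hv]
  refine π_eq_of_cls_ne huv fun e => hcon ⟨?_, u, mem_wall_of_cls_eq e, hu⟩
  rw [type_of_cls_eq e]; exact hj

/-! #### Separated classes -/

namespace ParallelClass

/-- Two different classes are separated unless their types commute and some chamber lies in panels
of both. -/
def Separated (l m : B.ParallelClass) : Prop :=
  l ≠ m ∧ ¬ (Γ.Adj l.type m.type ∧ (l.wall ∩ m.wall).Nonempty)

theorem Separated.symm {l m : B.ParallelClass} (h : l.Separated m) : m.Separated l :=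
  ⟨h.1.symm, fun h' => h.2 ⟨h'.1.symm, by rw [Set.inter_comm]; exact h'.2⟩⟩

/-- The chambers at `m` lie in one residue whose type is the star of the type of `m`. If `l`
separated two of them, it would meet this residue, and its type would be that of `m` or commute with
it; so `l` would be `m` or not be separated from it. -/
theorem Separated.π_eq {l m : B.ParallelClass} (h : l.Separated m) {x y : C} (hx : x ∈ m.wall)
    (hy : y ∈ m.wall) : l.π x = l.π y := by
  by_contra hne
  have hxy : B.δ x y ∈ W_ (star Γ m.type) :=
    δ_mem_trans (mem_wall_iff.1 hx) (δ_mem_symm (mem_wall_iff.1 hy))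
  obtain ⟨ht, z, hz, hzy⟩ := exists_cls_eq_of_π_ne hxy hne
  have hzm : z ∈ m.wall := mem_wall_of_δ_mem hy (δ_mem_symm hzy)
  rcases ht with ht | ht
  · exact h.1 ((cls_eq_of_mem_wall hz ht.symm).symm.trans hzm)
  · exact h.2 ⟨SimpleGraph.Adj.symm ht, z, hz, hzm⟩

/-- If `l` separates `c` from its projection to the panel of `m`, there is a chamber `z` at `l`
which `m` does not separate from `c`. So `c` has the same projection to `m` as the chambers at `l`.
-/
theorem Separated.π_eq_or {l m : B.ParallelClass} (h : l.Separated m) (c : C) :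
    l.π c = l.π m.base ∨ m.π c = m.π l.base := by
  by_contra! hne
  have h1 : m.π (m.π c) = m.π c := π_of_mem_rep (π_mem m c)
  have h2 : l.π (m.π c) = l.π m.base := h.π_eq (mem_wall_of_mem_rep (π_mem m c)) m.base_mem
  obtain ⟨z, hz, hm⟩ := exists_mem_wall (l := l) (x := c) (y := m.π c) (by rw [h2]; exact hne.1)
  refine hne.2 ?_
  rw [← hm m h1.symm]
  exact h.symm.π_eq hz l.base_mem

/-- A chamber at both `l` and `k` would have both gates as its projection to `m`. -/
theorem Separated.resolve {l m k : B.ParallelClass} (h : l.Separated m) (h' : m.Separated k)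
    (hne : m.π l.base ≠ m.π k.base) :
    l.Separated k ∧ l.π k.base = l.π m.base ∧ k.π l.base = k.π m.base := by
  refine ⟨⟨fun e => hne (by rw [e]), fun ht => ?_⟩, ?_, ?_⟩
  · obtain ⟨-, x, hx, hx'⟩ := ht
    exact hne ((h.symm.π_eq l.base_mem hx).trans (h'.π_eq hx' k.base_mem))
  · exact (h.π_eq_or k.base).resolve_right hne.symm
  · exact (h'.symm.π_eq_or l.base).resolve_right hne

/-- A consistent family of projections that differs from the projections of a chamber in finitely
many places belongs to a chamber. -/
theorem exists_π_eq {v : B.ParallelClass → C} (hv : ∀ l, v l ∈ l.rep.1.chambers)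
    (hcons : ∀ l m : B.ParallelClass, l.Separated m → v l = l.π m.base ∨ v m = m.π l.base)
    {c₀ : C} (hfin : {l : B.ParallelClass | v l ≠ l.π c₀}.Finite) :
    ∃ c : C, ∀ l : B.ParallelClass, l.π c = v l := by
  have hf : ∀ c : C, {l : B.ParallelClass | v l ≠ l.π c}.Finite := fun c => by
    refine (hfin.union (finite_π_ne c₀ c)).subset fun l hl => ?_
    by_contra hcon
    simp only [Set.mem_union, Set.mem_ofPred_eq, not_or, not_not] at hcon
    exact hl (hcon.1.trans hcon.2)
  have : Nonempty C := ⟨c₀⟩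
  -- A chamber with the fewest wrong projections. It is not at a wrong class, since moving inside
  -- its panel would correct this projection and change no other.
  let c := Function.argmin fun c : C => {l : B.ParallelClass | v l ≠ l.π c}.ncard
  have hmin : ∀ d, {l : B.ParallelClass | v l ≠ l.π c}.ncard ≤
      {l : B.ParallelClass | v l ≠ l.π d}.ncard := fun d =>
    Function.argmin_le (fun c : C => {l : B.ParallelClass | v l ≠ l.π c}.ncard) d
  have hwall : ∀ l, v l ≠ l.π c → c ∉ l.wall := by
    intro l hl hc
    obtain ⟨c', hc', e⟩ := exists_mem_panel_π_eq hc (hv l)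
    rw [mem_panel] at hc'
    have hcc : B.δ c c' = σ l.type := hc'.resolve_left (by rintro rfl; exact hl e.symm)
    refine absurd (hmin c') (not_le.2 (Set.ncard_lt_ncard ⟨?_, fun hsub => ?_⟩ (hf c)))
    · intro m hm
      have hne : B.cls l.type c ≠ m := by
        intro h
        have hc2 : B.cls l.type c = l := hc
        rw [hc2] at h
        subst h
        exact hm e.symm
      rw [Set.mem_ofPred_eq, π_eq_of_cls_ne hcc hne]
      exact hm
    · exact hsub (show l ∈ {l : B.ParallelClass | v l ≠ l.π c} from hl) e.symm
  refine ⟨c, ?_⟩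
  by_contra! hcon
  have hS : {z : C | ∃ l : B.ParallelClass, v l ≠ l.π c ∧ z ∈ l.wall}.Nonempty := by
    obtain ⟨l, hl⟩ := hcon
    exact ⟨l.base, l, hl.symm, l.base_mem⟩
  -- Suppose that some class is wrong, and take a chamber `z` at a wrong class `l` as close to `c`
  -- as possible. The class crossed by the first step from `z` towards `c` turns out to be separated
  -- from `l` and wrong as well, and the next chamber is at it and closer to `c`.
  obtain ⟨l, hl, hz⟩ := Function.argminOn_mem (fun z => ℓ (B.δ z c)) _ hS
  set z := Function.argminOn (fun z => ℓ (B.δ z c)) _ hS with hzdef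
  have hle : ∀ z' (m : B.ParallelClass), v m ≠ m.π c → z' ∈ m.wall →
      ℓ (B.δ z c) ≤ ℓ (B.δ z' c) := fun z' m hm hz' =>
    Function.argminOn_le (fun z => ℓ (B.δ z c))
      {z : C | ∃ l : B.ParallelClass, v l ≠ l.π c ∧ z ∈ l.wall} ⟨m, hm, hz'⟩
  have hzc : z ≠ c := by
    intro e
    exact hwall l hl (e ▸ hz)
  obtain ⟨k, z', hs, hlt, h1, h2⟩ := exists_step hzc
  have hkl : k ∉ star Γ l.type := fun hk => by
    have := hle z' l hl (mem_wall_of_adj hz hs hk)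
    omega
  have hN : l.Separated (B.cls k z) := by
    refine ⟨?_, fun h => hkl (Or.inr ?_)⟩
    · rintro e
      exact hkl (Or.inl (type_of_cls_eq e.symm).symm)
    · have := h.1
      rwa [type_cls] at this
  have e1 : l.π (B.cls k z).base = l.π z := hN.π_eq (base_mem _) (mem_wall_cls k z)
  have e2 : (B.cls k z).π l.base = (B.cls k z).π z := hN.symm.π_eq l.base_mem hz
  have h3 : l.π c = l.π z := by
    rw [← e1]
    refine (hN.π_eq_or c).resolve_right fun h => h1 ?_
    rw [h, e2]
  have h4 : v (B.cls k z) = (B.cls k z).π z := by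
    rw [← e2]
    refine (hcons l _ hN).resolve_left fun h => hl ?_
    rw [h, e1, h3]
  have := hle z' (B.cls k z) (by rw [h4]; exact h1)
    (mem_wall_of_adj (mem_wall_cls k z) hs (by rw [type_cls]; exact Or.inl rfl))
  omega

end ParallelClass

end Building

end RightAngledBuilding

/-! ### Coordinates on the blow-up -/

section RightAngledBlowUp

variable {I C : Type*} {Γ : SimpleGraph I} {B : Building (rightAngledMatrix Γ) C}

local notation "W_" => CoxeterMatrix.standardSubgroup (rightAngledMatrix Γ)

namespace Building

theorem ParallelClass.base_mem_rep (l : B.ParallelClass) : l.base ∈ l.rep.1.chambers := by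
  rw [ParallelClass.rep_eq]; exact self_mem_panel _ _

namespace SphericalResidue

variable (R : B.SphericalResidue)

theorem type_subset_star {j : I} (hj : j ∈ R.1.type) : (R.1.type : Set I) ⊆ star Γ j := by
  intro k hk
  by_cases h : k = j
  · exact Or.inl h
  · exact Or.inr (adj_of_finite_standardSubgroup R.2 hj hk (Ne.symm h))

theorem δ_mem {c d : C} (hc : c ∈ R.1.chambers) (hd : d ∈ R.1.chambers) :
    B.δ c d ∈ W_ (R.1.type : Set I) := by
  obtain ⟨e, he⟩ := R.1.isResidue
  rw [he] at hc hd
  exact δ_mem_trans (δ_mem_symm hc) hd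

theorem mem_of_δ_mem {c d : C} (hc : c ∈ R.1.chambers) (h : B.δ c d ∈ W_ (R.1.type : Set I)) :
    d ∈ R.1.chambers := by
  obtain ⟨e, he⟩ := R.1.isResidue
  rw [he] at hc ⊢
  exact δ_mem_trans hc h

theorem factor_eq (j : R.1.type) {c : C} (hc : c ∈ R.1.chambers) : R.factor j = B.cls j c :=
  cls_eq_iff.2 ⟨rfl, standardSubgroup_mono (R.type_subset_star j.2)
    (R.δ_mem R.1.nonempty.some_mem hc)⟩

theorem type_factor (j : R.1.type) : (R.factor j).type = j := type_cls _ _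

theorem factor_injective : Function.Injective R.factor := fun j k h =>
  Subtype.ext (by rw [← R.type_factor j, h, R.type_factor])

theorem mem_wall_factor (j : R.1.type) {c : C} (hc : c ∈ R.1.chambers) :
    c ∈ (R.factor j).wall :=
  mem_wall_of_cls_eq (R.factor_eq j hc).symm

theorem π_eq {l : B.ParallelClass} (hl : ∀ j, R.factor j ≠ l) {c d : C} (hc : c ∈ R.1.chambers)
    (hd : d ∈ R.1.chambers) : l.π c = l.π d := by
  by_contra hne
  obtain ⟨ht, z, hz, hzd⟩ := exists_cls_eq_of_π_ne (R.δ_mem hc hd) hne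
  refine hl ⟨l.type, ht⟩ ?_
  rw [R.factor_eq _ (R.mem_of_δ_mem hd (δ_mem_symm hzd))]
  exact hz

theorem not_separated_factor (j k : R.1.type) : ¬ (R.factor j).Separated (R.factor k) := by
  intro h
  refine h.2 ⟨?_, R.1.nonempty.some, R.mem_wall_factor j R.1.nonempty.some_mem,
    R.mem_wall_factor k R.1.nonempty.some_mem⟩
  rw [type_factor, type_factor]
  refine adj_of_finite_standardSubgroup R.2 j.2 k.2 fun e => h.1 ?_
  rw [Subtype.ext e]

end SphericalResidue

end Building

namespace BlowUpData

open Building Building.ParallelClass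

variable (D : BlowUpData B)

theorem tip_eq_iff {l : B.ParallelClass} {c d : C} : D.tip l c = D.tip l d ↔ l.π c = l.π d := by
  constructor
  · intro h
    exact congrArg Subtype.val (MappingCylinder.tip_injective _ h)
  · intro h
    exact congrArg (MappingCylinder.tip _) (Subtype.ext h)

/-- The clauses satisfied by the coordinates of the points of the blow-up. -/
noncomputable def clauses : ClauseSystem D.Cyl where
  N := Separated
  symm := Separated.symm
  irrefl l h := h.1 rfl
  gate l m := D.tip l m.base
  resolve h h' hne := by
    have := h.resolve h' fun e => hne ((D.tip_eq_iff).2 e)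
    exact ⟨this.1, (D.tip_eq_iff).2 this.2.1, (D.tip_eq_iff).2 this.2.2⟩

open Classical in
/-- The coordinates of a point of a product `Φ(R)`: for the classes of the factors of `R` these are
the given ones, for the others they are the tips determined by the chambers of `R`. -/
noncomputable def coord (x : D.PreBlowUp) (l : B.ParallelClass) : D.Cyl l :=
  if h : ∃ j, x.1.factor j = l then h.choose_spec ▸ x.2 h.choose
  else D.tip l x.1.1.nonempty.some

theorem coord_factor (R : B.SphericalResidue) (x : D.Phi R) (j : R.1.type) :
    D.coord ⟨R, x⟩ (R.factor j) = x j := by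
  have h : ∃ k, R.factor k = R.factor j := ⟨j, rfl⟩
  rw [coord, dif_pos h]
  have key : ∀ (k : R.1.type) (e : R.factor k = R.factor j),
      (e ▸ x k : D.Cyl (R.factor j)) = x j := by
    intro k e
    obtain rfl := R.factor_injective e
    rfl
  exact key _ h.choose_spec

theorem coord_of_ne {R : B.SphericalResidue} (x : D.Phi R) {l : B.ParallelClass}
    (hl : ∀ j, R.factor j ≠ l) {c : C} (hc : c ∈ R.1.chambers) :
    D.coord ⟨R, x⟩ l = D.tip l c := by
  rw [coord, dif_neg (by simpa using hl), tip_eq_iff]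
  exact R.π_eq hl R.1.nonempty.some_mem hc

theorem consistent_coord (x : D.PreBlowUp) : D.clauses.Consistent (D.coord x) := by
  obtain ⟨R, x⟩ := x
  have hb := R.1.nonempty.some_mem
  have key : ∀ (l : B.ParallelClass) (j : R.1.type), (∀ j, R.factor j ≠ l) →
      l.Separated (R.factor j) → D.coord ⟨R, x⟩ l = D.tip l (R.factor j).base := by
    intro l j hl h
    rw [D.coord_of_ne x hl hb, tip_eq_iff]
    exact h.π_eq (R.mem_wall_factor j hb) (base_mem _)
  intro l m h
  by_cases hl : ∃ j, R.factor j = l <;> by_cases hm : ∃ j, R.factor j = m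
  · obtain ⟨j, rfl⟩ := hl
    obtain ⟨k, rfl⟩ := hm
    exact absurd h (R.not_separated_factor j k)
  · obtain ⟨j, rfl⟩ := hl
    push Not at hm
    exact Or.inr (key m j hm h.symm)
  · obtain ⟨k, rfl⟩ := hm
    push Not at hl
    exact Or.inl (key l k hl h)
  · push Not at hl hm
    rw [D.coord_of_ne x hl hb, D.coord_of_ne x hm hb]
    exact (h.π_eq_or _).imp (D.tip_eq_iff).2 (D.tip_eq_iff).2

/-- The families of coordinates of the points of the blow-up. -/
abbrev CoordSpace (c₀ : C) : Type _ := D.clauses.Point fun l => D.tip l c₀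

/-- The point of the coordinate space with the given coordinates. -/
noncomputable def toCoordSpace (c₀ : C) (x : D.PreBlowUp) : D.CoordSpace c₀ :=
  ⟨D.coord x, D.consistent_coord x, by
    obtain ⟨R, x⟩ := x
    refine ((Set.finite_range R.factor).union
      (finite_π_ne (B := B) R.1.nonempty.some c₀)).subset fun l hl => ?_
    by_cases h : ∃ j, R.factor j = l
    · exact Or.inl h
    · right
      push Not at h
      rw [Set.mem_ofPred_eq, D.coord_of_ne x h R.1.nonempty.some_mem] at hl
      exact fun e => hl ((D.tip_eq_iff).2 e)⟩

variable {D} {c₀ : C}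

theorem toCoordSpace_factor (R : B.SphericalResidue) (x : D.Phi R) (j : R.1.type) :
    D.toCoordSpace c₀ ⟨R, x⟩ (R.factor j) = x j := D.coord_factor R x j

theorem toCoordSpace_of_ne {R : B.SphericalResidue} (x : D.Phi R) {l : B.ParallelClass}
    (hl : ∀ j, R.factor j ≠ l) {c : C} (hc : c ∈ R.1.chambers) :
    D.toCoordSpace c₀ ⟨R, x⟩ l = D.tip l c := D.coord_of_ne x hl hc

theorem toCoordSpace_eq {R : B.SphericalResidue} {u : D.CoordSpace c₀}
    (h : ∀ l, (∀ j, R.factor j ≠ l) → ∀ c ∈ R.1.chambers, u l = D.tip l c) :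
    D.toCoordSpace c₀ ⟨R, WithLp.toLp 2 fun j => u (R.factor j)⟩ = u := by
  refine ClauseSystem.Point.ext fun l => ?_
  by_cases hl : ∃ j, R.factor j = l
  · obtain ⟨j, rfl⟩ := hl
    rw [toCoordSpace_factor]
  · push Not at hl
    rw [toCoordSpace_of_ne _ hl R.1.nonempty.some_mem, h l hl _ R.1.nonempty.some_mem]

open Classical in
/-- There is a spherical residue with prescribed factors and prescribed other coordinates. -/
theorem exists_residue [Finite I] (u : D.CoordSpace c₀) {F : Set B.ParallelClass} (hfin : F.Finite)
    (hF : ∀ l ∈ F, ∀ m ∈ F, ¬ l.Separated m)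
    (hgate : ∀ l ∉ F, ∀ m ∈ F, l.Separated m → u l = D.tip l m.base)
    (htip : ∀ l ∉ F, ∃ c, u l = D.tip l c) :
    ∃ R : B.SphericalResidue, (∀ l, l ∈ F ↔ ∃ j, R.factor j = l) ∧
      ∀ l ∉ F, ∀ c ∈ R.1.chambers, u l = D.tip l c := by
  have : ∀ l, ∃ c, l ∉ F → u l = D.tip l c := fun l => by
    by_cases hl : l ∈ F
    · exact ⟨c₀, fun h => absurd hl h⟩
    · obtain ⟨c, hc⟩ := htip l hl
      exact ⟨c, fun _ => hc⟩
  choose t ht using this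
  -- Every prescription of projections on `F` is realized by a chamber, with fixed projections
  -- elsewhere.
  have key : ∀ w : B.ParallelClass → C, (∀ l, w l ∈ l.rep.1.chambers) →
      ∃ c : C, ∀ l : B.ParallelClass, l.π c = if l ∈ F then w l else l.π (t l) := by
    intro w hw
    refine exists_π_eq (fun l => ?_) (fun l m h => ?_) (c₀ := c₀) ((hfin.union u.2.2).subset ?_)
    · split_ifs
      · exact hw l
      · exact π_mem _ _
    · by_cases hl : l ∈ F <;> by_cases hm : m ∈ F
      · exact absurd h (hF l hl m hm)
      · right
        rw [if_neg hm, ← D.tip_eq_iff, ← ht m hm]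
        exact hgate m hm l hl h.symm
      · left
        rw [if_neg hl, ← D.tip_eq_iff, ← ht l hl]
        exact hgate l hl m hm h
      · rw [if_neg hl, if_neg hm, ← D.tip_eq_iff, ← ht l hl, ← D.tip_eq_iff, ← ht m hm]
        exact u.2.1 l m h
    · intro l hl
      by_cases hlF : l ∈ F
      · exact Or.inl hlF
      · right
        rw [Set.mem_ofPred_eq, if_neg hlF] at hl
        rw [Set.mem_ofPred_eq, ht l hlF]
        exact fun e => hl ((D.tip_eq_iff).1 e)
  obtain ⟨c, hc⟩ := key base base_mem_rep
  -- Change the prescription at `l` only. The two chambers obtained are separated by no class but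
  -- `l`, so the first step of a gallery between them crosses `l`.
  have hwall : ∀ l ∈ F, c ∈ l.wall := by
    intro l hl
    obtain ⟨d, hd, hne⟩ := B.exists_ne_mem_panel l.type l.base
    rw [← rep_eq] at hd
    obtain ⟨c', hc'⟩ := key (Function.update base l d) fun m => by
      by_cases hm : m = l
      · subst hm; rwa [Function.update_self]
      · rw [Function.update_of_ne hm]; exact base_mem_rep m
    have hcc : c ≠ c' := by
      rintro rfl
      have := (hc l).symm.trans (hc' l)
      rw [if_pos hl, if_pos hl, Function.update_self] at this
      exact hne this.symm
    obtain ⟨k, x', -, -, h1, -⟩ := exists_step (B := B) hcc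
    by_cases hk : B.cls k c = l
    · exact mem_wall_of_cls_eq hk
    · refine absurd ?_ h1
      rw [hc, hc', Function.update_of_ne hk]
  let J : Finset I := (hfin.image type).toFinset
  have hJ : ∀ j, j ∈ J ↔ ∃ l ∈ F, l.type = j := fun j => by simp [J]
  have hJf : Finite (W_ (J : Set I)) := by
    refine finite_standardSubgroup fun i hi j hj hij => ?_
    obtain ⟨l, hl, rfl⟩ := (hJ i).1 hi
    obtain ⟨m, hm, rfl⟩ := (hJ j).1 hj
    by_contra hadj
    exact hF l hl m hm ⟨fun e => hij (by rw [e]), fun h => hadj h.1⟩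
  let R : B.SphericalResidue := ⟨⟨J, B.residueSet J c, c, rfl⟩, hJf⟩
  have hcR : c ∈ R.1.chambers := B.mem_residueSet_self J c
  have hfac : ∀ l, l ∈ F ↔ ∃ j, R.factor j = l := by
    intro l
    constructor
    · intro hl
      exact ⟨⟨l.type, (hJ _).2 ⟨l, hl, rfl⟩⟩, (R.factor_eq _ hcR).trans (hwall l hl)⟩
    · rintro ⟨⟨j, hj⟩, rfl⟩
      obtain ⟨m, hm, rfl⟩ := (hJ j).1 hj
      have e : R.factor ⟨m.type, hj⟩ = m := (R.factor_eq _ hcR).trans (hwall m hm)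
      rw [e]
      exact hm
  refine ⟨R, hfac, fun l hl d hd => ?_⟩
  rw [ht l hl, tip_eq_iff, R.π_eq (fun j e => hl ((hfac l).2 ⟨j, e⟩)) hd hcR, hc l, if_neg hl]

theorem toCoordSpace_eq_of_glue {a b : D.PreBlowUp} (h : D.Glue a b) :
    D.toCoordSpace c₀ a = D.toCoordSpace c₀ b := by
  obtain ⟨R', R, h, x', x, h_mem, h_tip⟩ := h
  have hb := R'.1.nonempty.some_mem
  have htype : ∀ j ∈ R'.1.type, j ∈ R.1.type := by
    intro j hj
    obtain ⟨d, hd, -⟩ := B.exists_adj_right j R'.1.nonempty.some R'.1.nonempty.some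
    have hdR' := R'.mem_of_δ_mem hb (hd ▸ simple_mem_standardSubgroup hj)
    have := R.δ_mem (h hb) (h hdR')
    rw [hd] at this
    refine mem_of_isLeftDescent this ?_
    rw [CoxeterSystem.IsLeftDescent, CoxeterSystem.simple_mul_simple_self,
      CoxeterSystem.length_one, CoxeterSystem.length_simple]
    exact one_pos
  have hfac : ∀ j (hj : j ∈ R'.1.type), R'.factor ⟨j, hj⟩ = R.factor ⟨j, htype j hj⟩ :=
    fun j hj => (R'.factor_eq _ hb).trans (R.factor_eq ⟨j, htype j hj⟩ (h hb)).symm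
  refine ClauseSystem.Point.ext fun l => ?_
  by_cases hl : ∃ j, R.factor j = l
  · obtain ⟨⟨j, hj⟩, rfl⟩ := hl
    by_cases hj' : j ∈ R'.1.type
    · have e := h_mem j hj' hj
      have e1 : (⟨R'.factor ⟨j, hj'⟩, D.toCoordSpace c₀ ⟨R', x'⟩ (R'.factor ⟨j, hj'⟩)⟩ :
          Σ l, D.Cyl l) =
          ⟨R.factor ⟨j, hj⟩, D.toCoordSpace c₀ ⟨R', x'⟩ (R.factor ⟨j, hj⟩)⟩ :=
        congrArg (fun l => (⟨l, D.toCoordSpace c₀ ⟨R', x'⟩ l⟩ : Σ l, D.Cyl l)) (hfac j hj')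
      rw [toCoordSpace_factor, ← e] at e1
      rw [toCoordSpace_factor]
      exact (eq_of_heq (Sigma.mk.inj e1).2).symm
    · rw [toCoordSpace_factor, h_tip j hj hj' _ hb]
      refine toCoordSpace_of_ne _ (fun k e => hj' ?_) hb
      have := congrArg type e
      rw [SphericalResidue.type_factor, SphericalResidue.type_factor] at this
      exact (show (k : I) = j from this) ▸ k.2
  · push Not at hl
    rw [toCoordSpace_of_ne x hl (h hb)]
    exact toCoordSpace_of_ne x' (fun k e => hl _ ((hfac k k.2).symm.trans e)) hb

/-- The coordinates that are not tips. -/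
def inner (u : D.CoordSpace c₀) : Set B.ParallelClass := {l | ¬ ∃ c, u l = D.tip l c}

theorem finite_inner (u : D.CoordSpace c₀) : (inner u).Finite :=
  u.2.2.subset fun _ hl e => hl ⟨c₀, e⟩

theorem eq_tip_of_mem_inner {u : D.CoordSpace c₀} {l m : B.ParallelClass} (hm : m ∈ inner u)
    (h : l.Separated m) : u l = D.tip l m.base :=
  (u.2.1 l m h).resolve_right fun e => hm ⟨_, e⟩

/-- All points with the same coordinates are glued to a common point. -/
theorem exists_glue [Finite I] (u : D.CoordSpace c₀) :
    ∃ a₀ : D.PreBlowUp, D.toCoordSpace c₀ a₀ = u ∧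
      ∀ a : D.PreBlowUp, D.toCoordSpace c₀ a = u → D.Glue a₀ a := by
  -- The factors of `R₀` are exactly the coordinates that are not tips, so `R₀` is the smallest
  -- residue that represents `u`.
  obtain ⟨R₀, hfac, hR₀⟩ := exists_residue u (finite_inner u)
    (fun l hl m hm h => hl ⟨_, eq_tip_of_mem_inner hm h⟩)
    (fun l _ m hm h => eq_tip_of_mem_inner hm h) (fun l hl => not_not.1 hl)
  refine ⟨⟨R₀, WithLp.toLp 2 fun j => u (R₀.factor j)⟩,
    toCoordSpace_eq fun l hl => hR₀ l fun h => ?_, ?_⟩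
  · obtain ⟨j, hj⟩ := (hfac l).1 h
    exact hl j hj
  rintro ⟨R, x⟩ hx
  have hb := R.1.nonempty.some_mem
  have hc := R₀.1.nonempty.some_mem
  set b := R.1.nonempty.some
  set c := R₀.1.nonempty.some
  have hinner : ∀ l ∈ inner u, ∃ j, R.factor j = l := by
    intro l hl
    by_contra! hcon
    exact hl ⟨b, by rw [← hx, toCoordSpace_of_ne x hcon hb]⟩
  -- At a class that is not a factor of `R` both chambers project to the same tip, so only factors
  -- of `R` separate them.
  have hcR : c ∈ R.1.chambers := by
    refine R.mem_of_δ_mem hb (δ_mem_of_forall_type_mem fun l hl => ?_)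
    by_contra ht
    have hne : ∀ j, R.factor j ≠ l := by
      rintro j rfl
      rw [SphericalResidue.type_factor] at ht
      exact ht j.2
    have hli : l ∉ inner u := fun h => by
      obtain ⟨j, hj⟩ := hinner l h
      exact hne j hj
    have e := hR₀ l hli c hc
    rw [← hx, toCoordSpace_of_ne x hne hb, tip_eq_iff] at e
    exact hl e
  have htype : ∀ j ∈ R₀.1.type, j ∈ R.1.type := by
    intro j hj
    obtain ⟨k, hk⟩ := hinner _ ((hfac _).2 ⟨⟨j, hj⟩, rfl⟩)
    have := congrArg type hk
    rw [SphericalResidue.type_factor, SphericalResidue.type_factor] at this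
    exact (show (k : I) = j from this) ▸ k.2
  have hxj : ∀ j, x j = u (R.factor j) := fun j => by rw [← hx, toCoordSpace_factor]
  refine Glue.mk R₀ R (fun d hd => ?_) _ x (fun j hj' hj => ?_) fun j hj hj' d hd => ?_
  · exact R.mem_of_δ_mem hcR (standardSubgroup_mono htype (R₀.δ_mem hc hd))
  · have e : R.factor ⟨j, hj⟩ = R₀.factor ⟨j, hj'⟩ :=
      (R.factor_eq _ hcR).trans (R₀.factor_eq ⟨j, hj'⟩ hc).symm
    rw [hxj]
    exact congrArg (fun l => (⟨l, u l⟩ : Σ l, D.Cyl l)) e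
  · rw [hxj]
    refine hR₀ _ (fun h => hj' ?_) d hd
    obtain ⟨k, hk⟩ := (hfac _).1 h
    have := congrArg type hk
    rw [SphericalResidue.type_factor, SphericalResidue.type_factor] at this
    exact (show (k : I) = j from this) ▸ k.2

/-! ### The metric of the blow-up -/

theorem isStep_toCoordSpace {R : B.SphericalResidue} (x y : D.Phi R) :
    ClauseSystem.Point.IsStep (D.toCoordSpace c₀ ⟨R, x⟩) (D.toCoordSpace c₀ ⟨R, y⟩) := by
  have key : ∀ l, D.toCoordSpace c₀ ⟨R, x⟩ l ≠ D.toCoordSpace c₀ ⟨R, y⟩ l →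
      ∃ j, R.factor j = l := by
    intro l h
    by_contra! hl
    exact h (by rw [toCoordSpace_of_ne x hl R.1.nonempty.some_mem,
      toCoordSpace_of_ne y hl R.1.nonempty.some_mem])
  intro l m hl hm
  obtain ⟨j, rfl⟩ := key l hl
  obtain ⟨k, rfl⟩ := key m hm
  exact R.not_separated_factor j k

open Classical in
theorem edist_toCoordSpace {R : B.SphericalResidue} (x y : D.Phi R) :
    edist (D.toCoordSpace c₀ ⟨R, x⟩) (D.toCoordSpace c₀ ⟨R, y⟩) = edist x y := by
  have h2 : (2 : ℝ≥0∞).toReal = 2 := by simp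
  rw [edist_dist, (isStep_toCoordSpace x y).dist_eq,
    ClauseSystem.Point.l2_eq (Finset.univ.image R.factor), Finset.sum_image
      fun j _ k _ h => R.factor_injective h, PiLp.edist_eq_sum (by rw [h2]; norm_num), h2]
  · simp only [toCoordSpace_factor]
    have e : ∀ j, edist (x j) (y j) = ENNReal.ofReal (dist (x j) (y j)) := fun j => edist_dist _ _
    simp only [e]
    rw [Real.sqrt_eq_rpow, ← ENNReal.ofReal_rpow_of_nonneg (Finset.sum_nonneg fun j _ =>
      sq_nonneg _) (by norm_num), ENNReal.ofReal_sum_of_nonneg fun j _ => sq_nonneg _]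
    congr 1
    refine Finset.sum_congr rfl fun j _ => ?_
    rw [ENNReal.ofReal_pow dist_nonneg]
    norm_cast
  · intro l hl
    have hl' : ∀ j, R.factor j ≠ l := fun j e => hl (Finset.mem_image.2 ⟨j, Finset.mem_univ _, e⟩)
    rw [toCoordSpace_of_ne x hl' R.1.nonempty.some_mem,
      toCoordSpace_of_ne y hl' R.1.nonempty.some_mem]

theorem edist_toCoordSpace_le (a b : D.PreBlowUp) :
    edist (D.toCoordSpace c₀ a) (D.toCoordSpace c₀ b) ≤ D.preDist a b := by
  obtain ⟨R, x⟩ := a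
  obtain ⟨R', y⟩ := b
  by_cases h : R = R'
  · subst h
    rw [edist_toCoordSpace, preDist, dif_pos rfl]
    exact le_rfl
  · rw [preDist, dif_neg h]; exact le_top

/-- A step in the coordinate space takes place in the product of a residue. -/
theorem exists_phi_of_isStep [Finite I] {u v : D.CoordSpace c₀}
    (h : ClauseSystem.Point.IsStep u v) : ∃ (R : B.SphericalResidue) (x y : D.Phi R),
      D.toCoordSpace c₀ ⟨R, x⟩ = u ∧ D.toCoordSpace c₀ ⟨R, y⟩ = v := by
  have hdiff : ∀ l m, u l = v l → u m ≠ v m → l.Separated m → u l = D.tip l m.base := by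
    intro l m hl hm hs
    by_contra hne
    have h1 := (u.2.1 l m hs).resolve_left hne
    have h2 := (v.2.1 l m hs).resolve_left fun e => hne (hl.trans e)
    exact hm (h1.trans h2.symm)
  have hmix : ∀ l m, u l ≠ v l → m ∈ inner u → ¬ l.Separated m := by
    intro l m hl hm hs
    have hmv : u m = v m := by
      by_contra hne
      exact h l m hl hne hs
    refine hl ((eq_tip_of_mem_inner hm hs).trans (eq_tip_of_mem_inner (?_ : m ∈ inner v) hs).symm)
    rintro ⟨c, hc⟩
    exact hm ⟨c, hmv.trans hc⟩
  -- The factors of `R` have to include the coordinates that change and those that are not tips.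
  obtain ⟨R, hfac, hR⟩ : ∃ R : B.SphericalResidue,
      (∀ l, l ∈ {l | u l ≠ v l} ∪ inner u ↔ ∃ j, R.factor j = l) ∧
      ∀ l ∉ {l | u l ≠ v l} ∪ inner u, ∀ c ∈ R.1.chambers, u l = D.tip l c := by
    refine exists_residue u ((u.finite_diff v).union (finite_inner u)) ?_ ?_ ?_
    · rintro l (hl | hl) m (hm | hm)
      · exact h l m hl hm
      · exact hmix l m hl hm
      · exact fun hs => hmix m l hm hl hs.symm
      · exact fun hs => hl ⟨_, eq_tip_of_mem_inner hm hs⟩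
    · rintro l hl m (hm | hm) hs
      · refine hdiff l m ?_ hm hs
        by_contra hne
        exact hl (Or.inl hne)
      · exact eq_tip_of_mem_inner hm hs
    · intro l hl
      by_contra hcon
      exact hl (Or.inr hcon)
  have hout : ∀ l, (∀ j, R.factor j ≠ l) → l ∉ {l | u l ≠ v l} ∪ inner u := by
    intro l hl hlF
    obtain ⟨j, hj⟩ := (hfac l).1 hlF
    exact hl j hj
  refine ⟨R, _, _, toCoordSpace_eq (u := u) fun l hl => hR l (hout l hl),
    toCoordSpace_eq (u := v) fun l hl => ?_⟩
  have e : u l = v l := by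
    by_contra hne
    exact hout l hl (Or.inl hne)
  rw [← e]
  exact hR l (hout l hl)

/-- By `exists_glue` all representatives with given coordinates are glued directly to one of them.
-/
theorem mk_eq_mk_iff [Finite I] {a b : D.PreBlowUp} :
    (Quotient.mk (Relation.EqvGen.setoid D.Glue) a = Quotient.mk _ b) ↔
      D.toCoordSpace c₀ a = D.toCoordSpace c₀ b := by
  constructor
  · intro h
    have h' : Relation.EqvGen D.Glue a b := Quotient.exact h
    clear h
    induction h' with
    | rel _ _ h => exact toCoordSpace_eq_of_glue h
    | refl => rfl
    | symm _ _ _ ih => exact ih.symm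
    | trans _ _ _ _ _ ih1 ih2 => exact ih1.trans ih2
  · intro h
    obtain ⟨a₀, -, h₀⟩ := exists_glue (D.toCoordSpace c₀ b)
    exact Quotient.sound (.trans _ _ _ (.symm _ _ (.rel _ _ (h₀ a h))) (.rel _ _ (h₀ b rfl)))

variable (D c₀) in
/-- The blow-up is identified with the coordinate space. -/
noncomputable def coordMap [Finite I] : D.BlowUp → D.CoordSpace c₀ :=
  Quotient.lift (D.toCoordSpace c₀) fun _ _ h => mk_eq_mk_iff.1 (Quotient.sound h)

theorem coordMap_bijective [Finite I] : Function.Bijective (D.coordMap c₀) := by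
  constructor
  · intro a b h
    induction a using Quotient.inductionOn
    induction b using Quotient.inductionOn
    exact mk_eq_mk_iff.2 h
  · intro u
    obtain ⟨a, ha, -⟩ := exists_glue u
    exact ⟨Quotient.mk _ a, ha⟩

theorem blowUpDist_le_of_chain [Finite I] {u v : D.CoordSpace c₀} {r : ℝ}
    (h : ClauseSystem.Point.Chain u v r) {a b : D.BlowUp} (ha : D.coordMap c₀ a = u)
    (hb : D.coordMap c₀ b = v) : D.blowUpDist a b ≤ ENNReal.ofReal r := by
  induction h generalizing a with
  | refl x =>
    obtain rfl := coordMap_bijective.1 (ha.trans hb.symm)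
    refine (quotientEDist_self (fun x => ?_) a).le.trans bot_le
    rw [preDist, dif_pos rfl]
    exact edist_self x.2
  | @step u w v r hstep hchain ih =>
    obtain ⟨R, x, y, hx, hy⟩ := exists_phi_of_isStep hstep
    have e : a = Quotient.mk _ (⟨R, x⟩ : D.PreBlowUp) := coordMap_bijective.1 (ha.trans hx.symm)
    rw [ENNReal.ofReal_add (ClauseSystem.Point.l2_nonneg _ _) hchain.nonneg]
    refine (quotientEDist_triangle a (Quotient.mk _ (⟨R, y⟩ : D.PreBlowUp)) b).trans
      (add_le_add ?_ (ih hy hb))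
    rw [e]
    refine (quotientEDist_le_dist _ _).trans ?_
    rw [preDist, dif_pos rfl, ← hstep.dist_eq, ← edist_dist, ← hx, ← hy, edist_toCoordSpace]
    exact le_rfl

/-- The coordinate map does not increase distances on the pieces and respects gluing, which bounds
the quotient distance from below. Conversely, each step of a chain is realized in one `Φ(R)` with
the same length. -/
theorem blowUpDist_eq [Finite I] (a b : D.BlowUp) :
    edist (D.coordMap c₀ a) (D.coordMap c₀ b) = D.blowUpDist a b := by
  refine le_antisymm ?_ ?_
  · induction a using Quotient.inductionOn
    induction b using Quotient.inductionOn
    refine edist_le_quotientEDist (D.toCoordSpace c₀) edist_toCoordSpace_le (fun x y h => ?_) _ _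
    rw [(mk_eq_mk_iff (c₀ := c₀)).1 (Quotient.sound h), edist_self]
  · rw [edist_dist]
    refine ENNReal.le_of_forall_pos_le_add fun ε hε _ => ?_
    obtain ⟨r, hr, hc⟩ := ClauseSystem.Point.exists_chain_lt
      (lt_add_of_pos_right (dist (D.coordMap c₀ a) (D.coordMap c₀ b)) (NNReal.coe_pos.2 hε))
    refine (blowUpDist_le_of_chain hc rfl rfl).trans ?_
    refine (ENNReal.ofReal_le_ofReal hr.le).trans ?_
    exact ENNReal.ofReal_add_le.trans_eq (by rw [ENNReal.ofReal_coe_nnreal])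

end BlowUpData

end RightAngledBlowUp

/-! ### The theorem: transfer of the metric from the coordinate space -/

theorem mainTheorem10 {I : Type*} [Finite I] (Γ : SimpleGraph I) {C : Type*}
    (B : Building (rightAngledMatrix Γ) C) (D : BlowUpData B) (hZ : ∀ l, IsCAT0 (D.Z l)) :
    ∃ _ : MetricSpace D.BlowUp,
      (∀ a b : D.BlowUp, edist a b = D.blowUpDist a b) ∧ IsCAT0 D.BlowUp := by
  obtain ⟨c₀⟩ := B.nonempty
  have hbij := BlowUpData.coordMap_bijective (D := D) (c₀ := c₀)
  let m : MetricSpace D.BlowUp := MetricSpace.induced (D.coordMap c₀) hbij.1 inferInstance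
  refine ⟨m, fun a b => BlowUpData.blowUpDist_eq a b, ?_⟩
  have hcat : IsCAT0 (D.CoordSpace c₀) :=
    ClauseSystem.Point.isCAT0 fun l => MappingCylinder.isCAT0 (hZ _)
  obtain ⟨ψ, hψ⟩ := hbij.2.hasRightInverse
  have hψ' : Function.LeftInverse ψ (D.coordMap c₀) := fun a => hbij.1 (hψ _)
  have := hcat.isCNSet.image ψ fun x _ y _ => by
    change dist (D.coordMap c₀ (ψ x)) (D.coordMap c₀ (ψ y)) = _
    rw [hψ, hψ]
  rw [Set.image_univ, hψ'.surjective.range_eq] at this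
  exact this.isCAT0
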